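/- **Mean-field consistency (existence of a fixed point).** Let $T>0$ and $d,m\in\mathbb N$. Let $\mathcal M$ be the Banach space of finite signed Borel measures on $\mathbb R^d$ with the norm $\|\rho\|^*=\sup\{|(f,\rho)| : f\in C_\infty(\mathbb R^d),\ \|f\|_\infty\le 1\}$, where $(f,\rho)=\int f\,d\rho$ and $C_\infty(\mathbb R^d)$ is the space of continuous functions vanishing at infinity. Let $\mathcal M_1$ be its closed unit ball and $\mathcal P=\mathcal P(\mathbb R^d)\subset\mathcal M_1$ the set of probability measures, and let $C([0,T],\mathcal P)$ be the set of $\|\cdot\|^*$-continuous curves. Let $\nu(t,x,\rho,u,dy)$ be a finite nonnegative jump kernel, $J(t,x,\rho,u)$ a running payoff and $V^T(x,\rho)$ a terminal payoff, all given for $t\in[0,T]$, $x\in\mathbb R^d$, $\rho\in\mathcal M_1$, $u\in U\subset\mathbb R^m$. Put $$A[t,x,\rho,u]f=\int_{\mathbb R^d}(f(y)-f(x))\,\nu(t,x,\rho,u,dy).$$ *Hypothesis A.* The masses of the kernel $\nu$ are uniformly bounded, $\nu(t,x,\rho,u,\{x\})=0$, $\nu$ is continuous in $t$ and Lipschitz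 in $(x,\rho,u)$, uniformly in all arguments, where measures carry the norm $\|\cdot\|^*$. *Hypothesis B.* The set $U$ is compact and convex with nonempty interior. $J$ is bounded, concave in $u$, continuous in $t$, and Lipschitz in $(x,\rho)$ uniformly in all arguments. $V^T$ is bounded, continuous in $x$, and Lipschitz in $\rho$ uniformly in $x$. $J$ is $C^2$ in $u\in U$, and so is $A[t,x,\rho,u]f$ for every bounded continuous $f$. Moreover there are $L\ge 0$ and $c>0$ such that, for every $\mu\in C([0,T],\mathcal P)$ and every $V\in C_b([0,T]\times\mathbb R^d)$ that solves the Hamilton–Jacobi–Bellman equation $$\partial_t V(t,x)+\max_{u\in U}\Theta^{\mu,V}(t,x,u)=0,\qquad V(T,x)=V^T(x,\mu_T),$$ $$\text{where}\quad \Theta^{\mu,V}(t,x,u)=J(t,x,\mu_t,u)+A[t,x,\mu_t,u]V(t,\cdot),$$ the gradient $\Theta^{\mu,V}_u$ is $L$-Lipschitz in $x$ uniformly in $t\in[0,T]$ and $u\in U$, and all eigenvalues of the Hessian $\Theta^{\mu,V}_{uu}$ are at most $-c$ on $[0,T]\times\mathbb R^d\times U$. Assume Hypotheses A and B and let $\mu_0\in\mathcal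 P$. Then for every $\mu\in C([0,T],\mathcal P)$: 1. The Hamilton–Jacobi–Bellman equation for $\mu$ has a unique solution $V=V(\cdot,\cdot;\mu)\in C_b([0,T]\times\mathbb R^d)$. 2. For all $(t,x)$, $\Theta^{\mu,V}(t,x,\cdot)$ has a unique maximizer $\Gamma(t,x;\mu)$ over $U$. The map $\Gamma(\cdot,\cdot;\mu)$ is an optimal Borel feedback control and $V$ is the value function: for every $(t,x)$, $$V(t,x)=\max_\gamma \mathbb E\Big[\int_t^T J(s,X_s,\mu_s,\gamma(s,X_s))\,ds+V^T(X_T,\mu_T)\,\Big|\,X_t=x\Big]$$ over all Borel maps $\gamma:[0,T]\times\mathbb R^d\to U$, where $X$ is the jump Markov process with generator $A[s,\cdot,\mu_s,\gamma(s,\cdot)]$ (its laws being given by the forward Kolmogorov equation), and the maximum is attained at $\gamma=\Gamma(\cdot,\cdot;\mu)$. 3. There is a unique curve $\hat\mu=:\mathcal T(\mu)\in C([0,T],\mathcal P)$ with $$\frac{d}{dt}\hat\mu_t=A^*[t,\hat\mu_t,\Gamma(t,\cdot;\mu)]\hat\mu_t\ \ (t\in[0,T]),\qquad \hat\mu_0=\mu_0,$$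 where the derivative is taken in the norm $\|\cdot\|^*$ and $A^*$ is the adjoint of $A$, i.e. $(g,A^*[t,\rho,\gamma]\eta)=(A[t,\cdot,\rho,\gamma(\cdot)]g,\eta)$ for $g\in C_\infty(\mathbb R^d)$. The map $\mathcal T$ has a fixed point: there is $\mu\in C([0,T],\mathcal P)$ with $\mathcal T(\mu)=\mu$. Thus $\mu$ solves the kinetic equation driven by the feedback control $\Gamma(\cdot,\cdot;\mu)$ that is optimal against $\mu$, so $(\mu,\Gamma(\cdot,\cdot;\mu))$ is a consistent pair of mean-field flow and optimal control. -/

import Mathlib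

open MeasureTheory Set
open scoped ZeroAtInfty BoundedContinuousFunction

noncomputable section

/-- The state space `ℝ^d`; controls live in `ℝ^m`. -/
abbrev Euc (n : ℕ) := EuclideanSpace ℝ (Fin n)

/-- The norm `‖ρ‖* = sup { |(f, ρ)| : f ∈ C_∞(ℝ^d), ‖f‖_∞ ≤ 1 }` on the space `𝓜` of finite signed
measures on `ℝ^d` (the total variation norm). -/
def starNorm {d : ℕ} (ρ : SignedMeasure (Euc d)) : ℝ :=
  ⨆ f : {f : C₀(Euc d, ℝ) // ‖f‖ ≤ 1}, |∫ᵛ x, f.1 x ∂<•ρ|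

/-- The closed unit ball `𝓜₁` of `𝓜`. -/
def unitBall (d : ℕ) : Set (SignedMeasure (Euc d)) := {ρ | starNorm ρ ≤ 1}

/-- A probability measure on `ℝ^d`, as an element of `𝓜`. -/
def probToSigned {d : ℕ} (p : ProbabilityMeasure (Euc d)) : SignedMeasure (Euc d) :=
  (p : Measure (Euc d)).toSignedMeasure

/-- A finite nonnegative measure on `ℝ^d`, as an element of `𝓜`. -/
def finToSigned {d : ℕ} (p : FiniteMeasure (Euc d)) : SignedMeasure (Euc d) :=
  (p : Measure (Euc d)).toSignedMeasure

/-- The data of the game: horizon `T`, control set `U`, jump kernel `ν(t, x, ρ, u, dy)` (`y` is the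
state after the jump), running payoff `J` and terminal payoff `V^T`. Only their values for
`t ∈ [0, T]`, `ρ ∈ 𝓜₁` and `u ∈ U` matter. -/
structure MeanFieldGame (d m : ℕ) where
  T : ℝ
  T_pos : 0 < T
  U : Set (Euc m)
  ν : ℝ → Euc d → SignedMeasure (Euc d) → Euc m → FiniteMeasure (Euc d)
  J : ℝ → Euc d → SignedMeasure (Euc d) → Euc m → ℝ
  VT : Euc d → SignedMeasure (Euc d) → ℝ

namespace MeanFieldGame

variable {d m : ℕ} (G : MeanFieldGame d m)

/-- The time interval `[0, T]`. -/
def I : Set ℝ := Icc 0 G.T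

/-- The jump generator `A[t, x, ρ, u] f = ∫ (f(y) - f(x)) ν(t, x, ρ, u, dy)`. -/
def gen (t : ℝ) (x : Euc d) (ρ : SignedMeasure (Euc d)) (u : Euc m) (f : Euc d → ℝ) : ℝ :=
  ∫ y, (f y - f x) ∂(G.ν t x ρ u : Measure (Euc d))

/-- Elements of `C([0, T], 𝓟(ℝ^d))`, where `𝓟(ℝ^d)` carries the topology of the norm `‖·‖*`.
Curves are functions on `ℝ`, of which only the restriction to `[0, T]` is used. -/
def IsCurve (μ : ℝ → ProbabilityMeasure (Euc d)) : Prop :=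
  ∀ t ∈ G.I, ∀ ε > 0, ∃ δ > 0, ∀ s ∈ G.I, |s - t| < δ →
    starNorm (probToSigned (μ s) - probToSigned (μ t)) < ε

/-- `Θ(t, x, μ_t, u) = J(t, x, μ_t, u) + A[t, x, μ_t, u] V(t, ·)`. -/
def Theta (μ : ℝ → ProbabilityMeasure (Euc d)) (V : ℝ → Euc d → ℝ) (t : ℝ) (x : Euc d)
    (u : Euc m) : ℝ :=
  G.J t x (probToSigned (μ t)) u + G.gen t x (probToSigned (μ t)) u (V t)

/-- `u` is a maximizer over `U` of `Θ(t, x, μ_t, ·)`. -/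
def IsMaximizer (μ : ℝ → ProbabilityMeasure (Euc d)) (V : ℝ → Euc d → ℝ) (t : ℝ) (x : Euc d)
    (u : Euc m) : Prop :=
  u ∈ G.U ∧ ∀ v ∈ G.U, G.Theta μ V t x v ≤ G.Theta μ V t x u

/-- `V ∈ C_b([0, T] × ℝ^d)` solves the Hamilton-Jacobi-Bellman equation
`∂V/∂t + max_{u ∈ U} [J(t, x, μ_t, u) + A[t, x, μ_t, u] V] = 0`, `V(T, x) = V^T(x, μ_T)`. -/
structure IsHJBSolution (μ : ℝ → ProbabilityMeasure (Euc d)) (V : ℝ → Euc d → ℝ) : Prop where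
  continuousOn : ContinuousOn (fun p : ℝ × Euc d => V p.1 p.2) (G.I ×ˢ univ)
  bounded : ∃ C, ∀ t ∈ G.I, ∀ x, |V t x| ≤ C
  terminal : ∀ x, V G.T x = G.VT x (probToSigned (μ G.T))
  equation : ∀ t ∈ G.I, ∀ x, ∃ h, IsGreatest (G.Theta μ V t x '' G.U) h ∧
    HasDerivWithinAt (fun s => V s x) (-h) G.I t

/-- Feedback controls: Borel measurable maps `γ : [0, T] × ℝ^d → U`. -/
structure IsFeedback (γ : ℝ → Euc d → Euc m) : Prop where
  measurable : Measurable (fun p : Icc (0 : ℝ) G.T × Euc d => γ p.1 p.2)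
  mem : ∀ t ∈ G.I, ∀ x, γ t x ∈ G.U

/-- `η` is the curve of probability measures that starts at `μ₀` and solves the kinetic equation
`dη_t/dt = A*[t, η_t, γ(t, ·)] η_t` on `[0, T]`. The derivative is taken in the norm `‖·‖*`, that
is, uniformly over test functions `g ∈ C_∞(ℝ^d)` with `‖g‖_∞ ≤ 1`, and
`(g, A*[t, ρ, γ] η) = (A[t, ρ, γ] g, η)`. -/
structure IsKineticSolution (μ₀ : ProbabilityMeasure (Euc d)) (γ : ℝ → Euc d → Euc m)
    (η : ℝ → ProbabilityMeasure (Euc d)) : Prop where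
  curve : G.IsCurve η
  initial : η 0 = μ₀
  equation : ∀ t ∈ G.I, ∀ ε > 0, ∃ δ > 0, ∀ s ∈ G.I, |s - t| < δ →
    ∀ g : C₀(Euc d, ℝ), ‖g‖ ≤ 1 →
      |∫ x, g x ∂(η s : Measure (Euc d)) - ∫ x, g x ∂(η t : Measure (Euc d))
        - (s - t) * ∫ x, G.gen t x (probToSigned (η t)) (γ t x) g ∂(η t : Measure (Euc d))|
      ≤ ε * |s - t|

/-- `p s`, `t ≤ s ≤ T`, is the law at time `s` of the jump Markov process of a single player, with
generator `A[r, y, μ_r, γ(r, y)]`, that starts at time `t` in the state `x`: the solution of the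
forward Kolmogorov equation with initial value `δ_x`. -/
def IsStateLaw (μ : ℝ → ProbabilityMeasure (Euc d)) (γ : ℝ → Euc d → Euc m) (t : ℝ) (x : Euc d)
    (p : ℝ → ProbabilityMeasure (Euc d)) : Prop :=
  ∀ s ∈ Icc t G.T, ∀ g : C₀(Euc d, ℝ),
    ∫ y, g y ∂(p s : Measure (Euc d)) = g x +
      ∫ r in t..s, ∫ y, G.gen r y (probToSigned (μ r)) (γ r y) g ∂(p r : Measure (Euc d))

/-- The expected payoff `E[∫_t^T J(s, X_s, μ_s, γ(s, X_s)) ds + V^T(X_T, μ_T)]`, where `X_s` has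
law `p s`. -/
def payoff (μ : ℝ → ProbabilityMeasure (Euc d)) (γ : ℝ → Euc d → Euc m) (t : ℝ)
    (p : ℝ → ProbabilityMeasure (Euc d)) : ℝ :=
  (∫ s in t..G.T, ∫ y, G.J s y (probToSigned (μ s)) (γ s y) ∂(p s : Measure (Euc d)))
    + ∫ y, G.VT y (probToSigned (μ G.T)) ∂(p G.T : Measure (Euc d))

/-- The payoffs from `(t, x)` that some feedback control achieves against the flow `μ`. -/
def payoffs (μ : ℝ → ProbabilityMeasure (Euc d)) (t : ℝ) (x : Euc d) : Set ℝ :=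
  {K | ∃ γ p, G.IsFeedback γ ∧ G.IsStateLaw μ γ t x p ∧ K = G.payoff μ γ t p}

/-- `γ` is an optimal feedback control against the flow `μ`, from every `(t, x)`, and `V` is the
value function. -/
def IsOptimalFeedback (μ : ℝ → ProbabilityMeasure (Euc d)) (V : ℝ → Euc d → ℝ)
    (γ : ℝ → Euc d → Euc m) : Prop :=
  G.IsFeedback γ ∧ ∀ t ∈ G.I, ∀ x, IsGreatest (G.payoffs μ t x) (V t x) ∧
    ∃ p, G.IsStateLaw μ γ t x p ∧ G.payoff μ γ t p = V t x

/-- Assumptions on the jump kernel: uniformly bounded, no jumps onto the spot, continuous in `t`,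
uniformly Lipschitz in `(x, ρ, u)`, where measures carry the norm `‖·‖*`. -/
structure HypothesisA : Prop where
  bounded : ∃ C, ∀ t ∈ G.I, ∀ x, ∀ ρ ∈ unitBall d, ∀ u ∈ G.U, (G.ν t x ρ u).mass ≤ C
  no_stay : ∀ t ∈ G.I, ∀ x, ∀ ρ ∈ unitBall d, ∀ u ∈ G.U, G.ν t x ρ u {x} = 0
  continuous_time : ∀ x, ∀ ρ ∈ unitBall d, ∀ u ∈ G.U, ∀ t ∈ G.I, ∀ ε > 0, ∃ δ > 0,
    ∀ s ∈ G.I, |s - t| < δ →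
      starNorm (finToSigned (G.ν s x ρ u) - finToSigned (G.ν t x ρ u)) < ε
  lipschitz : ∃ L, ∀ t ∈ G.I, ∀ x x', ∀ ρ ∈ unitBall d, ∀ ρ' ∈ unitBall d,
    ∀ u ∈ G.U, ∀ u' ∈ G.U,
      starNorm (finToSigned (G.ν t x ρ u) - finToSigned (G.ν t x' ρ' u'))
        ≤ L * (‖x - x'‖ + starNorm (ρ - ρ') + ‖u - u'‖)

/-- Assumptions on the control set and the payoffs. In `theta_lipschitz` and `theta_concave`, `Θ` is
formed with the solution `V` of the Hamilton-Jacobi-Bellman equation for the curve `μ`. -/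
structure HypothesisB : Prop where
  U_compact : IsCompact G.U
  U_convex : Convex ℝ G.U
  U_interior : (interior G.U).Nonempty
  J_bounded : ∃ C, ∀ t ∈ G.I, ∀ x, ∀ ρ ∈ unitBall d, ∀ u ∈ G.U, |G.J t x ρ u| ≤ C
  J_concave : ∀ t ∈ G.I, ∀ x, ∀ ρ ∈ unitBall d, ConcaveOn ℝ G.U (G.J t x ρ)
  J_continuous_time : ∀ x, ∀ ρ ∈ unitBall d, ∀ u ∈ G.U, ContinuousOn (fun t => G.J t x ρ u) G.I
  J_lipschitz : ∃ L, ∀ t ∈ G.I, ∀ x x', ∀ ρ ∈ unitBall d, ∀ ρ' ∈ unitBall d, ∀ u ∈ G.U,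
    |G.J t x ρ u - G.J t x' ρ' u| ≤ L * (‖x - x'‖ + starNorm (ρ - ρ'))
  VT_bounded : ∃ C, ∀ x, ∀ ρ ∈ unitBall d, |G.VT x ρ| ≤ C
  VT_continuous : ∀ ρ ∈ unitBall d, Continuous (fun x => G.VT x ρ)
  VT_lipschitz : ∃ L, ∀ x, ∀ ρ ∈ unitBall d, ∀ ρ' ∈ unitBall d,
    |G.VT x ρ - G.VT x ρ'| ≤ L * starNorm (ρ - ρ')
  J_contDiff : ∀ t ∈ G.I, ∀ x, ∀ ρ ∈ unitBall d, ContDiffOn ℝ 2 (G.J t x ρ) G.U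
  gen_contDiff : ∀ t ∈ G.I, ∀ x, ∀ ρ ∈ unitBall d, ∀ f : Euc d →ᵇ ℝ,
    ContDiffOn ℝ 2 (fun u => G.gen t x ρ u f) G.U
  /-- `Θ_u` is Lipschitz in `x`, uniformly in the other arguments. -/
  theta_lipschitz : ∃ L, ∀ μ V, G.IsCurve μ → G.IsHJBSolution μ V →
    ∀ t ∈ G.I, ∀ x x', ∀ u ∈ G.U,
      ‖fderivWithin ℝ (G.Theta μ V t x) G.U u - fderivWithin ℝ (G.Theta μ V t x') G.U u‖
        ≤ L * ‖x - x'‖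
  /-- The eigenvalues of the Hessian `Θ_uu` are at most `-c < 0`, uniformly. -/
  theta_concave : ∃ c > 0, ∀ μ V, G.IsCurve μ → G.IsHJBSolution μ V →
    ∀ t ∈ G.I, ∀ x, ∀ u ∈ G.U, ∀ w : Euc m,
      iteratedFDerivWithin ℝ 2 (G.Theta μ V t x) G.U u ![w, w] ≤ -c * ‖w‖ ^ 2

end MeanFieldGame

end

/-! For a fixed flow everything reduces to integral equations. Integrated backwards from `T`, the
Hamilton–Jacobi–Bellman equation is a Volterra equation whose Hamiltonian is Lipschitz in `V`, so
Picard iteration gives exactly one bounded continuous solution (`isHJBSolution_iff`,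
`hjb_fixedPoint_exists`); the solution is Lipschitz in the flow (`abs_value_sub_le`). Uniform
concavity makes the maximizer unique, Lipschitz in `x` with a constant independent of the flow
(`norm_argmax_sub_le`) and Hölder continuous in the flow (`norm_argmax_sub_argmax_sq_le`). It is
optimal because the payoff of any feedback is `V` minus the accumulated gap between the Hamiltonian
and `Θ` (`IsStateLaw.payoff_eq`).

If `C` bounds the jump rates, the adjoint generator is `C (jump - 1)`, where `jump` sends
probability measures to probability measures. The kinetic equation is therefore a relaxation
equation in a closed convex set of the dual of `C_∞(ℝ^d)`, solved by Picard iteration inside that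
set (`exists_relaxation_solution`) and stable under changes of the control
(`dist_kineticSolution_le`).

The fixed point comes from Schauder's theorem (`exists_fixedPoint_of_isCompact`) in the space of
continuous curves in that dual. The difficulty is compactness, since sets of probability measures
are rarely compact in total variation. The optimal controls, however, are uniformly Lipschitz, hence
precompact on balls, and a single law has little mass far away. So one jump with such a control maps
totally bounded sets of laws to totally bounded sets (`totallyBounded_jump`). All Picard iterates of
a given order then lie in one totally bounded set, and since the iteration converges at a rate
independent of the control, so do all reachable laws (`totallyBounded_reachSet`). Together with a
uniform Lipschitz bound in time this gives compactness of the response map by Arzelà–Ascoli. -/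

/-! ### No `C¹` retraction of the ball onto its sphere (volume argument of Milnor and Rogers). -/

section Brouwer

/-- `det (1 + t A)` at `t = 1` is a fixed affine combination of its values at given nodes. -/
theorem exists_det_interpolation (n : ℕ) (τ : Fin (n + 1) → ℝ) (hτ : Function.Injective τ) :
    ∃ w : Fin (n + 1) → ℝ, ∑ i, w i = 1 ∧
      ∀ A : EuclideanSpace ℝ (Fin n) →L[ℝ] EuclideanSpace ℝ (Fin n),
        (1 + A).det = ∑ i, w i * (1 + τ i • A).det := by
  -- The determinant is a polynomial in `t` of degree at most `n`, so it equals its Lagrange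
  -- interpolant at `n + 1` nodes. The weights depend on the nodes alone.
  refine ⟨fun i => (Lagrange.basis Finset.univ τ i).eval 1, ?_, fun A => ?_⟩
  · have h := Lagrange.sum_basis (s := Finset.univ) (v := τ) hτ.injOn Finset.univ_nonempty
    have := congrArg (Polynomial.eval 1) h
    simpa [Polynomial.eval_finsetSum] using this
  · let b := (EuclideanSpace.basisFun (Fin n) ℝ).toBasis
    let M := LinearMap.toMatrix b b A.toLinearMap
    let q : Polynomial ℝ := ((Polynomial.X : Polynomial ℝ) • M.map (⇑(Polynomial.C : ℝ →+* _))
      + (1 : Matrix (Fin n) (Fin n) ℝ).map (⇑(Polynomial.C : ℝ →+* _))).det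
    have hq : ∀ t : ℝ, q.eval t = (1 + t • A).det := by
      intro t
      have h1 : q.eval t = (1 + t • M).det := by
        simp only [q]
        rw [← Polynomial.coe_evalRingHom, RingHom.map_det]
        congr 1
        ext i j
        rw [RingHom.mapMatrix_apply, Matrix.map_apply, Matrix.add_apply, Matrix.smul_apply,
          Matrix.map_apply, Matrix.map_apply, Matrix.add_apply, Matrix.smul_apply, map_add,
          smul_eq_mul, smul_eq_mul, map_mul, Polynomial.coe_evalRingHom, Polynomial.eval_X,
          Polynomial.eval_C, Polynomial.eval_C, add_comm]
      have h2 : (1 + t • A).toLinearMap = 1 + t • A.toLinearMap := rfl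
      rw [h1, ContinuousLinearMap.det, ← LinearMap.det_toMatrix b, h2, map_add, map_smul,
        LinearMap.toMatrix_one]
    have hdeg : q.degree < (Finset.univ : Finset (Fin (n + 1))).card := by
      have := Polynomial.natDegree_det_X_add_C_le M 1
      refine lt_of_le_of_lt Polynomial.degree_le_natDegree ?_
      rw [Finset.card_univ, Fintype.card_fin] at *
      exact_mod_cast Nat.lt_succ_of_le this
    have h := Lagrange.eq_interpolate (s := Finset.univ) (v := τ) (f := q) hτ.injOn hdeg
    have h1 := congrArg (Polynomial.eval 1) h
    rw [hq, Lagrange.interpolate_apply, Polynomial.eval_finsetSum] at h1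
    simp only [one_smul, Polynomial.eval_mul, Polynomial.eval_C, hq] at h1
    rw [h1]
    exact Finset.sum_congr rfl fun i _ => mul_comm _ _

/-- `1 + A` has positive determinant when `‖A‖ < 1`. -/
theorem det_one_add_pos {n : ℕ} {A : EuclideanSpace ℝ (Fin n) →L[ℝ] EuclideanSpace ℝ (Fin n)}
    (hA : ‖A‖ < 1) : 0 < (1 + A).det := by
  -- The segment from the identity to `1 + A` avoids singular maps, since a kernel vector would
  -- satisfy `‖v‖ ≤ ‖A‖ ‖v‖`; hence the determinant keeps its sign.
  have hne : ∀ s ∈ Icc (0 : ℝ) 1, (1 + s • A).det ≠ 0 := by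
    intro s hs h0
    obtain ⟨v, hv, hv0⟩ := (Submodule.ne_bot_iff _).1
      (LinearMap.bot_lt_ker_of_det_eq_zero (f := (1 + s • A).toLinearMap) h0).ne'
    have h1 : v + s • A v = 0 := by simpa using hv
    have h2 : ‖v‖ ≤ ‖A‖ * ‖v‖ := by
      have : v = -(s • A v) := eq_neg_of_add_eq_zero_left h1
      calc ‖v‖ = ‖s • A v‖ := by rw [this, norm_neg, ← this]
        _ = s * ‖A v‖ := by rw [norm_smul, Real.norm_of_nonneg hs.1]
        _ ≤ 1 * ‖A v‖ := by gcongr; exact hs.2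
        _ ≤ ‖A‖ * ‖v‖ := by rw [one_mul]; exact A.le_opNorm v
    have : 0 < ‖v‖ := norm_pos_iff.2 hv0
    nlinarith
  have hcont : ContinuousOn (fun s : ℝ => (1 + s • A).det) (Icc 0 1) :=
    (ContinuousLinearMap.continuous_det.comp (by fun_prop)).continuousOn
  by_contra hle
  push Not at hle
  have h01 : (0 : ℝ) ∈ Icc ((fun s : ℝ => (1 + s • A).det) 1) ((fun s : ℝ => (1 + s • A).det) 0) := by
    refine ⟨by simpa using hle, ?_⟩
    simp [ContinuousLinearMap.det]
  obtain ⟨s, hs, hs0⟩ := intermediate_value_Icc' zero_le_one hcont h01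
  exact hne s hs hs0

variable {n : ℕ}

/-- For a small `C¹` perturbation `x + k x` of the identity that fixes the sphere and maps the ball
into itself, the image of the ball has full volume. -/
theorem integral_det_one_add_fderiv {k : EuclideanSpace ℝ (Fin n) → EuclideanSpace ℝ (Fin n)}
    [Nontrivial (EuclideanSpace ℝ (Fin n))] {C : ℝ} (hC : C < 1)
    (hk : ∀ x ∈ Metric.closedBall 0 1, ContDiffAt ℝ 1 k x)
    (hkC : ∀ x ∈ Metric.closedBall 0 1, ‖fderiv ℝ k x‖ ≤ C)
    (hmaps : ∀ x ∈ Metric.closedBall (0 : EuclideanSpace ℝ (Fin n)) 1,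
      x + k x ∈ Metric.closedBall (0 : EuclideanSpace ℝ (Fin n)) 1)
    (hid : ∀ x, ‖x‖ = 1 → k x = 0) :
    ∫ x in Metric.closedBall (0 : EuclideanSpace ℝ (Fin n)) 1, (1 + fderiv ℝ k x).det
      = volume.real (Metric.closedBall (0 : EuclideanSpace ℝ (Fin n)) 1) := by
  set B := Metric.closedBall (0 : EuclideanSpace ℝ (Fin n)) 1 with hB
  set F : EuclideanSpace ℝ (Fin n) → EuclideanSpace ℝ (Fin n) := fun x => x + k x with hF
  have hFd : ∀ x ∈ B, HasStrictFDerivAt F (1 + fderiv ℝ k x) x := fun x hx =>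
    (hasStrictFDerivAt_id x).add ((hk x hx).hasStrictFDerivAt one_ne_zero)
  have hdet : ∀ x ∈ B, 0 < (1 + fderiv ℝ k x).det := fun x hx =>
    det_one_add_pos ((hkC x hx).trans_lt hC)
  have hinj : InjOn F B := by
    intro x hx y hy hxy
    have h1 := (convex_closedBall (0 : EuclideanSpace ℝ (Fin n)) 1).norm_image_sub_le_of_norm_fderiv_le
      (fun x hx => (hk x hx).differentiableAt one_ne_zero) hkC hx hy
    have h2 : k y - k x = -(y - x) := by
      simp only [F] at hxy
      rw [neg_sub, sub_eq_sub_iff_add_eq_add, add_comm, ← hxy, add_comm]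
    rw [h2, norm_neg] at h1
    by_contra hne
    have : 0 < ‖y - x‖ := norm_pos_iff.2 (sub_ne_zero.2 (Ne.symm hne))
    nlinarith
  have hFcont : ContinuousOn F B := fun x hx => (hFd x hx).continuousAt.continuousWithinAt
  have hball : Metric.ball (0 : EuclideanSpace ℝ (Fin n)) 1 ⊆ B := Metric.ball_subset_closedBall
  have hopen : IsOpen (F '' Metric.ball 0 1) := by
    rw [isOpen_iff_mem_nhds]
    rintro _ ⟨x, hx, rfl⟩
    rw [← (hFd x (hball hx)).map_nhds_eq_of_surj]
    · exact Filter.image_mem_map (Metric.isOpen_ball.mem_nhds hx)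
    · have h := (LinearMap.equivOfDetNeZero
        (1 + fderiv ℝ k x).toLinearMap (hdet x (hball hx)).ne').range
      exact h
  -- The image of the open ball is open, and it is relatively closed in the open ball: a limit point
  -- there is the image of a point of the closed ball, which is not on the sphere because `F` fixes
  -- the sphere. Connectedness finishes.
  have hsub : Metric.ball 0 1 ⊆ F '' Metric.ball 0 1 := by
    have hne : (F '' Metric.ball 0 1).Nonempty := ⟨_, mem_image_of_mem F (Metric.mem_ball_self one_pos)⟩
    have hcl : closure (F '' Metric.ball 0 1) ∩ Metric.ball 0 1 ⊆ F '' Metric.ball 0 1 := by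
      rintro y ⟨hy, hy1⟩
      have hc : IsClosed (F '' B) := ((isCompact_closedBall _ _).image_of_continuousOn hFcont).isClosed
      obtain ⟨x, hx, rfl⟩ := closure_minimal (image_mono hball) hc hy
      refine ⟨x, ?_, rfl⟩
      rw [mem_ball_zero_iff] at hy1 ⊢
      refine lt_of_le_of_ne (mem_closedBall_zero_iff.1 hx) fun h1 => ?_
      simp only [F, hid x h1, add_zero, h1, lt_irrefl] at hy1
    refine (convex_ball (0 : EuclideanSpace ℝ (Fin n)) 1).isPreconnected.subset_of_closure_inter_subset
      hopen ?_ hcl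
    have hFB : F '' Metric.ball 0 1 ⊆ interior B :=
      interior_maximal (by rintro _ ⟨x, hx, rfl⟩; exact hmaps x (hball hx)) hopen
    rw [interior_closedBall _ one_ne_zero] at hFB
    obtain ⟨y, hy⟩ := hne
    exact ⟨y, hFB hy, hy⟩
  have hvol : volume (F '' B) = volume B := by
    refine le_antisymm (measure_mono (by rintro _ ⟨x, hx, rfl⟩; exact hmaps x hx)) ?_
    rw [hB, Measure.addHaar_closedBall_eq_addHaar_ball]
    exact measure_mono (hsub.trans (image_mono hball))
  have h := integral_image_eq_integral_abs_det_fderiv_smul volume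
    Metric.isClosed_closedBall.measurableSet
    (fun x hx => (hFd x hx).hasFDerivAt.hasFDerivWithinAt) hinj (fun _ => (1 : ℝ))
  rw [setIntegral_const, smul_eq_mul, mul_one, measureReal_def, hvol, ← measureReal_def] at h
  rw [h]
  refine setIntegral_congr_fun Metric.isClosed_closedBall.measurableSet fun x hx => ?_
  simp [abs_of_pos (hdet x hx)]

/-- There is no `C¹` retraction of the closed ball onto the sphere. -/
theorem no_contDiff_retraction {r : EuclideanSpace ℝ (Fin n) → EuclideanSpace ℝ (Fin n)}
    (hr : ∀ x ∈ Metric.closedBall 0 1, ContDiffAt ℝ 1 r x)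
    (hmaps : ∀ x ∈ Metric.closedBall (0 : EuclideanSpace ℝ (Fin n)) 1, ‖r x‖ = 1)
    (hid : ∀ x, ‖x‖ = 1 → r x = x) : False := by
  have h0 := hmaps 0 (Metric.mem_closedBall_self zero_le_one)
  have : Nontrivial (EuclideanSpace ℝ (Fin n)) :=
    ⟨r 0, 0, fun h => by rw [h, norm_zero] at h0; exact zero_ne_one h0⟩
  set B := Metric.closedBall (0 : EuclideanSpace ℝ (Fin n)) 1 with hB
  set k := fun x => r x - x with hkdef
  have hk : ∀ x ∈ B, ContDiffAt ℝ 1 k x := fun x hx => (hr x hx).sub contDiffAt_id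
  have hkc : ContinuousOn (fun x => fderiv ℝ k x) B := fun x hx =>
    ((hk x hx).fderiv_right (m := 0) (by norm_num)).continuousAt.continuousWithinAt
  obtain ⟨C, hC⟩ := (isCompact_closedBall (0 : EuclideanSpace ℝ (Fin n)) 1).exists_bound_of_continuousOn hkc
  have hC0 : 0 ≤ C := (norm_nonneg _).trans (hC 0 (Metric.mem_closedBall_self zero_le_one))
  -- Distinct nodes so small that `x + τ i • k x` is injective (`τ i * C < 1`) and is a convex
  -- combination of `x` and `r x` (`τ i ≤ 1`).
  let τ : Fin (n + 1) → ℝ := fun i => (i : ℝ) / ((n + 1) * (C + 1))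
  have hpos : 0 < ((n : ℝ) + 1) * (C + 1) := by positivity
  have hτ : Function.Injective τ := by
    intro i j hij
    simp only [τ] at hij
    rw [div_left_inj' hpos.ne'] at hij
    exact Fin.ext (by exact_mod_cast hij)
  have hτ0 : ∀ i, 0 ≤ τ i := fun i => by positivity
  have hτ1 : ∀ i, τ i * C < 1 ∧ τ i ≤ 1 := by
    intro i
    have hi : (i : ℝ) < n + 1 := by exact_mod_cast i.2
    constructor
    · simp only [τ]
      rw [div_mul_eq_mul_div, div_lt_one hpos]
      nlinarith
    · simp only [τ]
      rw [div_le_one hpos]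
      nlinarith
  obtain ⟨w, hw1, hw⟩ := exists_det_interpolation n τ hτ
  have hfd : ∀ i, ∀ x ∈ B, fderiv ℝ (fun x => τ i • k x) x = τ i • fderiv ℝ k x := fun i x hx =>
    fderiv_fun_const_smul ((hk x hx).differentiableAt one_ne_zero) _
  have hint : ∀ i, ∫ x in B, (1 + τ i • fderiv ℝ k x).det = volume.real B := by
    intro i
    rw [← integral_det_one_add_fderiv (k := fun x => τ i • k x) (hτ1 i).1]
    · refine setIntegral_congr_fun Metric.isClosed_closedBall.measurableSet fun x hx => ?_
      simp only [hfd i x hx]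
    · exact fun x hx => (hk x hx).const_smul _
    · intro x hx
      rw [hfd i x hx, norm_smul, Real.norm_of_nonneg (hτ0 i)]
      exact mul_le_mul_of_nonneg_left (hC x hx) (hτ0 i)
    · intro x hx
      have : x + τ i • k x = (1 - τ i) • x + τ i • r x := by
        simp only [k, smul_sub, sub_smul, one_smul]; abel
      rw [this]
      exact (convex_closedBall (0 : EuclideanSpace ℝ (Fin n)) 1) hx
        (by rw [mem_closedBall_zero_iff, hmaps x hx]) (sub_nonneg.2 (hτ1 i).2) (hτ0 i) (by ring)
    · intro x hx
      simp [k, hid x hx]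
  have hI : ∀ i, IntegrableOn (fun x => w i * (1 + τ i • fderiv ℝ k x).det) B := by
    intro i
    refine ContinuousOn.integrableOn_compact (isCompact_closedBall _ _) ?_
    refine continuousOn_const.mul (ContinuousLinearMap.continuous_det.comp_continuousOn ?_)
    fun_prop
  -- The integral is the volume at every small node, and interpolation carries this to `t = 1`,
  -- where the map is `r` itself.
  have hsum : ∫ x in B, (1 + fderiv ℝ k x).det = volume.real B := by
    rw [integral_congr_ae (Filter.Eventually.of_forall fun x => hw (fderiv ℝ k x)), integral_finsetSum _ fun i _ => hI i]
    simp_rw [integral_const_mul, hint, ← Finset.sum_mul, hw1, one_mul]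
  -- On the open ball `‖r‖ ^ 2` is constant, so the derivative of `r` takes values orthogonal to `r
  -- x ≠ 0` and is singular; the sphere is a null set.
  have hzero : ∫ x in B, (1 + fderiv ℝ k x).det = 0 := by
    have hball : (∫ x in B, (1 + fderiv ℝ k x).det)
        = ∫ x in Metric.ball (0 : EuclideanSpace ℝ (Fin n)) 1, (1 + fderiv ℝ k x).det := by
      refine setIntegral_congr_set ?_
      refine (ae_eq_of_subset_of_measure_ge Metric.ball_subset_closedBall
        (Measure.addHaar_closedBall_eq_addHaar_ball volume _ _).le
        Metric.isOpen_ball.measurableSet.nullMeasurableSet measure_closedBall_lt_top.ne).symm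
    rw [hball]
    refine setIntegral_eq_zero_of_forall_eq_zero fun x hx => ?_
    have hxB := Metric.ball_subset_closedBall hx
    have hd := (hr x hxB).differentiableAt one_ne_zero
    have h1 : (1 + fderiv ℝ k x) = fderiv ℝ r x := by
      simp only [k]
      rw [fderiv_fun_sub hd differentiableAt_fun_id, fderiv_fun_id]
      ext v; simp
    rw [h1]
    by_contra hne
    have hsurj : Function.Surjective (fderiv ℝ r x) :=
      (LinearMap.equivOfDetNeZero (fderiv ℝ r x).toLinearMap hne).surjective
    obtain ⟨v, hv⟩ := hsurj (r x)
    have hconst : (fun y => ‖r y‖ ^ 2) =ᶠ[nhds x] fun _ => (1 : ℝ) := by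
      filter_upwards [Metric.isOpen_ball.mem_nhds hx] with y hy
      rw [hmaps y (Metric.ball_subset_closedBall hy), one_pow]
    have hder := (hd.hasFDerivAt.norm_sq).congr_of_eventuallyEq hconst.symm
    have := hder.unique (hasFDerivAt_const (1 : ℝ) x)
    have h2 := congrArg (fun φ => φ v) this
    simp only [smul_apply, ContinuousLinearMap.comp_apply, hv,
      innerSL_apply_apply, zero_apply, real_inner_self_eq_norm_sq,
      hmaps x hxB] at h2
    norm_num at h2
  have : 0 < volume.real B := by
    rw [measureReal_def]
    exact ENNReal.toReal_pos (Metric.measure_closedBall_pos _ _ one_pos).ne'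
      measure_closedBall_lt_top.ne
  linarith

end Brouwer

/-! ### The fixed point theorems of Brouwer and Schauder. -/

section Brouwer

/-- **Brouwer fixed point theorem** for the closed unit ball. -/
theorem exists_fixedPoint_of_norm_le_one {n : ℕ}
    {f : EuclideanSpace ℝ (Fin n) → EuclideanSpace ℝ (Fin n)} (hf : Continuous f)
    (hf1 : ∀ x, ‖f x‖ ≤ 1) : ∃ x, f x = x := by
  by_contra hne
  push Not at hne
  obtain ⟨x₀, hx₀, hmin⟩ := (isCompact_closedBall (0 : EuclideanSpace ℝ (Fin n)) 1).exists_isMinOn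
    ⟨0, Metric.mem_closedBall_self zero_le_one⟩
    (f := fun x => ‖f x - x‖) (by fun_prop)
  set δ := ‖f x₀ - x₀‖
  have hδ : 0 < δ := norm_pos_iff.2 (sub_ne_zero.2 (hne x₀))
  -- The smoothing costs `ε` and the rescaling back into the ball another `ε`, so a fixed point of
  -- `g` would give `‖f x - x‖ ≤ 2 ε < δ`.
  set ε := δ / 4 with hε
  have hε0 : 0 < ε := by positivity
  obtain ⟨g₀, hg₀, hg₀f, -⟩ := hf.exists_contDiff_approx 1 (ε := fun _ => ε) continuous_const
    fun _ => hε0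
  set g := fun x => (1 + ε)⁻¹ • g₀ x with hg
  have hgc : ContDiff ℝ 1 g := contDiff_const.fun_smul hg₀
  have hg₀1 : ∀ x, ‖g₀ x‖ ≤ 1 + ε := fun x => by
    have := hg₀f x
    rw [dist_eq_norm] at this
    calc ‖g₀ x‖ = ‖f x + (g₀ x - f x)‖ := by rw [add_sub_cancel]
      _ ≤ 1 + ε := (norm_add_le _ _).trans (add_le_add (hf1 x) this.le)
  have hg1 : ∀ x, ‖g x‖ ≤ 1 := fun x => by
    rw [hg, norm_smul, Real.norm_of_nonneg (by positivity), inv_mul_le_iff₀ (by positivity), mul_one]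
    exact hg₀1 x
  have hgf : ∀ x ∈ Metric.closedBall (0 : EuclideanSpace ℝ (Fin n)) 1, x - g x ≠ 0 := by
    intro x hx h0
    have h1 : δ ≤ ‖f x - x‖ := hmin hx
    have h2 : ‖g₀ x - g x‖ ≤ ε := by
      have : g₀ x = (1 + ε) • g x := by
        simp only [g]; rw [smul_smul, mul_inv_cancel₀ (by positivity), one_smul]
      rw [this, add_smul, one_smul, add_sub_cancel_left, norm_smul, Real.norm_of_nonneg hε0.le]
      exact mul_le_of_le_one_right hε0.le (hg1 x)
    have h3 := hg₀f x
    rw [dist_eq_norm] at h3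
    rw [sub_eq_zero] at h0
    rw [← h0] at h2
    have h4 : ‖f x - x‖ ≤ ‖g₀ x - f x‖ + ‖g₀ x - x‖ := by
      rw [← norm_neg (g₀ x - f x), neg_sub]
      simpa using norm_add_le (f x - g₀ x) (g₀ x - x)
    linarith
  -- The retraction sends `x` to the exit point of the ray from `g x` through `x`. The point `x + s
  -- (x - g x)` has norm one iff `b s² + 2 a s - (1 - ‖x‖²) = 0`; `D` is a quarter of the
  -- discriminant and `s` the larger root.
  let a : EuclideanSpace ℝ (Fin n) → ℝ := fun x => inner ℝ x (x - g x)
  let b : EuclideanSpace ℝ (Fin n) → ℝ := fun x => ‖x - g x‖ ^ 2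
  let D : EuclideanSpace ℝ (Fin n) → ℝ := fun x => a x ^ 2 + b x * (1 - ‖x‖ ^ 2)
  let s : EuclideanSpace ℝ (Fin n) → ℝ := fun x => (-a x + √(D x)) / b x
  have hb : ∀ x ∈ Metric.closedBall (0 : EuclideanSpace ℝ (Fin n)) 1, 0 < b x := fun x hx => by
    have := norm_pos_iff.2 (hgf x hx)
    positivity
  -- Hence `a` is positive on the sphere, which keeps `D` positive there, so that the root is `C¹`,
  -- and makes the larger root zero.
  have ha : ∀ x, ‖x‖ = 1 → b x ≤ 2 * a x := by
    intro x hx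
    have h1 := norm_sub_sq_real x (g x)
    have h2 : a x = ‖x‖ ^ 2 - inner ℝ x (g x) := by
      simp only [a, inner_sub_right, real_inner_self_eq_norm_sq]
    have h3 : ‖g x‖ ^ 2 ≤ 1 := pow_le_one₀ (norm_nonneg _) (hg1 x)
    simp only [b, h1, h2, hx]
    linarith
  have hD : ∀ x ∈ Metric.closedBall (0 : EuclideanSpace ℝ (Fin n)) 1, 0 < D x := by
    intro x hx
    rcases (mem_closedBall_zero_iff.1 hx).lt_or_eq with h | h
    · have : 0 < 1 - ‖x‖ ^ 2 := by
        have := pow_lt_one₀ (norm_nonneg _) h two_ne_zero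
        linarith
      have := mul_pos (hb x hx) this
      have := sq_nonneg (a x)
      simp only [D]
      linarith
    · have h1 := ha x h
      have h2 := hb x hx
      have : 0 < a x := by linarith
      simp only [D, h]
      norm_num
      positivity
  refine no_contDiff_retraction (r := fun x => x + s x • (x - g x)) ?_ ?_ ?_
  · intro x hx
    have hac : ContDiff ℝ 1 a := contDiff_id.inner ℝ (contDiff_id.sub hgc)
    have hbc : ContDiff ℝ 1 b := (contDiff_id.sub hgc).norm_sq ℝ
    have hDc : ContDiff ℝ 1 D :=
      (hac.pow 2).add (hbc.mul (contDiff_const.sub (contDiff_id.norm_sq ℝ)))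
    refine contDiffAt_id.add (ContDiffAt.fun_smul ?_ (contDiff_id.sub hgc).contDiffAt)
    exact (hac.contDiffAt.neg.add (hDc.contDiffAt.sqrt (hD x hx).ne')).div hbc.contDiffAt
      (hb x hx).ne'
  · intro x hx
    have h1 : ‖x + s x • (x - g x)‖ ^ 2 = 1 := by
      rw [norm_add_sq_real, inner_smul_right, norm_smul, mul_pow, Real.norm_eq_abs, sq_abs]
      change ‖x‖ ^ 2 + 2 * (s x * a x) + s x ^ 2 * b x = 1
      have hs : s x * b x = -a x + √(D x) := div_mul_cancel₀ _ (hb x hx).ne'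
      have hsq : √(D x) ^ 2 = a x ^ 2 + b x * (1 - ‖x‖ ^ 2) := Real.sq_sqrt (hD x hx).le
      have : b x * (‖x‖ ^ 2 + 2 * (s x * a x) + s x ^ 2 * b x - 1) = 0 := by
        have : √(D x) = s x * b x + a x := by linarith
        rw [this] at hsq
        linarith
      have := (mul_eq_zero.1 this).resolve_left (hb x hx).ne'
      linarith
    exact (pow_eq_one_iff_of_nonneg (norm_nonneg _) two_ne_zero).1 h1
  · intro x hx
    have hx' : x ∈ Metric.closedBall (0 : EuclideanSpace ℝ (Fin n)) 1 :=
      mem_closedBall_zero_iff.2 hx.le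
    have h1 := ha x hx
    have h2 := hb x hx'
    have hs : s x = 0 := by
      simp only [s, D, hx]
      norm_num
      left
      rw [Real.sqrt_sq (by linarith)]
      ring
    simp [hs]

/-- A continuous retraction of `ℝ^N` onto the standard simplex. -/
noncomputable def simplexRetraction (N : ℕ) (x : Fin N → ℝ) : Fin N → ℝ :=
  -- A deficit of the sum of the positive parts is shared equally among the coordinates; an excess
  -- is removed by rescaling.
  fun i => (max (x i) 0 + max 0 (1 - ∑ j, max (x j) 0) / N) / max 1 (∑ j, max (x j) 0)

theorem simplexRetraction_mem {N : ℕ} (hN : N ≠ 0) (x : Fin N → ℝ) :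
    simplexRetraction N x ∈ stdSimplex ℝ (Fin N) := by
  have hs : 0 < max 1 (∑ j, max (x j) 0) := lt_max_of_lt_left one_pos
  refine ⟨fun i => by unfold simplexRetraction; positivity, ?_⟩
  simp only [simplexRetraction]
  rw [← Finset.sum_div, Finset.sum_add_distrib, Finset.sum_const, Finset.card_univ, Fintype.card_fin,
    nsmul_eq_mul, mul_div_cancel₀ _ (by exact_mod_cast hN), div_eq_one_iff_eq hs.ne']
  rcases le_total (∑ j, max (x j) 0) 1 with h | h
  · rw [max_eq_right (by linarith), max_eq_left h]; ring
  · rw [max_eq_left (by linarith), max_eq_right h]; ring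

theorem simplexRetraction_eq_self {N : ℕ} {x : Fin N → ℝ} (hx : x ∈ stdSimplex ℝ (Fin N)) :
    simplexRetraction N x = x := by
  have h : ∀ j, max (x j) 0 = x j := fun j => max_eq_left (hx.1 j)
  ext i
  simp [simplexRetraction, h, hx.2]

theorem continuous_simplexRetraction (N : ℕ) : Continuous (simplexRetraction N) := by
  refine continuous_pi fun i => ?_
  refine Continuous.div (by fun_prop) (by fun_prop) fun x => ?_
  exact (lt_max_of_lt_left one_pos).ne'

/-- **Brouwer fixed point theorem** for the standard simplex. -/
theorem exists_fixedPoint_stdSimplex {N : ℕ} (hN : N ≠ 0) {f : (Fin N → ℝ) → Fin N → ℝ}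
    (hf : ContinuousOn f (stdSimplex ℝ (Fin N)))
    (hmaps : MapsTo f (stdSimplex ℝ (Fin N)) (stdSimplex ℝ (Fin N))) :
    ∃ x ∈ stdSimplex ℝ (Fin N), f x = x := by
  have hmem : ∀ x : EuclideanSpace ℝ (Fin N), f (simplexRetraction N x.ofLp) ∈ stdSimplex ℝ (Fin N) :=
    fun x => hmaps (simplexRetraction_mem hN _)
  have hcont : Continuous fun x : EuclideanSpace ℝ (Fin N) =>
      WithLp.toLp 2 (f (simplexRetraction N x.ofLp)) := by
    refine (PiLp.continuous_toLp 2 _).comp ?_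
    exact hf.comp_continuous ((continuous_simplexRetraction N).comp (PiLp.continuous_ofLp 2 _))
      fun x => simplexRetraction_mem hN _
  have hnorm : ∀ x : EuclideanSpace ℝ (Fin N),
      ‖WithLp.toLp 2 (f (simplexRetraction N x.ofLp))‖ ≤ 1 := by
    intro x
    rw [EuclideanSpace.norm_eq, Real.sqrt_le_one]
    have h := hmem x
    rw [← h.2]
    refine Finset.sum_le_sum fun i _ => ?_
    have h0 := h.1 i
    have h1 : f (simplexRetraction N x.ofLp) i ≤ 1 :=
      h.2 ▸ Finset.single_le_sum (fun j _ => h.1 j) (Finset.mem_univ i)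
    rw [Real.norm_of_nonneg h0]
    nlinarith
  obtain ⟨x, hx⟩ := exists_fixedPoint_of_norm_le_one hcont hnorm
  have hx' : f (simplexRetraction N x.ofLp) = x.ofLp := congrArg WithLp.ofLp hx
  have hxm : x.ofLp ∈ stdSimplex ℝ (Fin N) := hx' ▸ hmem x
  exact ⟨x.ofLp, hxm, by rwa [simplexRetraction_eq_self hxm] at hx'⟩

variable {Y : Type*} [NormedAddCommGroup Y] [NormedSpace ℝ Y]

/-- Schauder projection: tent functions around a finite `ε`-net of the image turn `f` into a
self-map of a simplex of barycentric weights, to which Brouwer's theorem applies. At the fixed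
weights `w`, only net points within `ε` of `f (p w)` carry weight. -/
theorem exists_approx_fixedPoint {S : Set Y} (hS : Convex ℝ S) (hne : S.Nonempty) {f : Y → Y}
    (hf : ContinuousOn f S) (hmaps : MapsTo f S S) (htb : TotallyBounded (f '' S)) {ε : ℝ}
    (hε : 0 < ε) : ∃ x ∈ S, ‖f x - x‖ ≤ ε := by
  obtain ⟨t, hts, htf, hcov⟩ := Metric.finite_approx_of_totallyBounded htb ε hε
  obtain ⟨N, y, -, rfl⟩ := htf.fin_param
  have hyS : ∀ i, y i ∈ S := fun i => by
    obtain ⟨z, hz, hzy⟩ := hts ⟨i, rfl⟩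
    exact hzy ▸ hmaps hz
  have hN : N ≠ 0 := by
    rintro rfl
    obtain ⟨x, hx⟩ := hne
    have := hcov (mem_image_of_mem f hx)
    simp at this
  let φ : Y → Fin N → ℝ := fun z i => max 0 (ε - ‖z - y i‖)
  have hφ0 : ∀ z i, 0 ≤ φ z i := fun z i => le_max_left _ _
  have hφpos : ∀ x ∈ S, 0 < ∑ i, φ (f x) i := by
    intro x hx
    have := hcov (mem_image_of_mem f hx)
    simp only [mem_range, iUnion_exists, iUnion_iUnion_eq', mem_iUnion, mem_ball_iff_norm] at this
    obtain ⟨i, hi⟩ := this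
    refine Finset.sum_pos' (fun i _ => hφ0 _ i) ⟨i, Finset.mem_univ _, ?_⟩
    exact lt_max_of_lt_right (sub_pos.2 hi)
  let p : (Fin N → ℝ) → Y := fun w => ∑ i, w i • y i
  have hp : ∀ w ∈ stdSimplex ℝ (Fin N), p w ∈ S := fun w hw =>
    hS.sum_mem (fun i _ => hw.1 i) hw.2 fun i _ => hyS i
  have hpc : Continuous p := by fun_prop
  have hcont : ContinuousOn (fun w i => φ (f (p w)) i / ∑ j, φ (f (p w)) j)
      (stdSimplex ℝ (Fin N)) := by
    have hc : ContinuousOn (fun w => f (p w)) (stdSimplex ℝ (Fin N)) :=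
      hf.comp hpc.continuousOn hp
    have hφc : ∀ i, ContinuousOn (fun w => φ (f (p w)) i) (stdSimplex ℝ (Fin N)) := fun i =>
      continuousOn_const.sup (continuousOn_const.sub (hc.sub continuousOn_const).norm)
    exact continuousOn_pi.2 fun i => (hφc i).div (continuousOn_finsetSum _ fun j _ => hφc j)
      fun w hw => (hφpos _ (hp w hw)).ne'
  have hself : MapsTo (fun w i => φ (f (p w)) i / ∑ j, φ (f (p w)) j)
      (stdSimplex ℝ (Fin N)) (stdSimplex ℝ (Fin N)) := by
    intro w hw
    have := hφpos _ (hp w hw)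
    refine ⟨fun i => div_nonneg (hφ0 _ i) this.le, ?_⟩
    rw [← Finset.sum_div, div_self this.ne']
  obtain ⟨w, hw, hfix⟩ := exists_fixedPoint_stdSimplex hN hcont hself
  refine ⟨p w, hp w hw, ?_⟩
  have hz : f (p w) - p w = ∑ i, w i • (f (p w) - y i) := by
    simp only [smul_sub, Finset.sum_sub_distrib, ← Finset.sum_smul, hw.2, one_smul, p]
  rw [hz]
  calc ‖∑ i, w i • (f (p w) - y i)‖ ≤ ∑ i, ‖w i • (f (p w) - y i)‖ := norm_sum_le _ _
    _ ≤ ∑ i, w i * ε := by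
      refine Finset.sum_le_sum fun i _ => ?_
      rw [norm_smul, Real.norm_of_nonneg (hw.1 i)]
      by_cases h : ‖f (p w) - y i‖ ≤ ε
      · exact mul_le_mul_of_nonneg_left h (hw.1 i)
      · have : w i = 0 := by
          rw [← congrFun hfix i]
          simp only [φ]
          rw [max_eq_left (by linarith), zero_div]
        simp [this]
    _ = ε := by rw [← Finset.sum_mul, hw.2, one_mul]

/-- **Schauder fixed point theorem.** -/
theorem exists_fixedPoint_of_isCompact {S K : Set Y} (hS : Convex ℝ S) (hne : S.Nonempty)
    (hcl : IsClosed S) {f : Y → Y} (hf : ContinuousOn f S) (hmaps : MapsTo f S S)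
    (hK : IsCompact K) (hfK : MapsTo f S K) : ∃ x ∈ S, f x = x := by
  have htb : TotallyBounded (f '' S) := hK.totallyBounded.subset hfK.image_subset
  choose x hxS hx using fun n : ℕ =>
    exists_approx_fixedPoint hS hne hf hmaps htb (Nat.one_div_pos_of_nat (α := ℝ) (n := n))
  obtain ⟨z, -, φ, hφ, hz⟩ := hK.tendsto_subseq fun n => hfK (hxS n)
  have h0 : Filter.Tendsto (fun n => f (x (φ n)) - x (φ n)) Filter.atTop (nhds 0) :=
    squeeze_zero_norm (fun n => hx (φ n))
      (tendsto_one_div_add_atTop_nhds_zero_nat.comp hφ.tendsto_atTop)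
  have hxz : Filter.Tendsto (fun n => x (φ n)) Filter.atTop (nhds z) := by
    have := hz.sub h0
    simpa using this
  have hzS : z ∈ S := hcl.mem_of_tendsto hxz (Filter.Eventually.of_forall fun n => hxS _)
  refine ⟨z, hzS, tendsto_nhds_unique ((hf z hzS).tendsto.comp ?_) hz⟩
  exact tendsto_nhdsWithin_iff.2 ⟨hxz, Filter.Eventually.of_forall fun n => hxS _⟩

end Brouwer

/-! ### Finite measures as functionals on `C_∞(ℝ^d)`, and the closed convex set of probability
measures. -/

noncomputable section

section Measures

open Filter Topology

variable {d : ℕ}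

/-- The dual of `C_∞(ℝ^d)`. -/
def C0Dual (d : ℕ) : Type := StrongDual ℝ C₀(Euc d, ℝ)

namespace C0Dual

instance : NormedAddCommGroup (C0Dual d) :=
  inferInstanceAs (NormedAddCommGroup (StrongDual ℝ C₀(Euc d, ℝ)))

instance : NormedSpace ℝ (C0Dual d) :=
  inferInstanceAs (NormedSpace ℝ (StrongDual ℝ C₀(Euc d, ℝ)))

instance : CompleteSpace (C0Dual d) :=
  inferInstanceAs (CompleteSpace (StrongDual ℝ C₀(Euc d, ℝ)))

instance : FunLike (C0Dual d) C₀(Euc d, ℝ) ℝ :=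
  inferInstanceAs (FunLike (StrongDual ℝ C₀(Euc d, ℝ)) C₀(Euc d, ℝ) ℝ)

instance : ContinuousLinearMapClass (C0Dual d) ℝ C₀(Euc d, ℝ) ℝ :=
  inferInstanceAs (ContinuousLinearMapClass (StrongDual ℝ C₀(Euc d, ℝ)) ℝ C₀(Euc d, ℝ) ℝ)

theorem sub_apply (Λ Λ' : C0Dual d) (g : C₀(Euc d, ℝ)) : (Λ - Λ') g = Λ g - Λ' g := rfl

theorem smul_apply (c : ℝ) (Λ : C0Dual d) (g : C₀(Euc d, ℝ)) : (c • Λ) g = c * Λ g := rfl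

theorem le_opNorm (Λ : C0Dual d) (g : C₀(Euc d, ℝ)) : |Λ g| ≤ ‖Λ‖ * ‖g‖ :=
  ContinuousLinearMap.le_opNorm (show StrongDual ℝ C₀(Euc d, ℝ) from Λ) g

theorem norm_le {Λ : C0Dual d} {c : ℝ} (hc : 0 ≤ c)
    (h : ∀ g : C₀(Euc d, ℝ), ‖g‖ ≤ 1 → |Λ g| ≤ c) : ‖Λ‖ ≤ c :=
  ContinuousLinearMap.opNorm_le_of_unit_norm (f := (show StrongDual ℝ C₀(Euc d, ℝ) from Λ)) hc
    fun g hg => h g hg.le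

@[ext] theorem ext {Λ Λ' : C0Dual d} (h : ∀ g, Λ g = Λ' g) : Λ = Λ' := DFunLike.ext _ _ h

/-- The functional with the given values. -/
def mk (φ : C₀(Euc d, ℝ) → ℝ) (hadd : ∀ f g, φ (f + g) = φ f + φ g)
    (hsmul : ∀ (c : ℝ) g, φ (c • g) = c * φ g) (C : ℝ) (hC : ∀ g, |φ g| ≤ C * ‖g‖) : C0Dual d :=
  LinearMap.mkContinuous { toFun := φ, map_add' := hadd, map_smul' := hsmul } C hC

/-- Evaluation at a test function. -/
def eval (g : C₀(Euc d, ℝ)) : C0Dual d →L[ℝ] ℝ :=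
  LinearMap.mkContinuous
    { toFun := fun Λ => Λ g, map_add' := fun _ _ => rfl, map_smul' := fun _ _ => rfl } ‖g‖
    fun Λ => (Λ.le_opNorm g).trans_eq (mul_comm _ _)

end C0Dual

theorem ZeroAtInftyContinuousMap.abs_apply_le (g : C₀(Euc d, ℝ)) (x : Euc d) : |g x| ≤ ‖g‖ := by
  rw [← ZeroAtInftyContinuousMap.norm_toBCF_eq_norm]
  exact g.toBCF.norm_coe_le_norm x

theorem ZeroAtInftyContinuousMap.norm_le_of_forall {g : C₀(Euc d, ℝ)} {M : ℝ} (hM : 0 ≤ M)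
    (h : ∀ x, |g x| ≤ M) : ‖g‖ ≤ M := by
  rw [← ZeroAtInftyContinuousMap.norm_toBCF_eq_norm]
  exact (BoundedContinuousFunction.norm_le hM).2 h

theorem integrable_of_continuous_of_abs_le {m : Measure (Euc d)} [IsFiniteMeasure m]
    {f : Euc d → ℝ} (hf : Continuous f) {M : ℝ} (hM : ∀ x, |f x| ≤ M) : Integrable f m :=
  Integrable.of_bound hf.aestronglyMeasurable M (Eventually.of_forall hM)

theorem ZeroAtInftyContinuousMap.integrable (g : C₀(Euc d, ℝ)) (m : Measure (Euc d))
    [IsFiniteMeasure m] : Integrable g m :=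
  integrable_of_continuous_of_abs_le g.continuous g.abs_apply_le

/-- A finite measure as a functional on `C_∞(ℝ^d)`. -/
def measDual (m : FiniteMeasure (Euc d)) : C0Dual d :=
  C0Dual.mk (fun g => ∫ x, g x ∂(m : Measure (Euc d)))
    (fun f g => integral_add (f.integrable _) (g.integrable _)) (fun c g => integral_const_mul c g)
    ((m : Measure (Euc d)).real univ) fun g => by
      rw [mul_comm]
      exact norm_integral_le_of_norm_le_const (f := g) (Eventually.of_forall g.abs_apply_le)

theorem vectorIntegral_sub (a b : FiniteMeasure (Euc d)) (g : C₀(Euc d, ℝ)) :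
    ∫ᵛ x, g x ∂<•(finToSigned a - finToSigned b) = (measDual a - measDual b) g := by
  rw [VectorMeasure.integral_sub_vectorMeasure]
  · simp only [finToSigned, VectorMeasure.integral_toSignedMeasure]
    rfl
  · simp only [finToSigned, VectorMeasure.Integrable, Measure.variation_toSignedMeasure]
    exact g.integrable _
  · simp only [finToSigned, VectorMeasure.Integrable, Measure.variation_toSignedMeasure]
    exact g.integrable _

/-- Both norms are suprema over the same unit ball. Boundedness of the family has to be supplied,
because an unbounded real supremum takes the default value zero. -/
theorem starNorm_eq_norm {ρ : SignedMeasure (Euc d)} {Λ : C0Dual d}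
    (h : ∀ g : C₀(Euc d, ℝ), ∫ᵛ x, g x ∂<•ρ = Λ g) : starNorm ρ = ‖Λ‖ := by
  have hle : ∀ g : {f : C₀(Euc d, ℝ) // ‖f‖ ≤ 1}, |∫ᵛ x, g.1 x ∂<•ρ| ≤ ‖Λ‖ := fun g => by
    rw [h]
    exact (Λ.le_opNorm g.1).trans (mul_le_of_le_one_right (norm_nonneg _) g.2)
  have : Nonempty {f : C₀(Euc d, ℝ) // ‖f‖ ≤ 1} := ⟨⟨0, by simp⟩⟩
  refine le_antisymm (ciSup_le hle) (C0Dual.norm_le (Real.iSup_nonneg fun _ => abs_nonneg _) ?_)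
  intro g hg
  rw [← h]
  exact le_ciSup (f := fun f : {f : C₀(Euc d, ℝ) // ‖f‖ ≤ 1} => |∫ᵛ x, f.1 x ∂<•ρ|)
    ⟨‖Λ‖, by rintro _ ⟨g, rfl⟩; exact hle g⟩ ⟨g, hg⟩

theorem starNorm_finToSigned_sub (a b : FiniteMeasure (Euc d)) :
    starNorm (finToSigned a - finToSigned b) = ‖measDual a - measDual b‖ :=
  starNorm_eq_norm (vectorIntegral_sub a b)

/-- A probability measure as a functional on `C_∞(ℝ^d)`. -/
def probDual (p : ProbabilityMeasure (Euc d)) : C0Dual d := measDual p.toFiniteMeasure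

theorem probDual_apply (p : ProbabilityMeasure (Euc d)) (g : C₀(Euc d, ℝ)) :
    probDual p g = ∫ x, g x ∂(p : Measure (Euc d)) := rfl

theorem starNorm_probToSigned_sub (a b : ProbabilityMeasure (Euc d)) :
    starNorm (probToSigned a - probToSigned b) = ‖probDual a - probDual b‖ :=
  starNorm_finToSigned_sub a.toFiniteMeasure b.toFiniteMeasure

theorem abs_integral_le_of_prob {m : Measure (Euc d)} [IsProbabilityMeasure m] {f : Euc d → ℝ} {M : ℝ}
    (h : ∀ x, |f x| ≤ M) : |∫ x, f x ∂m| ≤ M := by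
  simpa using norm_integral_le_of_norm_le_const (μ := m) (f := f) (Eventually.of_forall h)

theorem norm_probDual_le (p : ProbabilityMeasure (Euc d)) : ‖probDual p‖ ≤ 1 :=
  C0Dual.norm_le zero_le_one fun g hg =>
    (abs_integral_le_of_prob (m := (p : Measure (Euc d))) g.abs_apply_le).trans hg

theorem probToSigned_mem_unitBall (p : ProbabilityMeasure (Euc d)) :
    probToSigned p ∈ unitBall d := by
  have : starNorm (probToSigned p) = ‖probDual p‖ := starNorm_eq_norm fun g => by
    rw [probToSigned, VectorMeasure.integral_toSignedMeasure, probDual_apply]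
  exact this.trans_le (norm_probDual_le p)

/-- A continuous cutoff that is `1` on the ball of radius `n` and vanishes outside the ball of radius
`n + 1`. -/
def cutoff (d n : ℕ) (x : Euc d) : ℝ := max 0 (min 1 (n + 1 - ‖x‖))

theorem cutoff_nonneg (n : ℕ) (x : Euc d) : 0 ≤ cutoff d n x := le_max_left _ _

theorem cutoff_le_one (n : ℕ) (x : Euc d) : cutoff d n x ≤ 1 :=
  max_le zero_le_one (min_le_left _ _)

theorem cutoff_eq_one {n : ℕ} {x : Euc d} (h : ‖x‖ ≤ n) : cutoff d n x = 1 := by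
  rw [cutoff, min_eq_left (by linarith), max_eq_right zero_le_one]

theorem continuous_cutoff (n : ℕ) : Continuous (cutoff d n) := by
  unfold cutoff; fun_prop

theorem hasCompactSupport_cutoff (n : ℕ) : HasCompactSupport (cutoff d n) := by
  refine HasCompactSupport.intro (isCompact_closedBall (0 : Euc d) (n + 1)) fun x hx => ?_
  rw [mem_closedBall_zero_iff, not_le] at hx
  rw [cutoff, max_eq_left]
  exact (min_le_right _ _).trans (by linarith)

theorem tendsto_cutoff (x : Euc d) : Tendsto (fun n => cutoff d n x) atTop (𝓝 1) := by
  obtain ⟨N, hN⟩ := exists_nat_ge ‖x‖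
  refine tendsto_const_nhds.congr' ?_
  filter_upwards [eventually_ge_atTop N] with n hn
  exact (cutoff_eq_one (hN.trans (by exact_mod_cast hn))).symm

/-- The product of a continuous function with a cutoff. -/
def truncC (f : C(Euc d, ℝ)) (n : ℕ) : CompactlySupportedContinuousMap (Euc d) ℝ where
  toFun := fun x => f x * cutoff d n x
  continuous_toFun := f.continuous.mul (continuous_cutoff n)
  hasCompactSupport' := (hasCompactSupport_cutoff n).mul_left

/-- The inclusion of compactly supported functions into `C_∞(ℝ^d)`. -/
def ccToC0 (f : CompactlySupportedContinuousMap (Euc d) ℝ) : C₀(Euc d, ℝ) where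
  toContinuousMap := f.toContinuousMap
  zero_at_infty' := f.hasCompactSupport.is_zero_at_infty

/-- The product of a continuous function with a cutoff, in `C_∞(ℝ^d)`. -/
def trunc (f : C(Euc d, ℝ)) (n : ℕ) : C₀(Euc d, ℝ) := ccToC0 (truncC f n)

theorem trunc_apply (f : C(Euc d, ℝ)) (n : ℕ) (x : Euc d) : trunc f n x = f x * cutoff d n x := rfl

theorem abs_trunc_le (f : C(Euc d, ℝ)) (n : ℕ) (x : Euc d) : |trunc f n x| ≤ |f x| := by
  rw [trunc_apply, abs_mul, abs_of_nonneg (cutoff_nonneg n x)]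
  exact mul_le_of_le_one_right (abs_nonneg _) (cutoff_le_one n x)

theorem norm_trunc_le {f : C(Euc d, ℝ)} {M : ℝ} (hM : ∀ x, |f x| ≤ M) (n : ℕ) : ‖trunc f n‖ ≤ M :=
  ZeroAtInftyContinuousMap.norm_le_of_forall ((abs_nonneg _).trans (hM 0)) fun x =>
    (abs_trunc_le f n x).trans (hM x)

theorem tendsto_trunc (f : C(Euc d, ℝ)) (x : Euc d) :
    Tendsto (fun n => trunc f n x) atTop (𝓝 (f x)) := by
  simpa [trunc_apply] using (tendsto_cutoff x).const_mul (f x)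

theorem tendsto_integral_trunc {m : Measure (Euc d)} [IsFiniteMeasure m] {f : C(Euc d, ℝ)} {M : ℝ}
    (hM : ∀ x, |f x| ≤ M) :
    Tendsto (fun n => ∫ x, trunc f n x ∂m) atTop (𝓝 (∫ x, f x ∂m)) :=
  tendsto_integral_of_dominated_convergence (fun _ => M)
    (fun n => (trunc f n).continuous.aestronglyMeasurable) (integrable_const M)
    (fun n => Eventually.of_forall fun x => (abs_trunc_le f n x).trans (hM x))
    (Eventually.of_forall fun x => tendsto_trunc f x)

/-- The norm tests only functions that vanish at infinity; truncation and dominated convergence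
extend it to bounded continuous ones. This is needed because value functions, and the generator
applied to a test function, need not vanish at infinity. -/
theorem abs_integral_sub_integral_le (a b : FiniteMeasure (Euc d)) {f : Euc d → ℝ}
    (hf : Continuous f) {M : ℝ} (hM : ∀ x, |f x| ≤ M) :
    |∫ x, f x ∂(a : Measure (Euc d)) - ∫ x, f x ∂(b : Measure (Euc d))|
      ≤ M * ‖measDual a - measDual b‖ := by
  have h := (tendsto_integral_trunc (m := (a : Measure (Euc d))) (f := ⟨f, hf⟩) hM).sub
    (tendsto_integral_trunc (m := (b : Measure (Euc d))) (f := ⟨f, hf⟩) hM)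
  refine le_of_tendsto h.abs (Eventually.of_forall fun n => ?_)
  have h1 := (measDual a - measDual b).le_opNorm (trunc ⟨f, hf⟩ n)
  refine (h1.trans ?_)
  rw [mul_comm]
  exact mul_le_mul_of_nonneg_right (norm_trunc_le hM n) (norm_nonneg _)

theorem tendsto_trunc_norm (g : C₀(Euc d, ℝ)) :
    Tendsto (fun n => trunc g.toContinuousMap n) atTop (𝓝 g) := by
  rw [Metric.tendsto_atTop]
  intro ε hε
  have h := g.zero_at_infty'
  have hev := (Metric.tendsto_nhds.1 h) (ε / 2) (by positivity)
  rw [← Metric.cobounded_eq_cocompact] at hev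
  obtain ⟨r, hr⟩ := ((Metric.hasBasis_cobounded_compl_closedBall (0 : Euc d)).eventually_iff).1 hev
  obtain ⟨N, hN⟩ := exists_nat_ge r
  refine ⟨N, fun n hn => lt_of_le_of_lt ?_ (half_lt_self hε)⟩
  rw [dist_eq_norm]
  refine ZeroAtInftyContinuousMap.norm_le_of_forall (by positivity) fun x => ?_
  rw [ZeroAtInftyContinuousMap.sub_apply, trunc_apply]
  by_cases hx : ‖x‖ ≤ n
  · rw [cutoff_eq_one hx, mul_one]
    simp only [ZeroAtInftyContinuousMap.coe_toContinuousMap, sub_self, abs_zero]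
    positivity
  · have hx' : x ∈ (Metric.closedBall (0 : Euc d) r)ᶜ := by
      rw [mem_compl_iff, mem_closedBall_zero_iff, not_le]
      exact (hN.trans (by exact_mod_cast hn)).trans_lt (not_le.1 hx)
    have h1 := hr.2 hx'
    rw [Real.dist_eq, sub_zero] at h1
    have h2 : g x * cutoff d n x - g x = g x * (cutoff d n x - 1) := by ring
    simp only [ZeroAtInftyContinuousMap.coe_toContinuousMap]
    rw [h2, abs_mul]
    refine (mul_le_of_le_one_right (abs_nonneg _) ?_).trans h1.le
    rw [abs_le]
    constructor <;> linarith [cutoff_nonneg n x, cutoff_le_one n x]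

theorem probDual_injective : Function.Injective (probDual (d := d)) := by
  intro p q h
  apply Subtype.ext
  refine ext_of_forall_integral_eq_of_IsFiniteMeasure (μ := (p : Measure (Euc d)))
    (ν := (q : Measure (Euc d))) fun f => ?_
  have h0 := abs_integral_sub_integral_le p.toFiniteMeasure q.toFiniteMeasure f.continuous
    f.norm_coe_le_norm
  have h1 : measDual p.toFiniteMeasure - measDual q.toFiniteMeasure = 0 := sub_eq_zero.2 h
  rw [h1, norm_zero, mul_zero] at h0
  exact sub_eq_zero.1 (abs_nonpos_iff.1 h0)

/-- The set of probability measures, in the dual of `C_∞(ℝ^d)`. -/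
def probSet (d : ℕ) : Set (C0Dual d) := range probDual

/-- A positive functional of norm at most one without loss of mass at infinity is a probability
measure. -/
theorem mem_probSet_of_nonneg {Λ : C0Dual d} (hpos : ∀ g : C₀(Euc d, ℝ), (∀ x, 0 ≤ g x) → 0 ≤ Λ g)
    (hle : ‖Λ‖ ≤ 1) (htight : ∀ ε > 0, ∃ n, 1 - ε ≤ Λ (trunc 1 n)) : Λ ∈ probSet d := by
  -- The Riesz measure of the restriction to compactly supported functions: the norm bounds its mass
  -- by one, tightness excludes a deficit, and density of the truncations carries the representation
  -- to all of `C_∞(ℝ^d)`.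
  let Λc : CompactlySupportedContinuousMap (Euc d) ℝ →ₚ[ℝ] ℝ := PositiveLinearMap.mk₀
    { toFun := fun f => Λ (ccToC0 f)
      map_add' := fun f g => by rw [← map_add]; rfl
      map_smul' := fun c f => by rw [← map_smul]; rfl }
    fun f hf => hpos _ hf
  let m := RealRMK.rieszMeasure Λc
  have hm1 : m univ ≤ 1 := by
    have hmono : Monotone fun n : ℕ => Metric.closedBall (0 : Euc d) n := fun a b hab =>
      Metric.closedBall_subset_closedBall (by exact_mod_cast hab)
    rw [← Metric.iUnion_closedBall_nat (0 : Euc d), hmono.measure_iUnion]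
    refine iSup_le fun n => ?_
    refine (RealRMK.rieszMeasure_le_of_eq_one Λc (f := truncC 1 n)
      (fun x => mul_nonneg zero_le_one (cutoff_nonneg n x)) (isCompact_closedBall _ _)
      fun x hx => ?_).trans ?_
    · exact (one_mul _).trans (cutoff_eq_one (mem_closedBall_zero_iff.1 hx))
    · rw [← ENNReal.ofReal_one]
      refine ENNReal.ofReal_le_ofReal ?_
      have h1 := (le_abs_self _).trans (Λ.le_opNorm (trunc 1 n))
      have h2 : ‖trunc (1 : C(Euc d, ℝ)) n‖ ≤ 1 := norm_trunc_le (fun x => by simp) n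
      exact h1.trans (mul_le_one₀ hle (norm_nonneg _) h2)
  have hfin : IsFiniteMeasure m := ⟨hm1.trans_lt ENNReal.one_lt_top⟩
  have hΛ : ∀ f : CompactlySupportedContinuousMap (Euc d) ℝ, ∫ x, f x ∂m = Λ (ccToC0 f) :=
    RealRMK.integral_rieszMeasure Λc
  have hm2 : 1 ≤ m.real univ := by
    refine le_of_forall_pos_le_add fun ε hε => ?_
    obtain ⟨n, hn⟩ := htight ε hε
    have h1 : Λ (trunc 1 n) ≤ m.real univ := by
      rw [trunc, ← hΛ]
      calc ∫ x, (truncC 1 n) x ∂m ≤ ∫ _, (1 : ℝ) ∂m := by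
            refine integral_mono ((trunc 1 n).integrable m) (integrable_const _) fun x => ?_
            exact (one_mul _).trans_le (cutoff_le_one n x)
        _ = m.real univ := by simp
    linarith
  have hprob : IsProbabilityMeasure m := by
    refine ⟨le_antisymm hm1 ?_⟩
    rw [← ENNReal.ofReal_one, ← ofReal_measureReal]
    exact ENNReal.ofReal_le_ofReal hm2
  refine ⟨⟨m, hprob⟩, ?_⟩
  ext g
  have h1 : Tendsto (fun n => ∫ x, trunc g.toContinuousMap n x ∂m) atTop (𝓝 (∫ x, g x ∂m)) :=
    tendsto_integral_trunc g.abs_apply_le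
  have h2 := ((map_continuous Λ).tendsto g).comp (tendsto_trunc_norm g)
  exact tendsto_nhds_unique h1 (h2.congr fun n => (hΛ (truncC g.toContinuousMap n)).symm)

theorem nonneg_of_mem_probSet {Λ : C0Dual d} (h : Λ ∈ probSet d) {g : C₀(Euc d, ℝ)}
    (hg : ∀ x, 0 ≤ g x) : 0 ≤ Λ g := by
  obtain ⟨p, rfl⟩ := h
  exact integral_nonneg hg

theorem norm_le_of_mem_probSet {Λ : C0Dual d} (h : Λ ∈ probSet d) : ‖Λ‖ ≤ 1 := by
  obtain ⟨p, rfl⟩ := h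
  exact norm_probDual_le p

theorem tight_of_mem_probSet {Λ : C0Dual d} (h : Λ ∈ probSet d) :
    Tendsto (fun n => Λ (trunc 1 n)) atTop (𝓝 1) := by
  obtain ⟨p, rfl⟩ := h
  have := tendsto_integral_trunc (m := ((p : Measure (Euc d)))) (f := 1) (M := 1) (by simp)
  simpa [probDual_apply] using this

/-- No mass escapes to infinity in a norm limit, because all truncations of `1` lie in the unit ball
and are tested uniformly. -/
theorem isClosed_probSet : IsClosed (probSet d) := by
  refine isClosed_of_closure_subset fun Λ hΛ => ?_
  refine mem_probSet_of_nonneg (fun g hg => ?_) ?_ fun ε hε => ?_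
  · have hc : IsClosed {Λ : C0Dual d | 0 ≤ Λ g} :=
      isClosed_le continuous_const (C0Dual.eval g).continuous
    exact closure_minimal (fun Λ' h' => nonneg_of_mem_probSet h' hg) hc hΛ
  · exact closure_minimal (t := {Λ : C0Dual d | ‖Λ‖ ≤ 1}) (fun Λ' h' => norm_le_of_mem_probSet h')
      (isClosed_le continuous_norm continuous_const) hΛ
  · obtain ⟨Λ', h', hd⟩ := Metric.mem_closure_iff.1 hΛ (ε / 2) (by positivity)
    have h1 := (tight_of_mem_probSet h').eventually (lt_mem_nhds (show 1 - ε / 2 < 1 by linarith))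
    obtain ⟨n, hn⟩ := h1.exists
    refine ⟨n, ?_⟩
    have h2 := (Λ - Λ').le_opNorm (trunc 1 n)
    have h3 : ‖trunc (1 : C(Euc d, ℝ)) n‖ ≤ 1 := norm_trunc_le (fun x => by simp) n
    rw [dist_eq_norm] at hd
    have h4 : |(Λ - Λ') (trunc 1 n)| ≤ ε / 2 :=
      h2.trans ((mul_le_of_le_one_right (norm_nonneg _) h3).trans hd.le)
    have h5 := (abs_le.1 h4).1
    rw [C0Dual.sub_apply] at h5
    linarith

theorem convex_probSet : Convex ℝ (probSet d) := by
  intro Λ h Λ' h' a b ha hb hab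
  refine mem_probSet_of_nonneg (fun g hg => ?_) ?_ fun ε hε => ?_
  · exact add_nonneg (mul_nonneg ha (nonneg_of_mem_probSet h hg))
      (mul_nonneg hb (nonneg_of_mem_probSet h' hg))
  · have := (convex_closedBall (0 : C0Dual d) 1)
      (mem_closedBall_zero_iff.2 (norm_le_of_mem_probSet h))
      (mem_closedBall_zero_iff.2 (norm_le_of_mem_probSet h')) ha hb hab
    exact mem_closedBall_zero_iff.1 this
  · have h1 := ((tight_of_mem_probSet h).const_mul a).add ((tight_of_mem_probSet h').const_mul b)
    rw [mul_one, mul_one, hab] at h1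
    obtain ⟨n, hn⟩ := (h1.eventually (lt_mem_nhds (show 1 - ε < 1 by linarith))).exists
    exact ⟨n, hn.le⟩

end Measures

end

/-! ### Picard iteration for Volterra equations, and relaxation equations in convex sets. -/

noncomputable section

section Volterra

open Filter Topology

/-- The tail of the exponential series. -/
def expTail (a : ℝ) (n : ℕ) : ℝ := ∑' k, a ^ (k + n) / (k + n).factorial

theorem tendsto_expTail (a : ℝ) : Tendsto (expTail a) atTop (𝓝 0) :=
  tendsto_sum_nat_add fun n => a ^ n / n.factorial

theorem expTail_zero (a : ℝ) : expTail a 0 = Real.exp a := by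
  simp [expTail, Real.exp_eq_exp_ℝ, NormedSpace.exp_eq_tsum_div]

variable {β X : Type*} [MetricSpace X] {τ : β → ℝ} {T M : ℝ} {𝒞 : Set (β → X)}
  {Φ : (β → X) → β → X}

/-- Here `τ b` stands for the length of the time interval that `Φ` integrates over at `b`. Each
application turns `τ ^ n` into `τ ^ (n + 1) / (n + 1)`, so factorials accumulate and the horizon
need not be small. -/
theorem dist_iterate_le (hM : 0 ≤ M) (hΦ : MapsTo Φ 𝒞 𝒞)
    (hL : ∀ f ∈ 𝒞, ∀ g ∈ 𝒞, ∀ (n : ℕ) (D : ℝ), 0 ≤ D → (∀ b, dist (f b) (g b) ≤ D * τ b ^ n) →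
      ∀ b, dist (Φ f b) (Φ g b) ≤ D * M * (τ b ^ (n + 1) / (n + 1)))
    {f g : β → X} (hf : f ∈ 𝒞) (hg : g ∈ 𝒞) {D : ℝ} (hD0 : 0 ≤ D) (hD : ∀ b, dist (f b) (g b) ≤ D) (n : ℕ) :
    ∀ b, dist (Φ^[n] f b) (Φ^[n] g b) ≤ D * ((M * τ b) ^ n / n.factorial) := by
  induction n with
  | zero => simpa using hD
  | succ n ih =>
    intro b
    rw [Function.iterate_succ_apply', Function.iterate_succ_apply']
    have h := hL _ (hΦ.iterate n hf) _ (hΦ.iterate n hg) n (D * (M ^ n / n.factorial))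
      (by positivity) (fun b => (ih b).trans_eq (by rw [mul_pow]; ring)) b
    refine h.trans_eq ?_
    rw [Nat.factorial_succ, mul_pow]
    push_cast
    field_simp
    ring

theorem volterra_unique (hM : 0 ≤ M) (hΦ : MapsTo Φ 𝒞 𝒞)
    (hL : ∀ f ∈ 𝒞, ∀ g ∈ 𝒞, ∀ (n : ℕ) (D : ℝ), 0 ≤ D → (∀ b, dist (f b) (g b) ≤ D * τ b ^ n) →
      ∀ b, dist (Φ f b) (Φ g b) ≤ D * M * (τ b ^ (n + 1) / (n + 1)))
    {f g : β → X} (hf : f ∈ 𝒞) (hg : g ∈ 𝒞) (hff : Φ f = f) (hgg : Φ g = g) {D : ℝ}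
    (hD : ∀ b, dist (f b) (g b) ≤ D) : f = g := by
  ext b
  have h := dist_iterate_le hM hΦ hL hf hg (dist_nonneg.trans (hD b)) hD
  have h0 : Tendsto (fun n : ℕ => D * ((M * τ b) ^ n / n.factorial)) atTop (𝓝 0) := by
    simpa using (FloorSemiring.tendsto_pow_div_factorial_atTop (M * τ b)).const_mul D
  have h1 : dist (f b) (g b) ≤ 0 := ge_of_tendsto h0 (Eventually.of_forall fun n => by
    have := h n b
    rwa [Function.iterate_fixed hff, Function.iterate_fixed hgg] at this)
  exact dist_le_zero.1 h1

/-- Existence for Volterra type fixed point equations, with a rate for the Picard iteration. -/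
theorem volterra_exists [CompleteSpace X] (hτ0 : ∀ b, 0 ≤ τ b) (hτT : ∀ b, τ b ≤ T) (hM : 0 ≤ M)
    (hcl : ∀ (u : ℕ → β → X) f, (∀ n, u n ∈ 𝒞) → TendstoUniformly u f atTop → f ∈ 𝒞)
    (hΦ : MapsTo Φ 𝒞 𝒞)
    (hL : ∀ f ∈ 𝒞, ∀ g ∈ 𝒞, ∀ (n : ℕ) (D : ℝ), 0 ≤ D → (∀ b, dist (f b) (g b) ≤ D * τ b ^ n) →
      ∀ b, dist (Φ f b) (Φ g b) ≤ D * M * (τ b ^ (n + 1) / (n + 1)))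
    {f₀ : β → X} (hf₀ : f₀ ∈ 𝒞) {D : ℝ} (hD0 : 0 ≤ D) (hD : ∀ b, dist (f₀ b) (Φ f₀ b) ≤ D) :
    ∃ f ∈ 𝒞, Φ f = f ∧ ∀ n b, dist (Φ^[n] f₀ b) (f b) ≤ D * expTail (M * T) n := by
  have hstep : ∀ n b, dist (Φ^[n] f₀ b) (Φ^[n + 1] f₀ b) ≤ D * ((M * T) ^ n / n.factorial) := by
    intro n b
    rw [Function.iterate_succ_apply]
    refine (dist_iterate_le hM hΦ hL hf₀ (hΦ hf₀) hD0 hD n b).trans ?_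
    have := hτ0 b
    have := hτT b
    gcongr
  have hsum : Summable fun n : ℕ => D * ((M * T) ^ n / n.factorial) :=
    (Real.summable_pow_div_factorial (M * T)).mul_left D
  choose f hf using fun b => cauchySeq_tendsto_of_complete
    (cauchySeq_of_dist_le_of_summable _ (fun n => hstep n b) hsum)
  have hrate : ∀ n b, dist (Φ^[n] f₀ b) (f b) ≤ D * expTail (M * T) n := by
    intro n b
    refine (dist_le_tsum_of_dist_le_of_tendsto _ (fun n => hstep n b) hsum (hf b) n).trans_eq ?_
    rw [expTail, ← tsum_mul_left]
    exact tsum_congr fun k => by rw [add_comm n k]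
  have hlim : Tendsto (fun n => D * expTail (M * T) n) atTop (𝓝 0) := by
    simpa using (tendsto_expTail (M * T)).const_mul D
  have hunif : TendstoUniformly (fun n => Φ^[n] f₀) f atTop := by
    rw [Metric.tendstoUniformly_iff]
    intro ε hε
    filter_upwards [hlim.eventually (gt_mem_nhds hε)] with n hn b
    rw [dist_comm]
    exact (hrate n b).trans_lt hn
  have hfC : f ∈ 𝒞 := hcl _ _ (fun n => hΦ.iterate n hf₀) hunif
  refine ⟨f, hfC, ?_, hrate⟩
  ext b
  have hT : 0 ≤ T := (hτ0 b).trans (hτT b)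
  refine tendsto_nhds_unique ?_ ((tendsto_add_atTop_iff_nat 1).2 (hf b))
  rw [tendsto_iff_dist_tendsto_zero]
  refine squeeze_zero (fun _ => dist_nonneg) (fun n => ?_)
    (g := fun n => D * expTail (M * T) n * M * T) (by simpa using (hlim.mul_const M).mul_const T)
  have h0 : 0 ≤ D * expTail (M * T) n := dist_nonneg.trans (hrate n b)
  rw [Function.iterate_succ_apply']
  refine (hL _ (hΦ.iterate n hf₀) _ hfC 0 _ h0 (fun b => by simpa using hrate n b) b).trans ?_
  simp only [zero_add, pow_one, Nat.cast_zero, div_one]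
  exact mul_le_mul_of_nonneg_left (hτT b) (by positivity)

theorem integral_mul_sub_pow (D a t : ℝ) (n : ℕ) :
    ∫ s in a..t, D * (s - a) ^ n = D * ((t - a) ^ (n + 1) / (n + 1)) := by
  rw [intervalIntegral.integral_const_mul,
    intervalIntegral.integral_comp_sub_right (fun s => s ^ n) a, integral_pow]
  simp

theorem integral_mul_sub_pow' (D t b : ℝ) (n : ℕ) :
    ∫ s in t..b, D * (b - s) ^ n = D * ((b - t) ^ (n + 1) / (n + 1)) := by
  rw [intervalIntegral.integral_const_mul,
    intervalIntegral.integral_comp_sub_left (fun s => s ^ n) b, integral_pow]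
  simp

end Volterra

section RelaxationODE

open Filter Topology

variable {X : Type*} [NormedAddCommGroup X] [NormedSpace ℝ X]

/-- The solution `η` of `η' = C (G - η)`, `η a = k₀`. -/
def relax (C a : ℝ) (k₀ : X) (G : ℝ → X) (t : ℝ) : X :=
  Real.exp (-(C * (t - a))) • (k₀ + ∫ s in a..t, (C * Real.exp (C * (s - a))) • G s)

variable {C a t : ℝ} {k₀ : X} {G G' : ℝ → X}

theorem relax_self : relax C a k₀ G a = k₀ := by simp [relax]

theorem hasDerivAt_relax [CompleteSpace X] (hG : Continuous G) :
    HasDerivAt (relax C a k₀ G) (C • (G t - relax C a k₀ G t)) t := by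
  have hc : Continuous fun s => (C * Real.exp (C * (s - a))) • G s := by fun_prop
  have h1 : HasDerivAt (fun t => k₀ + ∫ s in a..t, (C * Real.exp (C * (s - a))) • G s)
      ((C * Real.exp (C * (t - a))) • G t) t :=
    (hc.integral_hasStrictDerivAt a t).hasDerivAt.const_add k₀
  have h2 : HasDerivAt (fun t => Real.exp (-(C * (t - a)))) (Real.exp (-(C * (t - a))) * (-C)) t := by
    have := (((hasDerivAt_id t).sub_const a).const_mul C).neg.exp
    simpa using this
  refine (h2.fun_smul h1).congr_deriv ?_
  have h3 : Real.exp (-(C * (t - a))) * (C * Real.exp (C * (t - a))) = C := by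
    rw [mul_left_comm, ← Real.exp_add, neg_add_cancel, Real.exp_zero, mul_one]
  rw [smul_smul, h3, smul_sub, relax, smul_smul, sub_eq_add_neg (C • G t), mul_neg, neg_smul,
    mul_comm (Real.exp _) C, ← sub_eq_add_neg]

theorem continuous_relax [CompleteSpace X] (hG : Continuous G) : Continuous (relax C a k₀ G) :=
  continuous_iff_continuousAt.2 fun _ => (hasDerivAt_relax hG).continuousAt

/-- The formula averages `k₀` with weight `e^{-C(t-a)}` and `G s` with density `C e^{-C(t-s)}`;
these have total mass one. An average outside `K` would contradict Hahn–Banach separation. -/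
theorem relax_mem [CompleteSpace X] {K : Set X} (hK : Convex ℝ K) (hcl : IsClosed K) (hC : 0 ≤ C) (hk₀ : k₀ ∈ K)
    (hG : Continuous G) (hat : a ≤ t) (hGK : ∀ s ∈ Icc a t, G s ∈ K) : relax C a k₀ G t ∈ K := by
  by_contra hmem
  obtain ⟨f, u, hfu, hu⟩ := geometric_hahn_banach_closed_point hK hcl hmem
  refine hu.not_ge ?_
  have hc : Continuous fun s => (C * Real.exp (C * (s - a))) • G s := by fun_prop
  rw [relax, map_smul, map_add, ← f.intervalIntegral_comp_comm (hc.intervalIntegrable _ _)]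
  have h1 : ∫ s in a..t, f ((C * Real.exp (C * (s - a))) • G s)
      ≤ ∫ s in a..t, (C * Real.exp (C * (s - a))) * u := by
    refine intervalIntegral.integral_mono_on hat ((f.continuous.comp hc).intervalIntegrable _ _)
      (Continuous.intervalIntegrable (by fun_prop) _ _) fun s hs => ?_
    rw [map_smul, smul_eq_mul]
    exact mul_le_mul_of_nonneg_left (hfu _ (hGK s hs)).le (by positivity)
  have h2 : ∫ s in a..t, (C * Real.exp (C * (s - a))) * u = (Real.exp (C * (t - a)) - 1) * u := by
    rw [intervalIntegral.integral_mul_const]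
    congr 1
    have hd : ∀ s ∈ uIcc a t, HasDerivAt (fun s => Real.exp (C * (s - a)))
        (C * Real.exp (C * (s - a))) s := fun s _ => by
      have := (((hasDerivAt_id s).sub_const a).const_mul C).exp
      simpa [mul_comm] using this
    rw [intervalIntegral.integral_eq_sub_of_hasDerivAt hd
      (Continuous.intervalIntegrable (by fun_prop) _ _)]
    simp
  have h3 := (hfu _ hk₀).le
  have h4 : f k₀ + ∫ s in a..t, f ((C * Real.exp (C * (s - a))) • G s)
      ≤ Real.exp (C * (t - a)) * u := by linarith
  rw [smul_eq_mul]
  calc Real.exp (-(C * (t - a))) * (f k₀ + ∫ s in a..t, f ((C * Real.exp (C * (s - a))) • G s))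
      ≤ Real.exp (-(C * (t - a))) * (Real.exp (C * (t - a)) * u) := by gcongr
    _ = u := by rw [← mul_assoc, ← Real.exp_add, neg_add_cancel, Real.exp_zero, one_mul]

/-- The growing exponential in the integrand is at most its value at `t`, which the prefactor
cancels. What remains is the power estimate that `volterra_exists` asks for. -/
theorem dist_relax_le (hC : 0 ≤ C) (hG : Continuous G) (hG' : Continuous G') (hat : a ≤ t) {D : ℝ}
    {n : ℕ} (h : ∀ s ∈ Icc a t, dist (G s) (G' s) ≤ D * (s - a) ^ n) :
    dist (relax C a k₀ G t) (relax C a k₀ G' t) ≤ D * C * ((t - a) ^ (n + 1) / (n + 1)) := by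
  have hc : ∀ G : ℝ → X, Continuous G → Continuous fun s => (C * Real.exp (C * (s - a))) • G s :=
    fun G hG => by fun_prop
  rw [dist_eq_norm, relax, relax, ← smul_sub, add_sub_add_left_eq_sub,
    ← intervalIntegral.integral_sub ((hc G hG).intervalIntegrable _ _)
      ((hc G' hG').intervalIntegrable _ _), norm_smul, Real.norm_of_nonneg (Real.exp_pos _).le]
  have h1 : ‖∫ s in a..t, ((C * Real.exp (C * (s - a))) • G s - (C * Real.exp (C * (s - a))) • G' s)‖
      ≤ ∫ s in a..t, (Real.exp (C * (t - a)) * (D * C)) * (s - a) ^ n := by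
    refine intervalIntegral.norm_integral_le_of_norm_le hat (Eventually.of_forall fun s hs => ?_)
      (Continuous.intervalIntegrable (by fun_prop) _ _)
    have hs' : s ∈ Icc a t := Ioc_subset_Icc_self hs
    rw [← smul_sub, norm_smul, Real.norm_of_nonneg (by positivity), ← dist_eq_norm]
    calc C * Real.exp (C * (s - a)) * dist (G s) (G' s)
        ≤ C * Real.exp (C * (t - a)) * (D * (s - a) ^ n) := by
          gcongr
          · exact hs.2
          · exact h s hs'
      _ = _ := by ring
  rw [integral_mul_sub_pow] at h1
  calc _ ≤ Real.exp (-(C * (t - a))) *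
        (Real.exp (C * (t - a)) * (D * C) * ((t - a) ^ (n + 1) / (n + 1))) := by gcongr
    _ = _ := by
      rw [mul_assoc (Real.exp (C * (t - a))), ← mul_assoc, ← Real.exp_add, neg_add_cancel,
        Real.exp_zero, one_mul]

/-- Solution of `η' = C (F(t, η) - η)` in a bounded closed convex set that `F` maps to itself,
with the rate of convergence of the Picard iteration. -/
theorem exists_relaxation_solution [CompleteSpace X] {K : Set X} (hK : Convex ℝ K) (hcl : IsClosed K) {R : ℝ}
    (hR : ∀ x ∈ K, ∀ y ∈ K, dist x y ≤ R) {b L : ℝ} (hab : a ≤ b) (hC : 0 ≤ C) (hL : 0 ≤ L)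
    {F : ℝ → X → X}
    (hF : ∀ t ∈ Icc a b, MapsTo (F t) K K)
    (hlip : ∀ t ∈ Icc a b, ∀ x ∈ K, ∀ y ∈ K, dist (F t x) (F t y) ≤ L * dist x y)
    (hcont : ∀ η : ℝ → X, Continuous η → (∀ t, η t ∈ K) →
      ContinuousOn (fun t => F t (η t)) (Icc a b))
    (hk₀ : k₀ ∈ K) :
    ∃ η : ℝ → X, Continuous η ∧ (∀ t, η t ∈ K) ∧ η a = k₀ ∧
      (∀ t ∈ Icc a b, HasDerivWithinAt η (C • (F t (η t) - η t)) (Icc a b) t) ∧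
      ∀ S : ℕ → Set X, (∀ n, Convex ℝ (S n) ∧ IsClosed (S n) ∧ S n ⊆ K ∧ k₀ ∈ S n) →
        (∀ n, ∀ t ∈ Icc a b, MapsTo (F t) (S n) (S (n + 1))) →
        ∀ n, ∀ t ∈ Icc a b, ∃ y ∈ S n, dist y (η t) ≤ R * expTail (L * C * (b - a)) n := by
  -- Curves live on `[a, b]`; composing with the projection makes the integrands continuous on the
  -- whole line.
  let pr : ℝ → Icc a b := projIcc a b hab
  have hpr : Continuous pr := continuous_projIcc
  let ext : (Icc a b → X) → ℝ → X := fun f s => F (pr s) (f (pr s))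
  let 𝒞 : Set (Icc a b → X) := {f | Continuous f ∧ ∀ t, f t ∈ K}
  have hext : ∀ f ∈ 𝒞, Continuous (ext f) := by
    intro f hf
    have h := hcont (fun s => f (pr s)) (hf.1.comp hpr) fun s => hf.2 _
    have h2 := h.comp_continuous (f := fun s : ℝ => (pr s : ℝ)) (by fun_prop) fun s => (pr s).2
    refine h2.congr fun s => ?_
    simp only [ext, pr, Function.comp_apply, projIcc_val]
  have hextK : ∀ f ∈ 𝒞, ∀ s, ext f s ∈ K := fun f hf s => hF _ (pr s).2 (hf.2 _)
  let Φ : (Icc a b → X) → Icc a b → X := fun f t => relax C a k₀ (ext f) t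
  have hΦ : MapsTo Φ 𝒞 𝒞 := fun f hf =>
    ⟨(continuous_relax (hext f hf)).comp continuous_subtype_val,
      fun t => relax_mem hK hcl hC hk₀ (hext f hf) t.2.1 fun s _ => hextK f hf s⟩
  have hLip : ∀ f ∈ 𝒞, ∀ g ∈ 𝒞, ∀ (n : ℕ) (D : ℝ), 0 ≤ D →
      (∀ t, dist (f t) (g t) ≤ D * ((t : ℝ) - a) ^ n) →
      ∀ t, dist (Φ f t) (Φ g t) ≤ D * (L * C) * (((t : ℝ) - a) ^ (n + 1) / (n + 1)) := by
    intro f hf g hg n D hD h t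
    have := dist_relax_le (k₀ := k₀) (D := L * D) (n := n) hC (hext f hf) (hext g hg) t.2.1
      fun s hs => ?_
    · exact this.trans_eq (by ring)
    · have hs' : s ∈ Icc a b := ⟨hs.1, hs.2.trans t.2.2⟩
      have h1 := (hlip _ (pr s).2 _ (hf.2 (pr s)) _ (hg.2 (pr s))).trans
        (mul_le_mul_of_nonneg_left (h (pr s)) hL)
      have h2 : ((pr s : ℝ)) = s := by simp only [pr, projIcc_of_mem hab hs']
      rw [h2] at h1
      simp only [ext, h2]
      exact h1.trans_eq (by ring)
  have hcl𝒞 : ∀ (u : ℕ → Icc a b → X) f, (∀ n, u n ∈ 𝒞) → TendstoUniformly u f atTop → f ∈ 𝒞 := by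
    intro u f hu huf
    refine ⟨huf.continuous (Frequently.of_forall fun n => (hu n).1), fun t => ?_⟩
    exact hcl.mem_of_tendsto (huf.tendsto_at t) (Eventually.of_forall fun n => (hu n).2 t)
  have hf₀ : (fun _ => k₀) ∈ 𝒞 := ⟨continuous_const, fun _ => hk₀⟩
  obtain ⟨f, hf, hfix, hrate⟩ := volterra_exists (τ := fun t : Icc a b => (t : ℝ) - a)
    (T := b - a) (M := L * C) (fun t => sub_nonneg.2 t.2.1) (fun t => sub_le_sub_right t.2.2 a)
    (mul_nonneg hL hC) hcl𝒞 hΦ hLip hf₀ (dist_nonneg.trans (hR _ hk₀ _ hk₀))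
    fun t => hR _ hk₀ _ ((hΦ hf₀).2 t)
  have hη : ∀ t ∈ Icc a b, f (pr t) = relax C a k₀ (ext f) t := fun t ht => by
    conv_lhs => rw [← hfix]
    simp only [Φ, pr, projIcc_of_mem hab ht]
  refine ⟨fun t => f (pr t), hf.1.comp hpr, fun t => hf.2 _, ?_, fun t ht => ?_,
    fun S hS hFS n => ?_⟩
  · change f (pr a) = k₀
    rw [hη a (left_mem_Icc.2 hab), relax_self]
  · have h1 := (hasDerivAt_relax (C := C) (a := a) (k₀ := k₀) (t := t) (hext f hf)).hasDerivWithinAt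
      (s := Icc a b)
    rw [← hη t ht] at h1
    have h2 : ext f t = F t (f (pr t)) := by simp only [ext, pr, projIcc_of_mem hab ht]
    rw [h2] at h1
    exact h1.congr_of_mem hη ht
  -- The next Picard iterate averages `k₀` and values of `F` on `S n`, all of which lie in the
  -- convex closed set `S (n + 1)`. The rate depends on `F` only through `L`, and so is uniform in
  -- the control later on.
  · have hiter : ∀ n, ∀ t, Φ^[n] (fun _ => k₀) t ∈ S n := by
      intro n
      induction n with
      | zero => exact fun _ => (hS 0).2.2.2
      | succ n ih =>
        intro t
        rw [Function.iterate_succ_apply']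
        have hmem : Φ^[n] (fun _ => k₀) ∈ 𝒞 := hΦ.iterate n hf₀
        exact relax_mem (hS _).1 (hS _).2.1 hC (hS _).2.2.2 (hext _ hmem) t.2.1
          fun s _ => hFS n _ (pr s).2 (ih _)
    intro t ht
    exact ⟨_, hiter n (pr t), hrate n (pr t)⟩

/-- Stability of `η' = C (F(t, η) - η)` under perturbation of `F`. -/
theorem dist_relaxation_solution_le {K : Set X} {b L δ : ℝ} (hC : 0 < C) (hL : 0 ≤ L) (hδ : 0 ≤ δ)
    {F F' : ℝ → X → X}
    (hlip : ∀ t ∈ Icc a b, ∀ x ∈ K, ∀ y ∈ K, dist (F t x) (F t y) ≤ L * dist x y)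
    {η η' : ℝ → X} (hηK : ∀ t ∈ Icc a b, η t ∈ K) (hηK' : ∀ t ∈ Icc a b, η' t ∈ K)
    (h0 : η a = η' a)
    (hη : ∀ t ∈ Icc a b, HasDerivWithinAt η (C • (F t (η t) - η t)) (Icc a b) t)
    (hη' : ∀ t ∈ Icc a b, HasDerivWithinAt η' (C • (F' t (η' t) - η' t)) (Icc a b) t)
    (hFF : ∀ t ∈ Icc a b, dist (F' t (η' t)) (F t (η' t)) ≤ δ) :
    ∀ t ∈ Icc a b, dist (η t) (η' t) ≤ δ * Real.exp (C * (L + 1) * (b - a)) := by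
  have hK0 : 0 < C * (L + 1) := by positivity
  have hIci : ∀ (ζ : ℝ → X) ζ' t, t ∈ Ico a b → HasDerivWithinAt ζ ζ' (Icc a b) t →
      HasDerivWithinAt ζ ζ' (Ici t) t := fun ζ ζ' t ht h =>
    (h.mono (Icc_subset_Icc_left ht.1)).mono_of_mem_nhdsWithin (Icc_mem_nhdsGE ht.2)
  -- Grönwall: `η` is an exact trajectory, `η'` one with error `C δ`, and the field has Lipschitz
  -- constant `C (L + 1)`.
  have h := dist_le_of_approx_trajectories_ODE_of_mem (v := fun t x => C • (F t x - x))
    (s := fun _ => K) (K := (C * (L + 1)).toNNReal) (f := η) (g := η') (a := a) (b := b)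
    (εf := 0) (εg := C * δ) (δ := 0)
    (f' := fun t => C • (F t (η t) - η t)) (g' := fun t => C • (F' t (η' t) - η' t)) ?_
    (fun t ht => (hη t ht).continuousWithinAt)
    (fun t ht => hIci _ _ t ht (hη t (Ico_subset_Icc_self ht))) (fun t _ => (dist_self _).le)
    (fun t ht => hηK t (Ico_subset_Icc_self ht))
    (fun t ht => (hη' t ht).continuousWithinAt)
    (fun t ht => hIci _ _ t ht (hη' t (Ico_subset_Icc_self ht))) ?_
    (fun t ht => hηK' t (Ico_subset_Icc_self ht)) (by rw [h0, dist_self])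
  · intro t ht
    refine (h t ht).trans ?_
    rw [Real.coe_toNNReal _ hK0.le, gronwallBound_of_K_ne_0 hK0.ne']
    simp only [zero_mul, zero_add]
    have h1 : C * δ / (C * (L + 1)) ≤ δ := by
      rw [mul_div_mul_left _ _ hC.ne', div_le_iff₀ (by positivity)]
      nlinarith
    have h2 : Real.exp (C * (L + 1) * (t - a)) - 1 ≤ Real.exp (C * (L + 1) * (b - a)) := by
      have : Real.exp (C * (L + 1) * (t - a)) ≤ Real.exp (C * (L + 1) * (b - a)) := by
        gcongr; exact ht.2
      linarith
    exact mul_le_mul h1 h2 (by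
      rw [sub_nonneg]; exact Real.one_le_exp (mul_nonneg hK0.le (sub_nonneg.2 ht.1))) hδ
  · intro t ht
    refine LipschitzOnWith.of_dist_le_mul fun x hx y hy => ?_
    rw [Real.coe_toNNReal _ hK0.le, dist_smul₀, Real.norm_of_nonneg hC.le, mul_assoc]
    refine mul_le_mul_of_nonneg_left ?_ hC.le
    refine (dist_sub_sub_le _ _ _ _).trans ?_
    have := hlip t (Ico_subset_Icc_self ht) x hx y hy
    linarith
  · intro t ht
    rw [dist_smul₀, Real.norm_of_nonneg hC.le, dist_sub_right]
    exact mul_le_mul_of_nonneg_left (hFF t (Ico_subset_Icc_self ht)) hC.le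

end RelaxationODE

end

/-! ### Bounds and continuity of the kernel, the generator and the payoffs. -/

noncomputable section

namespace MeanFieldGame

open Filter Topology

variable {d m : ℕ} {G : MeanFieldGame d m}

theorem left_mem_I (G : MeanFieldGame d m) : 0 ∈ G.I := left_mem_Icc.2 G.T_pos.le

theorem right_mem_I (G : MeanFieldGame d m) : G.T ∈ G.I := right_mem_Icc.2 G.T_pos.le

theorem isCurve_iff {μ : ℝ → ProbabilityMeasure (Euc d)} :
    G.IsCurve μ ↔ ContinuousOn (fun t => probDual (μ t)) G.I := by
  simp only [IsCurve, Metric.continuousOn_iff, starNorm_probToSigned_sub, dist_eq_norm,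
    Real.norm_eq_abs]

/-- The kernel as an element of the dual of `C_∞(ℝ^d)`. -/
def kern (G : MeanFieldGame d m) (t : ℝ) (x : Euc d) (p : ProbabilityMeasure (Euc d)) (u : Euc m) :
    C0Dual d :=
  measDual (G.ν t x (probToSigned p) u)

/-- A positive bound for the masses of the kernel. -/
def HypothesisA.mass (hA : G.HypothesisA) : ℝ := max 1 (hA.bounded.choose : ℝ)

/-- A Lipschitz constant for the kernel. -/
def HypothesisA.lip (hA : G.HypothesisA) : ℝ := max 0 hA.lipschitz.choose

theorem HypothesisA.mass_pos (hA : G.HypothesisA) : 0 < hA.mass := lt_max_of_lt_left one_pos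

theorem HypothesisA.lip_nonneg (hA : G.HypothesisA) : 0 ≤ hA.lip := le_max_left _ _

theorem HypothesisA.mass_le (hA : G.HypothesisA) {t : ℝ} (ht : t ∈ G.I) (x : Euc d) (p : ProbabilityMeasure (Euc d))
    {u : Euc m} (hu : u ∈ G.U) :
    (G.ν t x (probToSigned p) u : Measure (Euc d)).real univ ≤ hA.mass :=
  (NNReal.coe_le_coe.2 (hA.bounded.choose_spec t ht x _ (probToSigned_mem_unitBall p) u hu)).trans
    (le_max_right _ _)

theorem HypothesisA.norm_kern_sub_le (hA : G.HypothesisA) {t : ℝ} (ht : t ∈ G.I) (x x' : Euc d)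
    (p p' : ProbabilityMeasure (Euc d)) {u u' : Euc m} (hu : u ∈ G.U) (hu' : u' ∈ G.U) :
    ‖G.kern t x p u - G.kern t x' p' u'‖
      ≤ hA.lip * (‖x - x'‖ + ‖probDual p - probDual p'‖ + ‖u - u'‖) := by
  have := hA.lipschitz.choose_spec t ht x x' _ (probToSigned_mem_unitBall p) _
    (probToSigned_mem_unitBall p') u hu u' hu'
  rw [starNorm_finToSigned_sub, starNorm_probToSigned_sub] at this
  exact this.trans (mul_le_mul_of_nonneg_right (le_max_right _ _) (by positivity))

theorem HypothesisA.continuousOn_kern (hA : G.HypothesisA) (x : Euc d)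
    (p : ProbabilityMeasure (Euc d)) {u : Euc m} (hu : u ∈ G.U) :
    ContinuousOn (fun t => G.kern t x p u) G.I := by
  rw [Metric.continuousOn_iff]
  intro t ht ε hε
  obtain ⟨δ, hδ, h⟩ := hA.continuous_time x _ (probToSigned_mem_unitBall p) u hu t ht ε hε
  refine ⟨δ, hδ, fun s hs hst => ?_⟩
  rw [dist_eq_norm, kern, kern, ← starNorm_finToSigned_sub]
  exact h s hs hst

/-- Continuity in time is only known for fixed remaining arguments. The Lipschitz bound, uniform in
time, first moves those to their limits. -/
theorem HypothesisA.tendsto_kern (hA : G.HypothesisA) {ι : Type*} {l : Filter ι} {τ : ι → ℝ} {ξ : ι → Euc d}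
    {π : ι → ProbabilityMeasure (Euc d)} {υ : ι → Euc m} {t : ℝ} {x : Euc d}
    {p : ProbabilityMeasure (Euc d)} {u : Euc m} (ht : t ∈ G.I) (hu : u ∈ G.U)
    (hτ : Tendsto τ l (𝓝[G.I] t)) (hξ : Tendsto ξ l (𝓝 x))
    (hπ : Tendsto (fun i => probDual (π i)) l (𝓝 (probDual p))) (hυ : Tendsto υ l (𝓝 u))
    (hυU : ∀ᶠ i in l, υ i ∈ G.U) :
    Tendsto (fun i => G.kern (τ i) (ξ i) (π i) (υ i)) l (𝓝 (G.kern t x p u)) := by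
  have h1 : Tendsto (fun i => G.kern (τ i) x p u) l (𝓝 (G.kern t x p u)) :=
    (hA.continuousOn_kern x p hu t ht).tendsto.comp hτ
  have h2 : Tendsto (fun i => hA.lip * (‖ξ i - x‖ + ‖probDual (π i) - probDual p‖ + ‖υ i - u‖)
      + ‖G.kern (τ i) x p u - G.kern t x p u‖) l (𝓝 0) := by
    have e1 := tendsto_iff_norm_sub_tendsto_zero.1 hξ
    have e2 := tendsto_iff_norm_sub_tendsto_zero.1 hπ
    have e3 := tendsto_iff_norm_sub_tendsto_zero.1 hυ
    have e4 := tendsto_iff_norm_sub_tendsto_zero.1 h1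
    simpa using (((e1.add e2).add e3).const_mul hA.lip).add e4
  rw [tendsto_iff_norm_sub_tendsto_zero]
  refine squeeze_zero' (Eventually.of_forall fun _ => norm_nonneg _) ?_ h2
  filter_upwards [hτ.eventually self_mem_nhdsWithin, hυU] with i hi hiU
  refine (norm_sub_le_norm_sub_add_norm_sub _ (G.kern (τ i) x p u) _).trans ?_
  exact add_le_add_left (hA.norm_kern_sub_le hi _ _ _ _ hiU hu) _

section Generator

variable {f g : Euc d → ℝ} {M : ℝ} {t t' : ℝ} {p p' : ProbabilityMeasure (Euc d)} {u u' : Euc m}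

theorem abs_sub_le_two_mul (hM : ∀ x, |f x| ≤ M) (x y : Euc d) : |f y - f x| ≤ 2 * M := by
  have := (abs_sub (f y) (f x)).trans (add_le_add (hM y) (hM x))
  linarith

theorem HypothesisA.abs_gen_le (hA : G.HypothesisA) (ht : t ∈ G.I) (hu : u ∈ G.U)
    (hM : ∀ x, |f x| ≤ M) (x : Euc d) :
    |G.gen t x (probToSigned p) u f| ≤ 2 * hA.mass * M := by
  have h0 : 0 ≤ M := (abs_nonneg _).trans (hM x)
  have h := norm_integral_le_of_norm_le_const (μ := (G.ν t x (probToSigned p) u : Measure (Euc d)))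
    (f := fun y => f y - f x) (Eventually.of_forall (abs_sub_le_two_mul hM x))
  refine h.trans ?_
  have := hA.mass_le ht x p hu
  calc 2 * M * _ ≤ 2 * M * hA.mass := by gcongr
    _ = 2 * hA.mass * M := by ring

theorem gen_sub (ρ : SignedMeasure (Euc d)) (hf : Continuous f) (hfM : ∀ x, |f x| ≤ M)
    (hg : Continuous g) {M' : ℝ} (hgM : ∀ x, |g x| ≤ M') (x : Euc d) :
    G.gen t x ρ u (fun y => f y - g y) = G.gen t x ρ u f - G.gen t x ρ u g := by
  rw [gen, gen, gen, ← integral_sub]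
  · congr 1; ext y; ring
  · exact integrable_of_continuous_of_abs_le (by fun_prop) (abs_sub_le_two_mul hfM x)
  · exact integrable_of_continuous_of_abs_le (by fun_prop) (abs_sub_le_two_mul hgM x)

theorem HypothesisA.abs_gen_sub_gen_le (hA : G.HypothesisA) (ht : t ∈ G.I) (hu : u ∈ G.U)
    (hf : Continuous f) (hfM : ∀ x, |f x| ≤ M) (hg : Continuous g) {M' : ℝ}
    (hgM : ∀ x, |g x| ≤ M') {D : ℝ} (hD : ∀ x, |f x - g x| ≤ D) (x : Euc d) :
    |G.gen t x (probToSigned p) u f - G.gen t x (probToSigned p) u g| ≤ 2 * hA.mass * D := by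
  rw [← gen_sub _ hf hfM hg hgM]
  exact hA.abs_gen_le ht hu hD x

theorem abs_gen_sub_gen_le_norm_kern (hf : Continuous f) (hM : ∀ x, |f x| ≤ M) (x : Euc d) :
    |G.gen t x (probToSigned p) u f - G.gen t' x (probToSigned p') u' f|
      ≤ 2 * M * ‖G.kern t x p u - G.kern t' x p' u'‖ :=
  abs_integral_sub_integral_le _ _ (by fun_prop) (abs_sub_le_two_mul hM x)

end Generator

/-- `V` is continuous on `[0, T] × ℝ^d` and bounded by `M` there. -/
structure CbOn (G : MeanFieldGame d m) (V : ℝ → Euc d → ℝ) (M : ℝ) : Prop where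
  continuousOn : ContinuousOn (fun p : ℝ × Euc d => V p.1 p.2) (G.I ×ˢ univ)
  bound : ∀ t ∈ G.I, ∀ x, |V t x| ≤ M

theorem CbOn.continuous {V : ℝ → Euc d → ℝ} {M : ℝ} (hV : G.CbOn V M) {t : ℝ} (ht : t ∈ G.I) :
    Continuous (V t) :=
  hV.continuousOn.comp_continuous (f := fun x => (t, x)) (by fun_prop) fun _ => ⟨ht, mem_univ _⟩

section Tendsto

variable {ι : Type*} {l : Filter ι} {τ : ι → ℝ} {ξ : ι → Euc d}
    {π : ι → ProbabilityMeasure (Euc d)} {υ : ι → Euc m} {t : ℝ} {x : Euc d}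
    {p : ProbabilityMeasure (Euc d)} {u : Euc m}

/-- Under the limiting kernel, pointwise convergence of `V` suffices by dominated convergence;
exchanging the kernel costs `2 M` times its distance in norm. -/
theorem HypothesisA.tendsto_gen [l.IsCountablyGenerated] (hA : G.HypothesisA) {V : ℝ → Euc d → ℝ}
    {M : ℝ} (hV : G.CbOn V M) (ht : t ∈ G.I) (hu : u ∈ G.U)
    (hτ : Tendsto τ l (𝓝[G.I] t)) (hξ : Tendsto ξ l (𝓝 x))
    (hπ : Tendsto (fun i => probDual (π i)) l (𝓝 (probDual p))) (hυ : Tendsto υ l (𝓝 u))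
    (hυU : ∀ᶠ i in l, υ i ∈ G.U) :
    Tendsto (fun i => G.gen (τ i) (ξ i) (probToSigned (π i)) (υ i) (V (τ i))) l
      (𝓝 (G.gen t x (probToSigned p) u (V t))) := by
  have hk := hA.tendsto_kern ht hu hτ hξ hπ hυ hυU
  have hτI := hτ.eventually self_mem_nhdsWithin
  have hVl : ∀ {η : ι → Euc d} {y : Euc d}, Tendsto η l (𝓝 y) →
      Tendsto (fun i => V (τ i) (η i)) l (𝓝 (V t y)) := fun {η y} hη => by
    refine (hV.continuousOn (t, y) ⟨ht, mem_univ _⟩).tendsto.comp (x := l)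
      (f := fun i => (τ i, η i)) ?_
    rw [nhdsWithin_prod_eq, nhdsWithin_univ]
    exact hτ.prodMk hη
  have h1 : Tendsto (fun i => ∫ y, (V (τ i) y - V (τ i) (ξ i))
      ∂(G.ν t x (probToSigned p) u : Measure (Euc d))) l (𝓝 (G.gen t x (probToSigned p) u (V t))) := by
    refine tendsto_integral_filter_of_dominated_convergence (fun _ => 2 * M) ?_ ?_
      (integrable_const _) (Eventually.of_forall fun y => (hVl tendsto_const_nhds).sub (hVl hξ))
    · filter_upwards [hτI] with i hi
      exact ((hV.continuous hi).sub continuous_const).aestronglyMeasurable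
    · filter_upwards [hτI] with i hi
      exact Eventually.of_forall fun y => abs_sub_le_two_mul (hV.bound _ hi) _ _
  refine h1.congr_dist ?_
  have h2 : Tendsto (fun i => 2 * M * ‖G.kern t x p u - G.kern (τ i) (ξ i) (π i) (υ i)‖) l (𝓝 0) := by
    have := (tendsto_const_nhds (x := G.kern t x p u)).sub hk
    rw [sub_self] at this
    simpa using this.norm.const_mul (2 * M)
  refine squeeze_zero' (Eventually.of_forall fun _ => dist_nonneg) ?_ h2
  filter_upwards [hτI] with i hi
  exact abs_integral_sub_integral_le _ _ ((hV.continuous hi).sub continuous_const)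
    (abs_sub_le_two_mul (hV.bound _ hi) _)

/-- A bound for the running payoff. -/
def HypothesisB.bJ (hB : G.HypothesisB) : ℝ := max 0 hB.J_bounded.choose

/-- A Lipschitz constant for the running payoff. -/
def HypothesisB.lJ (hB : G.HypothesisB) : ℝ := max 0 hB.J_lipschitz.choose

/-- A bound for the terminal payoff. -/
def HypothesisB.bV (hB : G.HypothesisB) : ℝ := max 0 hB.VT_bounded.choose

/-- A Lipschitz constant for the terminal payoff. -/
def HypothesisB.lV (hB : G.HypothesisB) : ℝ := max 0 hB.VT_lipschitz.choose

theorem HypothesisB.bJ_nonneg (hB : G.HypothesisB) : 0 ≤ hB.bJ := le_max_left _ _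

theorem HypothesisB.lJ_nonneg (hB : G.HypothesisB) : 0 ≤ hB.lJ := le_max_left _ _

theorem HypothesisB.bV_nonneg (hB : G.HypothesisB) : 0 ≤ hB.bV := le_max_left _ _

theorem HypothesisB.lV_nonneg (hB : G.HypothesisB) : 0 ≤ hB.lV := le_max_left _ _

theorem HypothesisB.abs_J_le (hB : G.HypothesisB) (ht : t ∈ G.I) (x : Euc d)
    (p : ProbabilityMeasure (Euc d)) (hu : u ∈ G.U) : |G.J t x (probToSigned p) u| ≤ hB.bJ :=
  (hB.J_bounded.choose_spec t ht x _ (probToSigned_mem_unitBall p) u hu).trans (le_max_right _ _)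

theorem HypothesisB.abs_J_sub_le (hB : G.HypothesisB) (ht : t ∈ G.I) (x x' : Euc d)
    (p p' : ProbabilityMeasure (Euc d)) (hu : u ∈ G.U) :
    |G.J t x (probToSigned p) u - G.J t x' (probToSigned p') u|
      ≤ hB.lJ * (‖x - x'‖ + ‖probDual p - probDual p'‖) := by
  have := hB.J_lipschitz.choose_spec t ht x x' _ (probToSigned_mem_unitBall p) _
    (probToSigned_mem_unitBall p') u hu
  rw [starNorm_probToSigned_sub] at this
  exact this.trans (mul_le_mul_of_nonneg_right (le_max_right _ _) (by positivity))

theorem HypothesisB.abs_VT_le (hB : G.HypothesisB) (x : Euc d) (p : ProbabilityMeasure (Euc d)) :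
    |G.VT x (probToSigned p)| ≤ hB.bV :=
  (hB.VT_bounded.choose_spec x _ (probToSigned_mem_unitBall p)).trans (le_max_right _ _)

theorem HypothesisB.abs_VT_sub_le (hB : G.HypothesisB) (x : Euc d)
    (p p' : ProbabilityMeasure (Euc d)) :
    |G.VT x (probToSigned p) - G.VT x (probToSigned p')| ≤ hB.lV * ‖probDual p - probDual p'‖ := by
  have := hB.VT_lipschitz.choose_spec x _ (probToSigned_mem_unitBall p) _
    (probToSigned_mem_unitBall p')
  rw [starNorm_probToSigned_sub] at this
  exact this.trans (mul_le_mul_of_nonneg_right (le_max_right _ _) (norm_nonneg _))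

theorem HypothesisB.tendsto_J (hB : G.HypothesisB) (ht : t ∈ G.I) (hu : u ∈ G.U)
    (hτ : Tendsto τ l (𝓝[G.I] t)) (hξ : Tendsto ξ l (𝓝 x))
    (hπ : Tendsto (fun i => probDual (π i)) l (𝓝 (probDual p))) :
    Tendsto (fun i => G.J (τ i) (ξ i) (probToSigned (π i)) u) l
      (𝓝 (G.J t x (probToSigned p) u)) := by
  have h1 : Tendsto (fun i => G.J (τ i) x (probToSigned p) u) l (𝓝 (G.J t x (probToSigned p) u)) :=
    (hB.J_continuous_time x _ (probToSigned_mem_unitBall p) u hu t ht).tendsto.comp hτ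
  refine h1.congr_dist ?_
  have h2 : Tendsto (fun i => hB.lJ * (‖ξ i - x‖ + ‖probDual (π i) - probDual p‖)) l (𝓝 0) := by
    have e1 := tendsto_iff_norm_sub_tendsto_zero.1 hξ
    have e2 := tendsto_iff_norm_sub_tendsto_zero.1 hπ
    simpa using (e1.add e2).const_mul hB.lJ
  refine squeeze_zero' (Eventually.of_forall fun _ => dist_nonneg) ?_ h2
  filter_upwards [hτ.eventually self_mem_nhdsWithin] with i hi
  rw [dist_comm]
  exact hB.abs_J_sub_le hi _ _ _ _ hu

theorem HypothesisB.continuousOn_J (hB : G.HypothesisB) (ht : t ∈ G.I) (x : Euc d)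
    (p : ProbabilityMeasure (Euc d)) : ContinuousOn (G.J t x (probToSigned p)) G.U :=
  (hB.J_contDiff t ht x _ (probToSigned_mem_unitBall p)).continuousOn

end Tendsto

end MeanFieldGame

end

/-! ### The Hamiltonian and its joint continuity. -/

noncomputable section

namespace MeanFieldGame

open Filter Topology

variable {d m : ℕ} {G : MeanFieldGame d m} {μ μ' : ℝ → ProbabilityMeasure (Euc d)}
  {V W : ℝ → Euc d → ℝ} {M D t : ℝ} {u : Euc m}

theorem HypothesisB.U_nonempty (hB : G.HypothesisB) : G.U.Nonempty :=
  hB.U_interior.mono interior_subset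

theorem continuousOn_Theta (hA : G.HypothesisA) (hB : G.HypothesisB) (hV : G.CbOn V M)
    (ht : t ∈ G.I) (x : Euc d) : ContinuousOn (G.Theta μ V t x) G.U := by
  refine (hB.continuousOn_J ht x (μ t)).add fun u hu => ?_
  exact hA.tendsto_gen (τ := fun _ => t) (ξ := fun _ => x) (π := fun _ => μ t) hV ht hu
    (tendsto_nhdsWithin_iff.2 ⟨tendsto_const_nhds, Eventually.of_forall fun _ => ht⟩)
    tendsto_const_nhds tendsto_const_nhds (tendsto_id.mono_left nhdsWithin_le_nhds)
    self_mem_nhdsWithin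

theorem continuousOn_gen_prod (hA : G.HypothesisA) (hμ : G.IsCurve μ) (hV : G.CbOn V M)
    (hu : u ∈ G.U) :
    ContinuousOn (fun q : ℝ × Euc d => G.gen q.1 q.2 (probToSigned (μ q.1)) u (V q.1))
      (G.I ×ˢ univ) := by
  rintro ⟨t, x⟩ ⟨ht, -⟩
  have h1 : Tendsto (fun q : ℝ × Euc d => q.1) (𝓝[G.I ×ˢ univ] (t, x)) (𝓝[G.I] t) :=
    tendsto_fst.mono_left (nhdsWithin_prod_eq t x G.I univ).le
  have h2 : Tendsto (fun q : ℝ × Euc d => q.2) (𝓝[G.I ×ˢ univ] (t, x)) (𝓝 x) :=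
    continuous_snd.continuousWithinAt
  exact hA.tendsto_gen hV ht hu h1 h2 ((isCurve_iff.1 hμ t ht).tendsto.comp h1)
    tendsto_const_nhds (Eventually.of_forall fun _ => hu)

theorem continuousOn_J_prod (hB : G.HypothesisB) (hμ : G.IsCurve μ) (hu : u ∈ G.U) :
    ContinuousOn (fun q : ℝ × Euc d => G.J q.1 q.2 (probToSigned (μ q.1)) u) (G.I ×ˢ univ) := by
  rintro ⟨t, x⟩ ⟨ht, -⟩
  have h1 : Tendsto (fun q : ℝ × Euc d => q.1) (𝓝[G.I ×ˢ univ] (t, x)) (𝓝[G.I] t) :=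
    tendsto_fst.mono_left (nhdsWithin_prod_eq t x G.I univ).le
  have h2 : Tendsto (fun q : ℝ × Euc d => q.2) (𝓝[G.I ×ˢ univ] (t, x)) (𝓝 x) :=
    continuous_snd.continuousWithinAt
  exact hB.tendsto_J ht hu h1 h2 ((isCurve_iff.1 hμ t ht).tendsto.comp h1)

theorem continuousOn_Theta_prod (hA : G.HypothesisA) (hB : G.HypothesisB) (hμ : G.IsCurve μ)
    (hV : G.CbOn V M) (hu : u ∈ G.U) :
    ContinuousOn (fun q : ℝ × Euc d => G.Theta μ V q.1 q.2 u) (G.I ×ˢ univ) :=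
  (continuousOn_J_prod hB hμ hu).add (continuousOn_gen_prod hA hμ hV hu)

theorem abs_Theta_le (hA : G.HypothesisA) (hB : G.HypothesisB) (hV : G.CbOn V M)
    (ht : t ∈ G.I) (x : Euc d) (hu : u ∈ G.U) :
    |G.Theta μ V t x u| ≤ hB.bJ + 2 * hA.mass * M :=
  (abs_add_le _ _).trans (add_le_add (hB.abs_J_le ht x _ hu) (hA.abs_gen_le ht hu (hV.bound t ht) x))

/-- `Θ` depends on `V` and on the flow in a Lipschitz way. -/
theorem abs_Theta_sub_le (hA : G.HypothesisA) (hB : G.HypothesisB) (hV : G.CbOn V M) {M' : ℝ}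
    (hW : G.CbOn W M') (ht : t ∈ G.I) (hD : ∀ x, |V t x - W t x| ≤ D) (x : Euc d) (hu : u ∈ G.U) :
    |G.Theta μ V t x u - G.Theta μ' W t x u|
      ≤ (hB.lJ + 2 * M * hA.lip) * ‖probDual (μ t) - probDual (μ' t)‖ + 2 * hA.mass * D := by
  have hM : 0 ≤ M := (abs_nonneg _).trans (hV.bound t ht x)
  have h1 := hB.abs_J_sub_le ht x x (μ t) (μ' t) hu
  have h2 := abs_gen_sub_gen_le_norm_kern (G := G) (t := t) (t' := t) (p := μ t) (p' := μ' t) (u := u)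
    (u' := u) (hV.continuous ht) (hV.bound t ht) x
  have h3 := hA.norm_kern_sub_le ht x x (μ t) (μ' t) hu hu
  have h4 := hA.abs_gen_sub_gen_le (p := μ' t) ht hu (hV.continuous ht) (hV.bound t ht)
    (hW.continuous ht) (hW.bound t ht) hD x
  rw [sub_self, norm_zero, zero_add] at h1 h3
  rw [sub_self, norm_zero, add_zero] at h3
  have h5 := mul_le_mul_of_nonneg_left h3 (by positivity : 0 ≤ 2 * M)
  have h6 := h2.trans h5
  have h7 := abs_add_le (G.J t x (probToSigned (μ t)) u - G.J t x (probToSigned (μ' t)) u)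
    ((G.gen t x (probToSigned (μ t)) u (V t) - G.gen t x (probToSigned (μ' t)) u (V t))
      + (G.gen t x (probToSigned (μ' t)) u (V t) - G.gen t x (probToSigned (μ' t)) u (W t)))
  have h8 := abs_add_le
    (G.gen t x (probToSigned (μ t)) u (V t) - G.gen t x (probToSigned (μ' t)) u (V t))
    (G.gen t x (probToSigned (μ' t)) u (V t) - G.gen t x (probToSigned (μ' t)) u (W t))
  have h9 : G.Theta μ V t x u - G.Theta μ' W t x u =
      G.J t x (probToSigned (μ t)) u - G.J t x (probToSigned (μ' t)) u +
    ((G.gen t x (probToSigned (μ t)) u (V t) - G.gen t x (probToSigned (μ' t)) u (V t))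
      + (G.gen t x (probToSigned (μ' t)) u (V t) - G.gen t x (probToSigned (μ' t)) u (W t))) := by
    simp only [Theta]; ring
  rw [h9]
  linarith

/-- The Hamiltonian `max_{u ∈ U} Θ(t, x, u)`. -/
def ham (G : MeanFieldGame d m) (μ : ℝ → ProbabilityMeasure (Euc d)) (V : ℝ → Euc d → ℝ) (t : ℝ)
    (x : Euc d) : ℝ :=
  sSup (G.Theta μ V t x '' G.U)

theorem isGreatest_ham (hA : G.HypothesisA) (hB : G.HypothesisB) (hV : G.CbOn V M)
    (ht : t ∈ G.I) (x : Euc d) : IsGreatest (G.Theta μ V t x '' G.U) (G.ham μ V t x) :=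
  (hB.U_compact.image_of_continuousOn (continuousOn_Theta hA hB hV ht x)).isGreatest_sSup
    (hB.U_nonempty.image _)

theorem abs_ham_le (hA : G.HypothesisA) (hB : G.HypothesisB) (hV : G.CbOn V M)
    (ht : t ∈ G.I) (x : Euc d) : |G.ham μ V t x| ≤ hB.bJ + 2 * hA.mass * M := by
  obtain ⟨u, hu, h⟩ := (isGreatest_ham (μ := μ) hA hB hV ht x).1
  rw [← h]
  exact abs_Theta_le hA hB hV ht x hu

theorem abs_ham_sub_le (hA : G.HypothesisA) (hB : G.HypothesisB) (hV : G.CbOn V M) {M' : ℝ}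
    (hW : G.CbOn W M') (ht : t ∈ G.I) (hD : ∀ x, |V t x - W t x| ≤ D) (x : Euc d) :
    |G.ham μ V t x - G.ham μ' W t x|
      ≤ (hB.lJ + 2 * M * hA.lip) * ‖probDual (μ t) - probDual (μ' t)‖ + 2 * hA.mass * D := by
  have hVg := isGreatest_ham (μ := μ) hA hB hV ht x
  have hWg := isGreatest_ham (μ := μ') hA hB hW ht x
  obtain ⟨u, hu, h⟩ := hVg.1
  obtain ⟨v, hv, h'⟩ := hWg.1
  have h1 := hWg.2 (mem_image_of_mem _ hu)
  have h2 := hVg.2 (mem_image_of_mem _ hv)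
  have h3 := abs_le.1 (abs_Theta_sub_le (μ := μ) (μ' := μ') hA hB hV hW ht hD x hu)
  have h4 := abs_le.1 (abs_Theta_sub_le (μ := μ) (μ' := μ') hA hB hV hW ht hD x hv)
  rw [abs_le]
  constructor <;> linarith

/-- Up to `ε`, the values of `Θ` on `U` are dominated by those on a fixed finite set. -/
theorem exists_control_net (hA : G.HypothesisA) (hB : G.HypothesisB) (hM : 0 ≤ M) {ε : ℝ}
    (hε : 0 < ε) :
    ∃ F : Finset (Euc m), F.Nonempty ∧ ↑F ⊆ G.U ∧ ∀ (μ : ℝ → ProbabilityMeasure (Euc d))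
      (V : ℝ → Euc d → ℝ), G.CbOn V M → ∀ t ∈ G.I, ∀ x, ∀ u ∈ G.U, ∃ v ∈ F,
        G.Theta μ V t x u ≤ G.Theta μ V t x v + ε := by
  classical
  obtain ⟨u₀, hu₀⟩ := hB.U_interior
  obtain ⟨r, hr, hball⟩ := Metric.mem_nhds_iff.1 (mem_interior_iff_mem_nhds.1 hu₀)
  obtain ⟨R, hR⟩ := Metric.isBounded_iff.1 hB.U_compact.isBounded
  have hu₀U : u₀ ∈ G.U := interior_subset hu₀
  have hR0 : 0 ≤ R := dist_nonneg.trans (hR hu₀U hu₀U)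
  have hbJ := hB.bJ_nonneg
  have hlip := hA.lip_nonneg
  -- Moving the control by the fraction `l` loses at most `2 l bJ` in `J` and `2 M lip l R` in the
  -- generator; the summand `1` keeps `K` positive.
  set K := 2 * hB.bJ + 2 * M * (hA.lip * R) + 1 with hK
  have hK0 : 0 < K := by positivity
  set l := min (1 / 2) (ε / K) with hl
  have hl0 : 0 < l := lt_min (by norm_num) (by positivity)
  have hl1 : l ≤ 1 / 2 := min_le_left _ _
  have hlε : l * K ≤ ε := (le_div_iff₀ hK0).1 (min_le_right _ _)
  obtain ⟨N, hNU, hNf, hcov⟩ := hB.U_compact.finite_cover_balls (mul_pos hl0 hr)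
  -- No modulus of continuity of `J` in `u` is available uniformly in `(t, x, ρ)`. Pulling the net
  -- points towards an interior point puts them on segments inside `U` that start at `u`, where
  -- concavity and boundedness of `J` bound the loss.
  refine ⟨hNf.toFinset.image fun n => (1 - l) • n + l • u₀, ?_, ?_, ?_⟩
  · refine Finset.Nonempty.image ?_ _
    have := hcov hu₀U
    simp only [mem_iUnion] at this
    obtain ⟨n, hn, -⟩ := this
    exact ⟨n, hNf.mem_toFinset.2 hn⟩
  · intro v hv
    simp only [Finset.coe_image, Finite.coe_toFinset] at hv
    obtain ⟨n, hn, rfl⟩ := hv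
    exact hB.U_convex (hNU hn) hu₀U (by linarith) hl0.le (by ring)
  · intro μ V hV t ht x u hu
    have := hcov hu
    simp only [mem_iUnion] at this
    obtain ⟨n, hn, hun⟩ := this
    rw [mem_ball_iff_norm] at hun
    refine ⟨(1 - l) • n + l • u₀, Finset.mem_image_of_mem _ (hNf.mem_toFinset.2 hn), ?_⟩
    set v := (1 - l) • n + l • u₀ with hv
    have hvU : v ∈ G.U := hB.U_convex (hNU hn) hu₀U (by linarith) hl0.le (by ring)
    -- The far end of the segment, solving `v = (1 - l) u + l z`. It lies within `r` of `u₀` because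
    -- `n` lies within `l r` of `u`.
    set z := u₀ + ((1 - l) / l) • (n - u) with hz
    have hzU : z ∈ G.U := by
      apply hball
      rw [mem_ball_iff_norm, hz, add_sub_cancel_left, norm_smul, Real.norm_of_nonneg
        (div_nonneg (by linarith) hl0.le), div_mul_eq_mul_div, div_lt_iff₀ hl0, norm_sub_rev]
      calc (1 - l) * ‖u - n‖ ≤ 1 * ‖u - n‖ := by gcongr; linarith
        _ < r * l := by rw [one_mul, mul_comm]; exact hun
    have hvz : v = (1 - l) • u + l • z := by
      rw [hz, smul_add, smul_smul, mul_div_cancel₀ _ hl0.ne', hv]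
      module
    have hJ := (hB.J_concave t ht x _ (probToSigned_mem_unitBall (μ t))).2 hu hzU
      (by linarith : 0 ≤ 1 - l) hl0.le (by ring)
    rw [← hvz] at hJ
    simp only [smul_eq_mul] at hJ
    have hJu := abs_le.1 (hB.abs_J_le ht x (μ t) hu)
    have hJz := abs_le.1 (hB.abs_J_le ht x (μ t) hzU)
    have hgen := abs_gen_sub_gen_le_norm_kern (G := G) (t := t) (t' := t) (p := μ t) (p' := μ t)
      (u := u) (u' := v) (hV.continuous ht) (hV.bound t ht) x
    have hk := hA.norm_kern_sub_le ht x x (μ t) (μ t) hu hvU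
    have huv : ‖u - v‖ ≤ l * R := by
      have : u - v = l • (u - z) := by rw [hvz]; module
      rw [this, norm_smul, Real.norm_of_nonneg hl0.le]
      exact mul_le_mul_of_nonneg_left (by rw [← dist_eq_norm]; exact hR hu hzU) hl0.le
    simp only [sub_self, norm_zero, zero_add] at hk
    have hk2 : ‖G.kern t x (μ t) u - G.kern t x (μ t) v‖ ≤ hA.lip * (l * R) :=
      hk.trans (mul_le_mul_of_nonneg_left huv hlip)
    have hk3 := mul_le_mul_of_nonneg_left hk2 (by positivity : 0 ≤ 2 * M)
    have hg := (abs_le.1 (hgen.trans hk3)).2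
    have h1 : l * (G.J t x (probToSigned (μ t)) u - G.J t x (probToSigned (μ t)) z)
        ≤ l * (2 * hB.bJ) := mul_le_mul_of_nonneg_left (by linarith) hl0.le
    have h2 : l * K = l * (2 * hB.bJ) + 2 * M * (hA.lip * (l * R)) + l := by rw [hK]; ring
    simp only [Theta]
    linarith

/-- By `exists_control_net` the Hamiltonian is a uniform limit of maxima over finite sets of
controls, and for a fixed control `Θ` is continuous in `(t, x)`. -/
theorem continuousOn_ham (hA : G.HypothesisA) (hB : G.HypothesisB) (hμ : G.IsCurve μ)
    (hV : G.CbOn V M) :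
    ContinuousOn (fun q : ℝ × Euc d => G.ham μ V q.1 q.2) (G.I ×ˢ univ) := by
  refine continuousOn_of_uniform_approx_of_continuousOn fun s hs => ?_
  obtain ⟨ε, hε, hεs⟩ := Metric.mem_uniformity_dist.1 hs
  have hM : 0 ≤ M := (abs_nonneg _).trans (hV.bound 0 G.left_mem_I 0)
  obtain ⟨F, hF, hFU, hnet⟩ := exists_control_net hA hB hM (half_pos hε)
  refine ⟨fun q => F.sup' hF fun u => G.Theta μ V q.1 q.2 u,
    ContinuousOn.finset_sup'_apply hF fun u hu => continuousOn_Theta_prod hA hB hμ hV (hFU hu), ?_⟩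
  rintro ⟨t, x⟩ ⟨ht, -⟩
  refine hεs ?_
  have hg := isGreatest_ham (μ := μ) hA hB hV ht x
  obtain ⟨u, hu, h⟩ := hg.1
  obtain ⟨v, hv, huv⟩ := hnet μ V hV t ht x u hu
  have h1 : F.sup' hF (fun u => G.Theta μ V t x u) ≤ G.ham μ V t x :=
    Finset.sup'_le _ _ fun w hw => hg.2 (mem_image_of_mem _ (hFU hw))
  have h2 := Finset.le_sup' (fun u => G.Theta μ V t x u) hv
  rw [Real.dist_eq, abs_lt]
  constructor <;> linarith

end MeanFieldGame

end

/-! ### The Hamilton–Jacobi–Bellman equation as a backward Volterra equation. -/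

noncomputable section

namespace MeanFieldGame

open Filter Topology

variable {d m : ℕ} {G : MeanFieldGame d m} {μ μ' : ℝ → ProbabilityMeasure (Euc d)}
  {V W : ℝ → Euc d → ℝ} {M D t : ℝ} {u : Euc m}

/-- The projection onto `[0, T]`. -/
def pr (G : MeanFieldGame d m) : ℝ → G.I := projIcc 0 G.T G.T_pos.le

theorem continuous_pr (G : MeanFieldGame d m) : Continuous G.pr := continuous_projIcc

theorem pr_of_mem (ht : t ∈ G.I) : G.pr t = ⟨t, ht⟩ := projIcc_of_mem _ ht

theorem coe_pr_of_mem (ht : t ∈ G.I) : (G.pr t : ℝ) = t := by rw [pr_of_mem ht]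

theorem pr_coe (t : G.I) : G.pr t = t := projIcc_val _ t

/-- Extension of a function on `[0, T] × ℝ^d`, constant in time outside of `[0, T]`. -/
def extend (G : MeanFieldGame d m) (f : G.I × Euc d → ℝ) (t : ℝ) (x : Euc d) : ℝ := f (G.pr t, x)

/-- Continuous bounded functions on `[0, T] × ℝ^d`. -/
def Cb (G : MeanFieldGame d m) : Set (G.I × Euc d → ℝ) :=
  {f | Continuous f ∧ ∃ M, ∀ b, |f b| ≤ M}

theorem cbOn_extend {f : G.I × Euc d → ℝ} (hf : Continuous f) (hM : ∀ b, |f b| ≤ M) :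
    G.CbOn (G.extend f) M :=
  ⟨(hf.comp (by have := G.continuous_pr; fun_prop :
      Continuous fun p : ℝ × Euc d => (G.pr p.1, p.2))).continuousOn, fun _ _ _ => hM _⟩

theorem CbOn.restrict_mem (hV : G.CbOn V M) : (fun b : G.I × Euc d => V b.1 b.2) ∈ G.Cb :=
  ⟨hV.continuousOn.comp_continuous (f := fun b : G.I × Euc d => ((b.1 : ℝ), b.2)) (by fun_prop)
    fun b => ⟨b.1.2, mem_univ _⟩, M, fun b => hV.bound _ b.1.2 _⟩

theorem ham_congr (h : ∀ x, V t x = W t x) (x : Euc d) : G.ham μ V t x = G.ham μ W t x := by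
  have : V t = W t := funext h
  have : G.Theta μ V t x = G.Theta μ W t x := by ext u; simp only [Theta, this]
  rw [ham, ham, this]

/-- The fixed point map of the Hamilton-Jacobi-Bellman equation. -/
def hjbMap (G : MeanFieldGame d m) (μ : ℝ → ProbabilityMeasure (Euc d)) (f : G.I × Euc d → ℝ)
    (b : G.I × Euc d) : ℝ :=
  G.VT b.2 (probToSigned (μ G.T)) + ∫ s in (b.1 : ℝ)..G.T, G.ham μ (G.extend f) (G.pr s) b.2

theorem continuous_ham_pr (hA : G.HypothesisA) (hB : G.HypothesisB) (hμ : G.IsCurve μ)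
    (hV : G.CbOn V M) : Continuous fun q : ℝ × Euc d => G.ham μ V (G.pr q.1) q.2 :=
  (continuousOn_ham hA hB hμ hV).comp_continuous (f := fun q : ℝ × Euc d => ((G.pr q.1 : ℝ), q.2))
    (by have := G.continuous_pr; fun_prop) fun q => ⟨(G.pr q.1).2, mem_univ _⟩

theorem continuous_ham_pr_time (hA : G.HypothesisA) (hB : G.HypothesisB) (hμ : G.IsCurve μ)
    (hV : G.CbOn V M) (x : Euc d) : Continuous fun s => G.ham μ V (G.pr s) x :=
  (continuous_ham_pr hA hB hμ hV).comp (f := fun s => (s, x)) (by fun_prop)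

theorem abs_integral_ham_le (hA : G.HypothesisA) (hB : G.HypothesisB) (hV : G.CbOn V M)
    (ht : t ∈ G.I) (x : Euc d) :
    |∫ s in t..G.T, G.ham μ V (G.pr s) x| ≤ (hB.bJ + 2 * hA.mass * M) * G.T := by
  have hnn : 0 ≤ hB.bJ + 2 * hA.mass * M := (abs_nonneg _).trans (abs_ham_le (μ := μ) hA hB hV ht x)
  have := intervalIntegral.norm_integral_le_of_norm_le_const (a := t) (b := G.T)
    (f := fun s => G.ham μ V (G.pr s) x) fun s _ => abs_ham_le hA hB hV (G.pr s).2 x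
  refine this.trans ?_
  rw [abs_of_nonneg (sub_nonneg.2 ht.2)]
  exact mul_le_mul_of_nonneg_left (by linarith [ht.1]) hnn

theorem mapsTo_hjbMap (hA : G.HypothesisA) (hB : G.HypothesisB) (hμ : G.IsCurve μ) :
    MapsTo (G.hjbMap μ) G.Cb G.Cb := by
  rintro f ⟨hf, M, hM⟩
  have hV := cbOn_extend hf hM
  refine ⟨?_, hB.bV + (hB.bJ + 2 * hA.mass * M) * G.T, fun b => ?_⟩
  · have h1 : Continuous fun b : G.I × Euc d => ∫ s in G.T..(b.1 : ℝ),
        G.ham μ (G.extend f) (G.pr s) b.2 := by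
      refine intervalIntegral.continuous_parametric_intervalIntegral_of_continuous
        (f := fun (b : G.I × Euc d) s => G.ham μ (G.extend f) (G.pr s) b.2) ?_ (by fun_prop)
      exact (continuous_ham_pr hA hB hμ hV).comp
        (f := fun q : (G.I × Euc d) × ℝ => (q.2, q.1.2)) (by fun_prop)
    have h2 : Continuous fun b : G.I × Euc d => G.VT b.2 (probToSigned (μ G.T)) :=
      (hB.VT_continuous _ (probToSigned_mem_unitBall _)).comp continuous_snd
    refine (h2.sub h1).congr fun b => ?_
    rw [hjbMap, intervalIntegral.integral_symm, ← sub_eq_add_neg]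
    rfl
  · exact (abs_add_le _ _).trans
      (add_le_add (hB.abs_VT_le _ _) (abs_integral_ham_le hA hB hV b.1.2 b.2))

/-- The terminal terms cancel, and at each time the Hamiltonian is Lipschitz in `V` with constant `2
mass`. Integrating back from `T` raises the power of `T - t`. -/
theorem dist_hjbMap_le (hA : G.HypothesisA) (hB : G.HypothesisB) (hμ : G.IsCurve μ)
    {f g : G.I × Euc d → ℝ} (hf : f ∈ G.Cb) (hg : g ∈ G.Cb) (n : ℕ) (D : ℝ)
    (h : ∀ b : G.I × Euc d, dist (f b) (g b) ≤ D * (G.T - (b.1 : ℝ)) ^ n) (b : G.I × Euc d) :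
    dist (G.hjbMap μ f b) (G.hjbMap μ g b)
      ≤ D * (2 * hA.mass) * ((G.T - (b.1 : ℝ)) ^ (n + 1) / (n + 1)) := by
  obtain ⟨hf, M, hM⟩ := hf
  obtain ⟨hg, M', hM'⟩ := hg
  have hV := cbOn_extend hf hM
  have hW := cbOn_extend hg hM'
  have hci : ∀ {V M}, G.CbOn V M → IntervalIntegrable (fun s => G.ham μ V (G.pr s) b.2) volume b.1 G.T :=
    fun hV => (continuous_ham_pr_time hA hB hμ hV b.2).intervalIntegrable _ _
  rw [hjbMap, hjbMap, dist_add_left, Real.dist_eq, ← intervalIntegral.integral_sub (hci hV) (hci hW),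
    ← integral_mul_sub_pow']
  have hgi : IntervalIntegrable (fun s => D * (2 * hA.mass) * (G.T - s) ^ n) volume b.1 G.T :=
    Continuous.intervalIntegrable (by fun_prop) _ _
  refine intervalIntegral.norm_integral_le_of_norm_le (E := ℝ) (μ := volume)
    (f := fun s => G.ham μ (G.extend f) (G.pr s) b.2 - G.ham μ (G.extend g) (G.pr s) b.2)
    (g := fun s => D * (2 * hA.mass) * (G.T - s) ^ n) b.1.2.2
    (Eventually.of_forall fun s hs => ?_) hgi
  have hs' : s ∈ G.I := ⟨b.1.2.1.trans hs.1.le, hs.2⟩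
  have := abs_ham_sub_le (μ := μ) (μ' := μ) (D := D * (G.T - s) ^ n) hA hB hV hW (G.pr s).2
    (fun x => ?_) b.2
  · rw [sub_self, norm_zero, mul_zero, zero_add] at this
    exact this.trans_eq (by ring)
  · have := h (G.pr s, x)
    rw [coe_pr_of_mem hs'] at this
    simp only [extend, pr_coe]
    exact this

theorem isClosed_Cb {w : ℕ → G.I × Euc d → ℝ} {f : G.I × Euc d → ℝ} (hw : ∀ n, w n ∈ G.Cb)
    (hf : TendstoUniformly w f atTop) : f ∈ G.Cb := by
  refine ⟨hf.continuous (Frequently.of_forall fun n => (hw n).1), ?_⟩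
  obtain ⟨n, hn⟩ := (Metric.tendstoUniformly_iff.1 hf 1 one_pos).exists
  obtain ⟨M, hM⟩ := (hw n).2
  refine ⟨M + 1, fun b => ?_⟩
  have h1 := hn b
  rw [Real.dist_eq] at h1
  have h2 := abs_add_le (f b - w n b) (w n b)
  rw [sub_add_cancel] at h2
  linarith [hM b]

/-- The distance to the initial guess is controlled by the defect `D` of the guess. The guess zero
yields the bound `valueBound`; the solution for another flow yields the dependence on the flow. -/
theorem hjb_fixedPoint_exists (hA : G.HypothesisA) (hB : G.HypothesisB) (hμ : G.IsCurve μ)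
    {f₀ : G.I × Euc d → ℝ} (hf₀ : f₀ ∈ G.Cb) {D : ℝ}
    (hD : ∀ b, dist (f₀ b) (G.hjbMap μ f₀ b) ≤ D) :
    ∃ f ∈ G.Cb, G.hjbMap μ f = f ∧ ∀ b, dist (f₀ b) (f b) ≤ D * Real.exp (2 * hA.mass * G.T) := by
  obtain ⟨f, hf, hfix, hr⟩ := volterra_exists (τ := fun b : G.I × Euc d => G.T - (b.1 : ℝ))
    (T := G.T) (M := 2 * hA.mass) (fun b => sub_nonneg.2 b.1.2.2)
    (fun b => sub_le_self _ b.1.2.1) (by have := hA.mass_pos; positivity)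
    (fun w f hw hf => isClosed_Cb hw hf) (mapsTo_hjbMap hA hB hμ)
    (fun f hf g hg n D _ h => dist_hjbMap_le hA hB hμ hf hg n D h) hf₀
    (dist_nonneg.trans (hD (⟨0, G.left_mem_I⟩, 0))) hD
  refine ⟨f, hf, hfix, fun b => ?_⟩
  have := hr 0 b
  rwa [expTail_zero] at this

theorem hjb_fixedPoint_unique (hA : G.HypothesisA) (hB : G.HypothesisB) (hμ : G.IsCurve μ)
    {f g : G.I × Euc d → ℝ} (hf : f ∈ G.Cb) (hg : g ∈ G.Cb) (hff : G.hjbMap μ f = f)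
    (hgg : G.hjbMap μ g = g) : f = g := by
  obtain ⟨M, hM⟩ := hf.2
  obtain ⟨M', hM'⟩ := hg.2
  refine volterra_unique (τ := fun b : G.I × Euc d => G.T - (b.1 : ℝ)) (M := 2 * hA.mass)
    (by have := hA.mass_pos; positivity) (mapsTo_hjbMap hA hB hμ)
    (fun f hf g hg n D _ h => dist_hjbMap_le hA hB hμ hf hg n D h) hf hg hff hgg (D := M + M')
    fun b => ?_
  rw [Real.dist_eq]
  exact (abs_sub _ _).trans (add_le_add (hM b) (hM' b))

theorem hasDerivAt_integral_ham (hA : G.HypothesisA) (hB : G.HypothesisB) (hμ : G.IsCurve μ)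
    (hV : G.CbOn V M) (t : ℝ) (x : Euc d) :
    HasDerivAt (fun t => ∫ s in t..G.T, G.ham μ V (G.pr s) x) (-G.ham μ V (G.pr t) x) t := by
  have := ((continuous_ham_pr_time hA hB hμ hV x).integral_hasStrictDerivAt G.T t).hasDerivAt.neg
  refine this.congr_of_eventuallyEq (Eventually.of_forall fun t => ?_)
  exact intervalIntegral.integral_symm _ _

/-- A function is a solution of the Hamilton-Jacobi-Bellman equation if and only if it is continuous,
bounded, and solves the integrated equation. -/
theorem isHJBSolution_iff (hA : G.HypothesisA) (hB : G.HypothesisB) (hμ : G.IsCurve μ) :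
    G.IsHJBSolution μ V ↔ (∃ M, G.CbOn V M) ∧ ∀ t ∈ G.I, ∀ x,
      V t x = G.VT x (probToSigned (μ G.T)) + ∫ s in t..G.T, G.ham μ V (G.pr s) x := by
  constructor
  · intro h
    obtain ⟨M, hM⟩ := h.bounded
    have hV : G.CbOn V M := ⟨h.continuousOn, hM⟩
    refine ⟨⟨M, hV⟩, fun t ht x => ?_⟩
    have hd : ∀ s ∈ G.I, HasDerivWithinAt (fun s => V s x) (-G.ham μ V s x) G.I s := fun s hs => by
      obtain ⟨h0, hg, hd⟩ := h.equation s hs x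
      rwa [hg.unique (isGreatest_ham hA hB hV hs x)] at hd
    have hconst : ∀ s ∈ Icc 0 G.T,
        V s x - ∫ r in s..G.T, G.ham μ V (G.pr r) x = V 0 x - ∫ r in (0 : ℝ)..G.T, G.ham μ V (G.pr r) x := by
      have hder : ∀ s ∈ Icc 0 G.T,
          HasDerivWithinAt (fun s => V s x - ∫ r in s..G.T, G.ham μ V (G.pr r) x) 0 (Icc 0 G.T) s := by
        intro s hs
        have h1 := (hd s hs).sub (hasDerivAt_integral_ham hA hB hμ hV s x).hasDerivWithinAt
        rwa [coe_pr_of_mem hs, sub_self] at h1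
      refine constant_of_has_deriv_right_zero (fun s hs => (hder s hs).continuousWithinAt)
        fun s hs => ?_
      exact ((hder s (Ico_subset_Icc_self hs)).mono (Icc_subset_Icc_left hs.1)).mono_of_mem_nhdsWithin
        (Icc_mem_nhdsGE hs.2)
    have e1 := hconst t ht
    have e2 := hconst G.T G.right_mem_I
    rw [intervalIntegral.integral_same, h.terminal x] at e2
    linarith
  · rintro ⟨⟨M, hV⟩, h⟩
    refine ⟨hV.continuousOn, ⟨M, hV.bound⟩, fun x => ?_, fun t ht x => ?_⟩
    · rw [h _ G.right_mem_I, intervalIntegral.integral_same, add_zero]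
    · refine ⟨_, isGreatest_ham hA hB hV ht x, ?_⟩
      have h1 := ((hasDerivAt_integral_ham hA hB hμ hV t x).const_add
        (G.VT x (probToSigned (μ G.T)))).hasDerivWithinAt (s := G.I)
      rw [coe_pr_of_mem ht] at h1
      exact h1.congr_of_mem (fun s hs => h s hs x) ht

theorem IsHJBSolution.hjbMap_eq (hA : G.HypothesisA) (hB : G.HypothesisB) (hμ : G.IsCurve μ)
    (hV : G.IsHJBSolution μ V) :
    G.hjbMap μ (fun b => V b.1 b.2) = fun b : G.I × Euc d => V b.1 b.2 := by
  ext b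
  rw [((isHJBSolution_iff hA hB hμ).1 hV).2 _ b.1.2, hjbMap]
  congr 1
  refine intervalIntegral.integral_congr fun s _ => ham_congr (fun x => ?_) _
  simp only [extend, pr_coe]

/-- A bound for the value functions, uniform in the flow. -/
def valueBound (hA : G.HypothesisA) (hB : G.HypothesisB) : ℝ :=
  (hB.bV + hB.bJ * G.T) * Real.exp (2 * hA.mass * G.T)

/-- Existence for the Hamilton-Jacobi-Bellman equation. -/
theorem exists_isHJBSolution (hA : G.HypothesisA) (hB : G.HypothesisB) (hμ : G.IsCurve μ) :
    ∃ V, G.IsHJBSolution μ V ∧ G.CbOn V (valueBound hA hB) := by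
  have h0 : (fun _ => 0 : G.I × Euc d → ℝ) ∈ G.Cb := ⟨continuous_const, 0, by simp⟩
  obtain ⟨f, hf, hfix, hr⟩ := hjb_fixedPoint_exists hA hB hμ h0 (D := hB.bV + hB.bJ * G.T)
    fun b => by
      rw [Real.dist_eq, zero_sub, abs_neg]
      refine (abs_add_le _ _).trans (add_le_add (hB.abs_VT_le _ _) ?_)
      have hz : G.CbOn (G.extend fun _ => (0 : ℝ)) 0 := cbOn_extend continuous_const (by simp)
      exact (abs_integral_ham_le hA hB hz b.1.2 b.2).trans_eq (by ring)
  have hb : G.CbOn (G.extend f) (valueBound hA hB) := cbOn_extend hf.1 fun b => by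
    have := hr b
    rwa [Real.dist_eq, zero_sub, abs_neg] at this
  refine ⟨G.extend f, (isHJBSolution_iff hA hB hμ).2 ⟨⟨_, hb⟩, fun t ht x => ?_⟩, hb⟩
  conv_lhs => rw [extend, pr_of_mem ht, ← hfix]
  rfl

theorem IsHJBSolution.unique (hA : G.HypothesisA) (hB : G.HypothesisB) (hμ : G.IsCurve μ)
    (hV : G.IsHJBSolution μ V) (hW : G.IsHJBSolution μ W) : ∀ t ∈ G.I, ∀ x, V t x = W t x := by
  obtain ⟨M, hM⟩ := ((isHJBSolution_iff hA hB hμ).1 hV).1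
  obtain ⟨M', hM'⟩ := ((isHJBSolution_iff hA hB hμ).1 hW).1
  have := hjb_fixedPoint_unique hA hB hμ hM.restrict_mem hM'.restrict_mem
    (hV.hjbMap_eq hA hB hμ) (hW.hjbMap_eq hA hB hμ)
  exact fun t ht x => congrFun this (⟨t, ht⟩, x)

theorem IsHJBSolution.congr (hA : G.HypothesisA) (hB : G.HypothesisB) (hμ : G.IsCurve μ)
    (hV : G.IsHJBSolution μ V) (h : ∀ t ∈ G.I, ∀ x, W t x = V t x) : G.IsHJBSolution μ W := by
  obtain ⟨⟨M, hM⟩, he⟩ := (isHJBSolution_iff hA hB hμ).1 hV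
  refine (isHJBSolution_iff hA hB hμ).2 ⟨⟨M, hM.continuousOn.congr fun q hq => h _ hq.1 _,
    fun t ht x => by rw [h t ht]; exact hM.bound t ht x⟩, fun t ht x => ?_⟩
  rw [h t ht, he t ht]
  congr 1
  exact intervalIntegral.integral_congr fun s _ => ham_congr (fun x => (h _ (G.pr s).2 x).symm) _

theorem IsHJBSolution.cbOn (hA : G.HypothesisA) (hB : G.HypothesisB) (hμ : G.IsCurve μ)
    (hV : G.IsHJBSolution μ V) : G.CbOn V (valueBound hA hB) := by
  obtain ⟨W, hW, hb⟩ := exists_isHJBSolution hA hB hμ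
  have h := hV.unique hA hB hμ hW
  exact ⟨hV.continuousOn, fun t ht x => by rw [h t ht]; exact hb.bound t ht x⟩

/-- A Lipschitz constant for the dependence of the value function on the flow. -/
def valueLip (hA : G.HypothesisA) (hB : G.HypothesisB) : ℝ :=
  (hB.lV + (hB.lJ + 2 * valueBound hA hB * hA.lip) * G.T) * Real.exp (2 * hA.mass * G.T)

theorem valueBound_nonneg (hA : G.HypothesisA) (hB : G.HypothesisB) : 0 ≤ valueBound hA hB := by
  have := hB.bV_nonneg
  have := hB.bJ_nonneg
  have := G.T_pos
  unfold valueBound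
  positivity

/-- The solution for `μ'` serves as initial guess in the equation for `μ`. Its defect comes from the
terminal payoff and from the dependence of the Hamiltonian on the flow, both Lipschitz. -/
theorem abs_value_sub_le (hA : G.HypothesisA) (hB : G.HypothesisB) (hμ : G.IsCurve μ)
    (hμ' : G.IsCurve μ') (hV : G.IsHJBSolution μ V) (hW : G.IsHJBSolution μ' W) {e : ℝ}
    (he : ∀ t ∈ G.I, ‖probDual (μ t) - probDual (μ' t)‖ ≤ e) :
    ∀ t ∈ G.I, ∀ x, |V t x - W t x| ≤ valueLip hA hB * e := by
  have hVb := hV.cbOn hA hB hμ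
  have hWb := hW.cbOn hA hB hμ'
  have hWf := (isHJBSolution_iff hA hB hμ').1 hW
  have hb0 := valueBound_nonneg hA hB
  have hlJ := hB.lJ_nonneg
  have hlV := hB.lV_nonneg
  have hlip := hA.lip_nonneg
  have he0 : 0 ≤ e := (norm_nonneg _).trans (he 0 G.left_mem_I)
  set K := hB.lJ + 2 * valueBound hA hB * hA.lip with hK
  have hK0 : 0 ≤ K := by positivity
  obtain ⟨f, hf, hfix, hr⟩ := hjb_fixedPoint_exists hA hB hμ hWb.restrict_mem
    (D := (hB.lV + K * G.T) * e) fun b => by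
      rw [hWf.2 _ b.1.2, hjbMap, Real.dist_eq, add_sub_add_comm]
      have h1 := hB.abs_VT_sub_le b.2 (μ' G.T) (μ G.T)
      rw [norm_sub_rev] at h1
      have h2 := h1.trans (mul_le_mul_of_nonneg_left (he _ G.right_mem_I) hlV)
      have hWe : G.CbOn (G.extend fun b => W b.1 b.2) (valueBound hA hB) :=
        cbOn_extend hWb.restrict_mem.1 fun b => hWb.bound _ b.1.2 _
      have h3 : |(∫ s in (b.1 : ℝ)..G.T, G.ham μ' W (G.pr s) b.2)
          - ∫ s in (b.1 : ℝ)..G.T, G.ham μ (G.extend fun b => W b.1 b.2) (G.pr s) b.2|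
          ≤ K * e * G.T := by
        rw [← intervalIntegral.integral_sub
          ((continuous_ham_pr_time hA hB hμ' hWb b.2).intervalIntegrable _ _)
          ((continuous_ham_pr_time hA hB hμ hWe b.2).intervalIntegrable _ _)]
        have := intervalIntegral.norm_integral_le_of_norm_le_const (a := (b.1 : ℝ)) (b := G.T)
          (C := K * e) (f := fun s => G.ham μ' W (G.pr s) b.2
            - G.ham μ (G.extend fun b => W b.1 b.2) (G.pr s) b.2) fun s _ => by
          have h4 := abs_ham_sub_le (μ := μ') (μ' := μ) (D := 0) hA hB hWb hWe (G.pr s).2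
            (fun x => by simp [extend, pr_coe]) b.2
          rw [mul_zero, add_zero, norm_sub_rev] at h4
          exact h4.trans (mul_le_mul_of_nonneg_left (he _ (G.pr s).2) hK0)
        refine this.trans ?_
        rw [abs_of_nonneg (sub_nonneg.2 b.1.2.2)]
        exact mul_le_mul_of_nonneg_left (by linarith [b.1.2.1]) (by positivity)
      refine (abs_add_le _ _).trans ((add_le_add h2 h3).trans_eq (by ring))
  have hfV := hjb_fixedPoint_unique hA hB hμ hf hVb.restrict_mem hfix (hV.hjbMap_eq hA hB hμ)
  intro t ht x
  have := hr (⟨t, ht⟩, x)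
  rw [hfV, Real.dist_eq, abs_sub_comm] at this
  exact this.trans_eq (by rw [valueLip]; ring)

end MeanFieldGame

end

/-! ### Strong concavity and the regularity of the maximizer. -/

noncomputable section

section StrongConcavity

variable {E : Type*} [NormedAddCommGroup E] [NormedSpace ℝ E] {U : Set E} {f g : E → ℝ} {c K : ℝ}
  {u v : E}

/-- A `C²` function on a convex body whose Hessian is at most `-c` lies below its second order
expansion. -/
theorem le_add_fderivWithin_sub (hU : Convex ℝ U) (hne : (interior U).Nonempty)
    (hf : ContDiffOn ℝ 2 f U)
    (hc : ∀ z ∈ U, ∀ w, iteratedFDerivWithin ℝ 2 f U z ![w, w] ≤ -c * ‖w‖ ^ 2) (hu : u ∈ U)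
    (hv : v ∈ U) :
    f v ≤ f u + fderivWithin ℝ f U u (v - u) - c / 2 * ‖v - u‖ ^ 2 := by
  have hUD : UniqueDiffOn ℝ U := uniqueDiffOn_convex hU hne
  set w := v - u with hw
  have hmem : ∀ s ∈ Icc (0 : ℝ) 1, u + s • w ∈ U := fun s hs => by
    have := hU hu hv (sub_nonneg.2 hs.2) hs.1 (by ring)
    convert this using 1
    rw [hw]; module
  have hline : ∀ s : ℝ, HasDerivWithinAt (fun s : ℝ => u + s • w) w (Icc 0 1) s := fun s => by
    simpa using (((hasDerivAt_id s).smul_const w).const_add u).hasDerivWithinAt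
  have h1 : ∀ s ∈ Icc (0 : ℝ) 1, HasDerivWithinAt (fun s : ℝ => f (u + s • w))
      (fderivWithin ℝ f U (u + s • w) w) (Icc 0 1) s := fun s hs =>
    ((hf.differentiableOn (by norm_num) _ (hmem s hs)).hasFDerivWithinAt).comp_hasDerivWithinAt s
      (hline s) hmem
  have hf' : DifferentiableOn ℝ (fderivWithin ℝ f U) U :=
    (hf.fderivWithin hUD (m := 1) (by norm_num)).differentiableOn (by norm_num)
  have h2 : ∀ s ∈ Icc (0 : ℝ) 1, HasDerivWithinAt (fun s : ℝ => fderivWithin ℝ f U (u + s • w) w)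
      (fderivWithin ℝ (fderivWithin ℝ f U) U (u + s • w) w w) (Icc 0 1) s := fun s hs => by
    have := ((hf' _ (hmem s hs)).hasFDerivWithinAt).comp_hasDerivWithinAt s (hline s) hmem
    exact (ContinuousLinearMap.apply ℝ ℝ w).hasFDerivAt.comp_hasDerivWithinAt s this
  -- Taylor's estimate by integrating twice along the segment: the Hessian bound gives monotonicity
  -- of the corrected first derivative, and this gives monotonicity of the corrected function in
  -- `h4`.
  have h3 : AntitoneOn (fun s : ℝ => fderivWithin ℝ f U (u + s • w) w + c * ‖w‖ ^ 2 * s)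
      (Icc 0 1) := by
    have hd : ∀ s ∈ Icc (0 : ℝ) 1, HasDerivWithinAt
        (fun s : ℝ => fderivWithin ℝ f U (u + s • w) w + c * ‖w‖ ^ 2 * s)
        (fderivWithin ℝ (fderivWithin ℝ f U) U (u + s • w) w w + c * ‖w‖ ^ 2 * 1) (Icc 0 1) s :=
      fun s hs => (h2 s hs).add (((hasDerivAt_id s).const_mul _).hasDerivWithinAt)
    refine antitoneOn_of_hasDerivWithinAt_nonpos (convex_Icc 0 1)
      (fun s hs => (hd s hs).continuousWithinAt)
      (fun s hs => (hd s (interior_subset hs)).mono interior_subset) fun s hs => ?_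
    have := hc _ (hmem s (interior_subset hs)) w
    rw [iteratedFDerivWithin_two_apply _ hUD (hmem s (interior_subset hs))] at this
    simp only [Matrix.cons_val_zero, Matrix.cons_val_one] at this
    linarith
  have h4 : AntitoneOn (fun s : ℝ => f (u + s • w) + c / 2 * ‖w‖ ^ 2 * s ^ 2
      - fderivWithin ℝ f U u w * s) (Icc 0 1) := by
    have hd : ∀ s ∈ Icc (0 : ℝ) 1, HasDerivWithinAt (fun s : ℝ => f (u + s • w)
        + c / 2 * ‖w‖ ^ 2 * s ^ 2 - fderivWithin ℝ f U u w * s)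
        (fderivWithin ℝ f U (u + s • w) w + c / 2 * ‖w‖ ^ 2 * (2 * s)
          - fderivWithin ℝ f U u w * 1) (Icc 0 1) s := fun s hs => by
      refine ((h1 s hs).add ?_).sub (((hasDerivAt_id s).const_mul _).hasDerivWithinAt)
      simpa using (((hasDerivAt_pow 2 s).const_mul (c / 2 * ‖w‖ ^ 2))).hasDerivWithinAt
    refine antitoneOn_of_hasDerivWithinAt_nonpos (convex_Icc 0 1)
      (fun s hs => (hd s hs).continuousWithinAt)
      (fun s hs => (hd s (interior_subset hs)).mono interior_subset) fun s hs => ?_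
    have hs' := interior_subset hs
    have := h3 (left_mem_Icc.2 zero_le_one) hs' hs'.1
    simp only [zero_smul, add_zero, mul_zero] at this
    linarith
  have := h4 (left_mem_Icc.2 zero_le_one) (right_mem_Icc.2 zero_le_one) zero_le_one
  simp only [zero_smul, add_zero, mul_zero, one_smul, mul_one, one_pow, sub_zero, ne_eq,
    OfNat.ofNat_ne_zero, not_false_eq_true, zero_pow] at this
  rw [hw, add_sub_cancel] at this
  linarith

/-- Quadratic growth at a maximizer. -/
theorem mul_norm_sub_sq_le_of_isMaxOn (hU : Convex ℝ U) (hne : (interior U).Nonempty)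
    (hf : ContDiffOn ℝ 2 f U)
    (hc : ∀ z ∈ U, ∀ w, iteratedFDerivWithin ℝ 2 f U z ![w, w] ≤ -c * ‖w‖ ^ 2) (hu : u ∈ U)
    (hmax : IsMaxOn f U u) (hv : v ∈ U) : c / 2 * ‖v - u‖ ^ 2 ≤ f u - f v := by
  have h1 := le_add_fderivWithin_sub hU hne hf hc hu hv
  have h2 := hmax.localize.fderivWithin_nonpos
    (sub_mem_posTangentConeAt_of_segment_subset (hU.segment_subset hu hv))
  linarith

/-- Maximizers of functions with close gradients are close. -/
theorem norm_sub_le_of_isMaxOn (hU : Convex ℝ U) (hne : (interior U).Nonempty)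
    (hf : ContDiffOn ℝ 2 f U) (hg : ContDiffOn ℝ 2 g U) (hc0 : 0 < c)
    (hfc : ∀ z ∈ U, ∀ w, iteratedFDerivWithin ℝ 2 f U z ![w, w] ≤ -c * ‖w‖ ^ 2)
    (hgc : ∀ z ∈ U, ∀ w, iteratedFDerivWithin ℝ 2 g U z ![w, w] ≤ -c * ‖w‖ ^ 2) (hu : u ∈ U)
    (hfu : IsMaxOn f U u) (hv : v ∈ U) (hgv : IsMaxOn g U v)
    (hK : ∀ z ∈ U, ‖fderivWithin ℝ f U z - fderivWithin ℝ g U z‖ ≤ K) : ‖u - v‖ ≤ K / c := by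
  -- The two growth inequalities add up to `c ‖u - v‖² ≤ (f - g)(u) - (f - g)(v)`, and the mean
  -- value inequality bounds the right side by `K ‖u - v‖`.
  have h1 := mul_norm_sub_sq_le_of_isMaxOn hU hne hf hfc hu hfu hv
  have h2 := mul_norm_sub_sq_le_of_isMaxOn hU hne hg hgc hv hgv hu
  have hUD : UniqueDiffOn ℝ U := uniqueDiffOn_convex hU hne
  have hdf := hf.differentiableOn (by norm_num)
  have hdg := hg.differentiableOn (by norm_num)
  have h3 := hU.norm_image_sub_le_of_norm_hasFDerivWithin_le (C := K)
    (fun z hz => (hdf z hz).hasFDerivWithinAt.sub (hdg z hz).hasFDerivWithinAt) hK hv hu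
  simp only [Pi.sub_apply] at h3
  have h4 := (le_abs_self _).trans h3
  rw [norm_sub_rev v u] at h1
  rw [le_div_iff₀ hc0]
  by_contra! hlt
  have hpos : 0 < ‖u - v‖ := by
    rcases (norm_nonneg (u - v)).eq_or_lt with h | h
    · rw [← h, zero_mul] at hlt
      exact absurd ((norm_nonneg _).trans (hK u hu)) (not_le.2 hlt)
    · exact h
  have := mul_lt_mul_of_pos_right hlt hpos
  nlinarith

end StrongConcavity

namespace MeanFieldGame

open Filter Topology

variable {d m : ℕ} {G : MeanFieldGame d m} {μ μ' : ℝ → ProbabilityMeasure (Euc d)}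
  {V W : ℝ → Euc d → ℝ} {M D t : ℝ} {u v : Euc m} {x x' : Euc d}

/-- The concavity constant of `Θ` along solutions of the Hamilton-Jacobi-Bellman equation. -/
def HypothesisB.conc (hB : G.HypothesisB) : ℝ := hB.theta_concave.choose

/-- A Lipschitz constant for the gradient of `Θ`. -/
def HypothesisB.lΘ (hB : G.HypothesisB) : ℝ := hB.theta_lipschitz.choose

theorem HypothesisB.conc_pos (hB : G.HypothesisB) : 0 < hB.conc := hB.theta_concave.choose_spec.1

theorem contDiffOn_Theta (hB : G.HypothesisB) (hV : G.CbOn V M) (ht : t ∈ G.I) (x : Euc d) :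
    ContDiffOn ℝ 2 (G.Theta μ V t x) G.U :=
  (hB.J_contDiff t ht x _ (probToSigned_mem_unitBall _)).add
    (hB.gen_contDiff t ht x _ (probToSigned_mem_unitBall _)
      (BoundedContinuousFunction.ofNormedAddCommGroup (V t) (hV.continuous ht) M (hV.bound t ht)))

theorem IsMaximizer.mul_norm_sub_sq_le (hA : G.HypothesisA) (hB : G.HypothesisB)
    (hμ : G.IsCurve μ) (hV : G.IsHJBSolution μ V) (ht : t ∈ G.I) (hu : G.IsMaximizer μ V t x u)
    (hv : v ∈ G.U) : hB.conc / 2 * ‖v - u‖ ^ 2 ≤ G.Theta μ V t x u - G.Theta μ V t x v :=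
  mul_norm_sub_sq_le_of_isMaxOn hB.U_convex hB.U_interior
    (contDiffOn_Theta hB (hV.cbOn hA hB hμ) ht x)
    (hB.theta_concave.choose_spec.2 μ V hμ hV t ht x) hu.1 hu.2 hv

theorem IsMaximizer.unique (hA : G.HypothesisA) (hB : G.HypothesisB)
    (hμ : G.IsCurve μ) (hV : G.IsHJBSolution μ V) (ht : t ∈ G.I) (hu : G.IsMaximizer μ V t x u)
    (hv : G.IsMaximizer μ V t x v) : v = u := by
  have h1 := hu.mul_norm_sub_sq_le hA hB hμ hV ht hv.1
  have h2 := hv.2 u hu.1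
  have h3 : ‖v - u‖ ^ 2 ≤ 0 := by
    have := hB.conc_pos
    by_contra! h
    have : 0 < hB.conc / 2 * ‖v - u‖ ^ 2 := by positivity
    linarith
  exact sub_eq_zero.1 (norm_eq_zero.1 (pow_eq_zero_iff two_ne_zero |>.1 (le_antisymm h3 (by positivity))))

/-- The constant does not depend on the flow; the compactness of the response map rests on this. -/
theorem IsMaximizer.norm_sub_le (hA : G.HypothesisA) (hB : G.HypothesisB)
    (hμ : G.IsCurve μ) (hV : G.IsHJBSolution μ V) (ht : t ∈ G.I) (hu : G.IsMaximizer μ V t x u)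
    (hv : G.IsMaximizer μ V t x' v) : ‖u - v‖ ≤ hB.lΘ * ‖x - x'‖ / hB.conc :=
  norm_sub_le_of_isMaxOn hB.U_convex hB.U_interior
    (contDiffOn_Theta hB (hV.cbOn hA hB hμ) ht x) (contDiffOn_Theta hB (hV.cbOn hA hB hμ) ht x')
    hB.conc_pos (hB.theta_concave.choose_spec.2 μ V hμ hV t ht x)
    (hB.theta_concave.choose_spec.2 μ V hμ hV t ht x') hu.1 hu.2 hv.1 hv.2
    (hB.theta_lipschitz.choose_spec μ V hμ hV t ht x x')

/-- The maximizer of `Θ(t, x, ·)` over the control set, for `t ∈ [0, T]`; extended to all times,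
constant outside of `[0, T]`. -/
def argmax (G : MeanFieldGame d m) (μ : ℝ → ProbabilityMeasure (Euc d)) (V : ℝ → Euc d → ℝ) (t : ℝ)
    (x : Euc d) : Euc m :=
  Classical.epsilon (G.IsMaximizer μ V (G.pr t) x)

theorem isMaximizer_argmax (hA : G.HypothesisA) (hB : G.HypothesisB) (hV : G.CbOn V M) (t : ℝ)
    (x : Euc d) : G.IsMaximizer μ V (G.pr t) x (G.argmax μ V t x) := by
  obtain ⟨⟨u, hu, h1⟩, h2⟩ := isGreatest_ham (μ := μ) hA hB hV (G.pr t).2 x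
  exact Classical.epsilon_spec (p := G.IsMaximizer μ V (G.pr t) x)
    ⟨u, hu, fun v hv => h1 ▸ h2 (mem_image_of_mem _ hv)⟩

theorem isMaximizer_iff (hA : G.HypothesisA) (hB : G.HypothesisB) (hμ : G.IsCurve μ)
    (hV : G.IsHJBSolution μ V) (ht : t ∈ G.I) :
    G.IsMaximizer μ V t x u ↔ u = G.argmax μ V t x := by
  have h := isMaximizer_argmax (μ := μ) hA hB (hV.cbOn hA hB hμ) t x
  rw [coe_pr_of_mem ht] at h
  exact ⟨fun hu => h.unique hA hB hμ hV ht hu, fun hu => hu ▸ h⟩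

theorem Theta_argmax (hA : G.HypothesisA) (hB : G.HypothesisB) (hV : G.CbOn V M) (t : ℝ)
    (x : Euc d) : G.Theta μ V (G.pr t) x (G.argmax μ V t x) = G.ham μ V (G.pr t) x := by
  have h := isMaximizer_argmax (μ := μ) hA hB hV t x
  refine IsGreatest.unique ⟨mem_image_of_mem _ h.1, ?_⟩
    (isGreatest_ham (μ := μ) hA hB hV (G.pr t).2 x)
  rintro _ ⟨v, hv, rfl⟩
  exact h.2 v hv

/-- The maximizer at `q₀` remains nearly optimal at nearby `q`, because the Hamiltonian and `Θ` with
that one control are continuous; quadratic growth turns near optimality into closeness. -/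
theorem continuous_argmax (hA : G.HypothesisA) (hB : G.HypothesisB) (hμ : G.IsCurve μ)
    (hV : G.IsHJBSolution μ V) : Continuous fun q : ℝ × Euc d => G.argmax μ V q.1 q.2 := by
  have hVb := hV.cbOn hA hB hμ
  rw [continuous_iff_continuousAt]
  intro q₀
  have hm := fun q : ℝ × Euc d => isMaximizer_argmax (μ := μ) hA hB hVb q.1 q.2
  have h1 : Continuous fun q : ℝ × Euc d =>
      G.Theta μ V (G.pr q.1) q.2 (G.argmax μ V q₀.1 q₀.2) :=
    (continuousOn_Theta_prod hA hB hμ hVb (hm q₀).1).comp_continuous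
      (f := fun q : ℝ × Euc d => ((G.pr q.1 : ℝ), q.2))
      (by have := G.continuous_pr; fun_prop) fun q => ⟨(G.pr q.1).2, mem_univ _⟩
  have h2 : Tendsto (fun q : ℝ × Euc d => (2 / hB.conc) * (G.ham μ V (G.pr q.1) q.2
      - G.Theta μ V (G.pr q.1) q.2 (G.argmax μ V q₀.1 q₀.2))) (𝓝 q₀) (𝓝 0) := by
    have := (((continuous_ham_pr hA hB hμ hVb).sub h1).const_mul (2 / hB.conc)).tendsto q₀
    simp only [Pi.sub_apply] at this
    rwa [Theta_argmax hA hB hVb, sub_self, mul_zero] at this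
  rw [ContinuousAt, tendsto_iff_norm_sub_tendsto_zero]
  have h3 : Tendsto (fun q : ℝ × Euc d => ‖G.argmax μ V q.1 q.2 - G.argmax μ V q₀.1 q₀.2‖ ^ 2)
      (𝓝 q₀) (𝓝 0) := by
    refine squeeze_zero (fun _ => by positivity) (fun q => ?_) h2
    have := (hm q).mul_norm_sub_sq_le hA hB hμ hV (G.pr q.1).2 (hm q₀).1
    rw [Theta_argmax hA hB hVb, norm_sub_rev] at this
    have hc := hB.conc_pos
    rw [div_mul_eq_mul_div, le_div_iff₀ hc]
    linarith
  have h4 := (Real.continuous_sqrt.tendsto 0).comp h3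
  rw [Real.sqrt_zero] at h4
  exact h4.congr fun q => Real.sqrt_sq (norm_nonneg _)

theorem norm_argmax_sub_le (hA : G.HypothesisA) (hB : G.HypothesisB) (hμ : G.IsCurve μ)
    (hV : G.IsHJBSolution μ V) (t : ℝ) (x x' : Euc d) :
    ‖G.argmax μ V t x - G.argmax μ V t x'‖ ≤ hB.lΘ / hB.conc * ‖x - x'‖ :=
  ((isMaximizer_argmax hA hB (hV.cbOn hA hB hμ) t x).norm_sub_le hA hB hμ hV (G.pr t).2
    (isMaximizer_argmax hA hB (hV.cbOn hA hB hμ) t x')).trans_eq (by ring)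

/-- The constant in the Hölder estimate `norm_argmax_sub_argmax_sq_le`. -/
def argmaxHolder (hA : G.HypothesisA) (hB : G.HypothesisB) : ℝ :=
  4 * (hB.lJ + 2 * valueBound hA hB * hA.lip + 2 * hA.mass * valueLip hA hB) / hB.conc

/-- The optimal control depends on the flow in a Hölder continuous way. -/
theorem norm_argmax_sub_argmax_sq_le (hA : G.HypothesisA) (hB : G.HypothesisB) (hμ : G.IsCurve μ)
    (hμ' : G.IsCurve μ') (hV : G.IsHJBSolution μ V) (hW : G.IsHJBSolution μ' W) {e : ℝ}
    (he : ∀ t ∈ G.I, ‖probDual (μ t) - probDual (μ' t)‖ ≤ e) (t : ℝ) (x : Euc d) :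
    ‖G.argmax μ V t x - G.argmax μ' W t x‖ ^ 2 ≤ argmaxHolder hA hB * e := by
  have hVb := hV.cbOn hA hB hμ
  have hWb := hW.cbOn hA hB hμ'
  have hu := isMaximizer_argmax (μ := μ) hA hB hVb t x
  have hv := isMaximizer_argmax (μ := μ') hA hB hWb t x
  -- There is no estimate for the dependence of the gradient of `Θ` on the flow, so values are
  -- compared instead of gradients. This bounds only the squared distance of the maximizers.
  have h1 := hu.mul_norm_sub_sq_le hA hB hμ hV (G.pr t).2 hv.1
  have h2 := hv.mul_norm_sub_sq_le hA hB hμ' hW (G.pr t).2 hu.1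
  have hD := fun x => abs_value_sub_le hA hB hμ hμ' hV hW he _ (G.pr t).2 x
  have h3 := abs_le.1 (abs_Theta_sub_le (μ := μ) (μ' := μ') hA hB hVb hWb (G.pr t).2 hD x hu.1)
  have h4 := abs_le.1 (abs_Theta_sub_le (μ := μ) (μ' := μ') hA hB hVb hWb (G.pr t).2 hD x hv.1)
  have h5 : (hB.lJ + 2 * valueBound hA hB * hA.lip) * ‖probDual (μ (G.pr t)) - probDual (μ' (G.pr t))‖
      ≤ (hB.lJ + 2 * valueBound hA hB * hA.lip) * e := by
    refine mul_le_mul_of_nonneg_left (he _ (G.pr t).2) ?_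
    have := hB.lJ_nonneg
    have := hA.lip_nonneg
    have := valueBound_nonneg hA hB
    positivity
  rw [norm_sub_rev] at h1
  have hc := hB.conc_pos
  rw [argmaxHolder, div_mul_eq_mul_div, le_div_iff₀ hc]
  have : 0 ≤ hB.conc * ‖G.argmax μ V t x - G.argmax μ' W t x‖ ^ 2 := by positivity
  nlinarith

theorem isFeedback_argmax (hA : G.HypothesisA) (hB : G.HypothesisB) (hμ : G.IsCurve μ)
    (hV : G.IsHJBSolution μ V) : G.IsFeedback (G.argmax μ V) :=
  ⟨((continuous_argmax hA hB hμ hV).comp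
    (f := fun p : Icc (0 : ℝ) G.T × Euc d => ((p.1 : ℝ), p.2)) (by fun_prop)).measurable,
    fun t _ x => (isMaximizer_argmax (μ := μ) hA hB (hV.cbOn hA hB hμ) t x).1⟩

end MeanFieldGame

end

/-! ### The one-step operator of the uniformized jump chain. -/

noncomputable section

namespace MeanFieldGame

open Filter Topology

variable {d m : ℕ} {G : MeanFieldGame d m} {t t' : ℝ} {x : Euc d} {u : Euc m}
  {p p' q q' : ProbabilityMeasure (Euc d)} {φ φ' : Euc d → Euc m}

theorem norm_measDual_le (m : FiniteMeasure (Euc d)) :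
    ‖measDual m‖ ≤ (m : Measure (Euc d)).real univ :=
  C0Dual.norm_le measureReal_nonneg fun g hg => by
    have := norm_integral_le_of_norm_le_const (μ := (m : Measure (Euc d))) (f := g) (C := 1)
      (Eventually.of_forall fun x => (g.abs_apply_le x).trans hg)
    rwa [one_mul] at this

theorem HypothesisA.norm_kern_le (hA : G.HypothesisA) (ht : t ∈ G.I) (x : Euc d)
    (p : ProbabilityMeasure (Euc d)) (hu : u ∈ G.U) : ‖G.kern t x p u‖ ≤ hA.mass :=
  (norm_measDual_le _).trans (hA.mass_le ht x p hu)

theorem HypothesisA.norm_kern_sub_le_two (hA : G.HypothesisA) {u' : Euc m} (ht : t ∈ G.I)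
    (ht' : t' ∈ G.I) (x : Euc d) (p p' : ProbabilityMeasure (Euc d)) (hu : u ∈ G.U)
    (hu' : u' ∈ G.U) : ‖G.kern t x p u - G.kern t' x p' u'‖ ≤ 2 * hA.mass :=
  (norm_sub_le _ _).trans ((add_le_add (hA.norm_kern_le ht x p hu)
    (hA.norm_kern_le ht' x p' hu')).trans_eq (by ring))

theorem gen_eq_sub {ρ : SignedMeasure (Euc d)} {f : Euc d → ℝ} (hf : Continuous f) {M : ℝ}
    (hM : ∀ x, |f x| ≤ M) :
    G.gen t x ρ u f = ∫ y, f y ∂(G.ν t x ρ u : Measure (Euc d))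
      - (G.ν t x ρ u : Measure (Euc d)).real univ * f x := by
  rw [gen, integral_sub (integrable_of_continuous_of_abs_le hf hM) (integrable_const _),
    integral_const, smul_eq_mul]

theorem gen_coe_eq_sub (ρ : SignedMeasure (Euc d)) (g : C₀(Euc d, ℝ)) :
    G.gen t x ρ u g = ∫ y, g y ∂(G.ν t x ρ u : Measure (Euc d))
      - (G.ν t x ρ u : Measure (Euc d)).real univ * g x :=
  gen_eq_sub g.continuous g.abs_apply_le

theorem HypothesisA.one_sub_mass_nonneg (hA : G.HypothesisA) (ht : t ∈ G.I) (hu : u ∈ G.U) :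
    0 ≤ 1 - hA.mass⁻¹ * (G.ν t x (probToSigned p) u : Measure (Euc d)).real univ := by
  rw [sub_nonneg, inv_mul_le_iff₀ hA.mass_pos, mul_one]
  exact hA.mass_le ht x p hu

/-- As `C` bounds the mass of `ν`, the expression averages `g` against a probability measure: `C⁻¹
ν` plus the remaining mass at `x`. The same reason gives `abs_add_gen_le`. -/
theorem HypothesisA.add_gen_nonneg (hA : G.HypothesisA) (ht : t ∈ G.I) (hu : u ∈ G.U)
    {g : C₀(Euc d, ℝ)} (hg : ∀ x, 0 ≤ g x) :
    0 ≤ g x + hA.mass⁻¹ * G.gen t x (probToSigned p) u g := by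
  rw [gen_coe_eq_sub]
  have h1 := mul_nonneg (hA.one_sub_mass_nonneg (x := x) (p := p) ht hu) (hg x)
  have h2 : 0 ≤ hA.mass⁻¹ * ∫ y, g y ∂(G.ν t x (probToSigned p) u : Measure (Euc d)) :=
    mul_nonneg (inv_nonneg.2 hA.mass_pos.le) (integral_nonneg hg)
  linarith

theorem HypothesisA.abs_add_gen_le (hA : G.HypothesisA) (ht : t ∈ G.I) (hu : u ∈ G.U)
    (g : C₀(Euc d, ℝ)) : |g x + hA.mass⁻¹ * G.gen t x (probToSigned p) u g| ≤ ‖g‖ := by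
  rw [gen_coe_eq_sub]
  have h0 := hA.one_sub_mass_nonneg (x := x) (p := p) ht hu
  set ν := (G.ν t x (probToSigned p) u : Measure (Euc d))
  have h1 : |∫ y, g y ∂ν| ≤ ‖g‖ * ν.real univ :=
    norm_integral_le_of_norm_le_const (f := g) (Eventually.of_forall g.abs_apply_le)
  have h2 : g x + hA.mass⁻¹ * (∫ y, g y ∂ν - ν.real univ * g x)
      = (1 - hA.mass⁻¹ * ν.real univ) * g x + hA.mass⁻¹ * ∫ y, g y ∂ν := by ring
  have hC := inv_nonneg.2 hA.mass_pos.le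
  rw [h2]
  refine (abs_add_le _ _).trans ?_
  rw [abs_mul, abs_mul, abs_of_nonneg h0, abs_of_nonneg hC]
  calc _ ≤ (1 - hA.mass⁻¹ * ν.real univ) * ‖g‖ + hA.mass⁻¹ * (‖g‖ * ν.real univ) := by
        gcongr
        exact g.abs_apply_le x
    _ = ‖g‖ := by ring

/-- Continuous maps from the state space to the control set. -/
structure IsControl (G : MeanFieldGame d m) (φ : Euc d → Euc m) : Prop where
  continuous : Continuous φ
  mem : ∀ x, φ x ∈ G.U

theorem cbOn_const (g : C₀(Euc d, ℝ)) : G.CbOn (fun _ => g) ‖g‖ :=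
  ⟨(g.continuous.comp continuous_snd).continuousOn, fun _ _ => g.abs_apply_le⟩

theorem IsControl.continuous_gen (hφ : G.IsControl φ) (hA : G.HypothesisA) (ht : t ∈ G.I)
    (p : ProbabilityMeasure (Euc d)) (g : C₀(Euc d, ℝ)) :
    Continuous fun x => G.gen t x (probToSigned p) (φ x) g :=
  continuous_iff_continuousAt.2 fun x =>
    hA.tendsto_gen (τ := fun _ => t) (ξ := id) (π := fun _ => p) (υ := φ) (cbOn_const g) ht
      (hφ.mem x) (tendsto_nhdsWithin_iff.2 ⟨tendsto_const_nhds, Eventually.of_forall fun _ => ht⟩)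
      tendsto_id tendsto_const_nhds (hφ.continuous.tendsto x) (Eventually.of_forall hφ.mem)

theorem IsControl.continuous_kern (hφ : G.IsControl φ) (hA : G.HypothesisA) (ht : t ∈ G.I)
    (p : ProbabilityMeasure (Euc d)) : Continuous fun x => G.kern t x p (φ x) :=
  continuous_iff_continuousAt.2 fun x =>
    hA.tendsto_kern (τ := fun _ => t) (ξ := id) (π := fun _ => p) (υ := φ) ht
      (hφ.mem x) (tendsto_nhdsWithin_iff.2 ⟨tendsto_const_nhds, Eventually.of_forall fun _ => ht⟩)
      tendsto_id tendsto_const_nhds (hφ.continuous.tendsto x) (Eventually.of_forall hφ.mem)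

/-- The functional with the given values, if there is one. -/
def _root_.C0Dual.ofFun (φ : C₀(Euc d, ℝ) → ℝ) : C0Dual d :=
  Classical.epsilon fun Λ : C0Dual d => ∀ g, Λ g = φ g

/-- One step of the jump chain with transition kernel `δ_x + C⁻¹ (ν(x, ·) - ν(x, ℝ^d) δ_x)`, where `C`
bounds the masses of `ν`, from the initial law `q`. -/
def jump (hA : G.HypothesisA) (t : ℝ) (p : ProbabilityMeasure (Euc d)) (φ : Euc d → Euc m)
    (q : ProbabilityMeasure (Euc d)) : C0Dual d :=
  -- The kernel sees the population law `p`, while the law being transported is `q`. The definition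
  -- needs no hypotheses; `jump_apply` shows that its values are the intended ones for `t ∈ [0, T]`
  -- and continuous controls.
  C0Dual.ofFun fun g =>
    ∫ x, (g x + hA.mass⁻¹ * G.gen t x (probToSigned p) (φ x) g) ∂(q : Measure (Euc d))

theorem IsControl.continuous_add_gen (hφ : G.IsControl φ) (hA : G.HypothesisA) (ht : t ∈ G.I)
    (p : ProbabilityMeasure (Euc d)) (g : C₀(Euc d, ℝ)) :
    Continuous fun x => g x + hA.mass⁻¹ * G.gen t x (probToSigned p) (φ x) g :=
  g.continuous.add ((hφ.continuous_gen hA ht p g).const_mul _)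

theorem jump_apply (hA : G.HypothesisA) (ht : t ∈ G.I) (hφ : G.IsControl φ) (g : C₀(Euc d, ℝ)) :
    jump hA t p φ q g
      = ∫ x, (g x + hA.mass⁻¹ * G.gen t x (probToSigned p) (φ x) g) ∂(q : Measure (Euc d)) := by
  have hint : ∀ g : C₀(Euc d, ℝ), Integrable
      (fun x => g x + hA.mass⁻¹ * G.gen t x (probToSigned p) (φ x) g) (q : Measure (Euc d)) :=
    fun g => integrable_of_continuous_of_abs_le (hφ.continuous_add_gen hA ht p g)
      fun x => hA.abs_add_gen_le ht (hφ.mem x) g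
  refine Classical.epsilon_spec (p := fun Λ : C0Dual d => ∀ g, Λ g = ∫ x, (g x + hA.mass⁻¹ *
    G.gen t x (probToSigned p) (φ x) g) ∂(q : Measure (Euc d)))
    ⟨C0Dual.mk (fun g => ∫ x, (g x + hA.mass⁻¹ * G.gen t x (probToSigned p) (φ x) g)
      ∂(q : Measure (Euc d))) (fun f g => ?_) (fun c g => ?_) 1 fun g => ?_, fun _ => rfl⟩ g
  · rw [← integral_add (hint f) (hint g)]
    congr 1; ext x
    rw [gen_coe_eq_sub, gen_coe_eq_sub, gen_coe_eq_sub]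
    simp only [ZeroAtInftyContinuousMap.add_apply]
    rw [integral_add (f.integrable _) (g.integrable _)]
    ring
  · rw [← integral_const_mul]
    congr 1; ext x
    rw [gen_coe_eq_sub, gen_coe_eq_sub]
    simp only [ZeroAtInftyContinuousMap.smul_apply, smul_eq_mul]
    rw [integral_const_mul]
    ring
  · rw [one_mul]
    exact abs_integral_le_of_prob fun x => hA.abs_add_gen_le ht (hφ.mem x) g

/-- Positivity and contraction hold pointwise in `x`. No mass is lost because the generator
annihilates constants, so its values on truncations of `1` tend to zero. -/
theorem jump_mem_probSet (hA : G.HypothesisA) (ht : t ∈ G.I) (hφ : G.IsControl φ) :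
    jump hA t p φ q ∈ probSet d := by
  refine mem_probSet_of_nonneg (fun g hg => ?_) (C0Dual.norm_le zero_le_one fun g hg => ?_)
    fun ε hε => ?_
  · rw [jump_apply hA ht hφ]
    exact integral_nonneg fun x => hA.add_gen_nonneg ht (hφ.mem x) hg
  · rw [jump_apply hA ht hφ]
    exact abs_integral_le_of_prob fun x => (hA.abs_add_gen_le ht (hφ.mem x) g).trans hg
  · have h1 : ∀ n, ‖trunc (1 : C(Euc d, ℝ)) n‖ ≤ 1 := fun n => norm_trunc_le (fun x => by simp) n
    have hgen : ∀ x, Tendsto (fun n => G.gen t x (probToSigned p) (φ x) (trunc 1 n)) atTop (𝓝 0) := by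
      intro x
      have h2 := tendsto_integral_trunc (m := (G.ν t x (probToSigned p) (φ x) : Measure (Euc d)))
        (f := 1) (M := 1) (by simp)
      have h3 := h2.sub ((tendsto_trunc 1 x).const_mul
        ((G.ν t x (probToSigned p) (φ x) : Measure (Euc d)).real univ))
      simp only [ContinuousMap.one_apply, integral_const, smul_eq_mul, mul_one, sub_self] at h3
      exact h3.congr fun n => (gen_coe_eq_sub _ _).symm
    have h4 : Tendsto (fun n => jump hA t p φ q (trunc 1 n)) atTop (𝓝 1) := by
      have : Tendsto (fun n => ∫ x, (trunc 1 n x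
          + hA.mass⁻¹ * G.gen t x (probToSigned p) (φ x) (trunc 1 n)) ∂(q : Measure (Euc d))) atTop
          (𝓝 (∫ _, (1 : ℝ) ∂(q : Measure (Euc d)))) := by
        refine tendsto_integral_of_dominated_convergence (fun _ => 1)
          (fun n => (hφ.continuous_add_gen hA ht p _).aestronglyMeasurable) (integrable_const _)
          (fun n => Eventually.of_forall fun x =>
            (hA.abs_add_gen_le ht (hφ.mem x) _).trans (h1 n)) (Eventually.of_forall fun x => ?_)
        simpa using (tendsto_trunc 1 x).add ((hgen x).const_mul hA.mass⁻¹)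
      rw [integral_const, smul_eq_mul, mul_one, probReal_univ] at this
      exact this.congr fun n => (jump_apply hA ht hφ _).symm
    obtain ⟨n, hn⟩ := (h4.eventually (lt_mem_nhds (show 1 - ε < 1 by linarith))).exists
    exact ⟨n, hn.le⟩

theorem norm_jump_sub_le (hA : G.HypothesisA) (ht : t ∈ G.I) (hφ : G.IsControl φ) :
    ‖jump hA t p φ q - jump hA t p φ q'‖ ≤ ‖probDual q - probDual q'‖ := by
  refine C0Dual.norm_le (norm_nonneg _) fun g hg => ?_
  rw [C0Dual.sub_apply, jump_apply hA ht hφ, jump_apply hA ht hφ]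
  refine (abs_integral_sub_integral_le q.toFiniteMeasure q'.toFiniteMeasure
    (hφ.continuous_add_gen hA ht p g) fun x => hA.abs_add_gen_le ht (hφ.mem x) g).trans ?_
  exact mul_le_of_le_one_left (norm_nonneg _) hg

/-- The kernel distance is averaged over `q` instead of maximized over `x`. Hence pointwise
convergence of controls suffices in `tendsto_jump`, and closeness on a ball of large `q`-mass in
`totallyBounded_jump`. -/
theorem norm_jump_sub_le_integral (hA : G.HypothesisA) (ht : t ∈ G.I) (ht' : t' ∈ G.I)
    (hφ : G.IsControl φ) (hφ' : G.IsControl φ') :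
    ‖jump hA t p φ q - jump hA t' p' φ' q‖
      ≤ hA.mass⁻¹ * 2 * ∫ x, ‖G.kern t x p (φ x) - G.kern t' x p' (φ' x)‖ ∂(q : Measure (Euc d)) := by
  have hC := inv_nonneg.2 hA.mass_pos.le
  refine C0Dual.norm_le (by positivity) fun g hg => ?_
  rw [C0Dual.sub_apply, jump_apply hA ht hφ, jump_apply hA ht' hφ', ← integral_sub
    (integrable_of_continuous_of_abs_le (hφ.continuous_add_gen hA ht p g)
      fun x => hA.abs_add_gen_le ht (hφ.mem x) g)
    (integrable_of_continuous_of_abs_le (hφ'.continuous_add_gen hA ht' p' g)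
      fun x => hA.abs_add_gen_le ht' (hφ'.mem x) g), ← integral_const_mul]
  refine norm_integral_le_of_norm_le (f := fun x =>
    (g x + hA.mass⁻¹ * G.gen t x (probToSigned p) (φ x) g)
      - (g x + hA.mass⁻¹ * G.gen t' x (probToSigned p') (φ' x) g))
    (integrable_of_continuous_of_abs_le (M := hA.mass⁻¹ * 2 * (2 * hA.mass)) ?_ fun x => ?_)
    (Eventually.of_forall fun x => ?_)
  · exact (((hφ.continuous_kern hA ht p).sub (hφ'.continuous_kern hA ht' p')).norm).const_mul _
  · rw [abs_of_nonneg (by positivity)]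
    exact mul_le_mul_of_nonneg_left
      (hA.norm_kern_sub_le_two ht ht' x p p' (hφ.mem x) (hφ'.mem x)) (by positivity)
  · have h1 := abs_gen_sub_gen_le_norm_kern (G := G) (t := t) (t' := t') (p := p) (p' := p')
      (u := φ x) (u' := φ' x) g.continuous (fun x => (g.abs_apply_le x).trans hg) x
    rw [add_sub_add_left_eq_sub, ← mul_sub, Real.norm_eq_abs, abs_mul, abs_of_nonneg hC, mul_assoc]
    rw [mul_one] at h1
    exact mul_le_mul_of_nonneg_left h1 hC

/-- `jump` is Lipschitz in the law of the population and in the control. -/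
theorem norm_jump_sub_jump_le (hA : G.HypothesisA) (ht : t ∈ G.I) (hφ : G.IsControl φ)
    (hφ' : G.IsControl φ') {δ : ℝ} (hδ : ∀ x, ‖φ x - φ' x‖ ≤ δ) :
    ‖jump hA t p φ q - jump hA t p' φ' q'‖
      ≤ ‖probDual q - probDual q'‖
        + hA.mass⁻¹ * 2 * (hA.lip * (‖probDual p - probDual p'‖ + δ)) := by
  have hC := inv_nonneg.2 hA.mass_pos.le
  refine (norm_sub_le_norm_sub_add_norm_sub _ (jump hA t p φ q') _).trans
    (add_le_add (norm_jump_sub_le hA ht hφ)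
      ((norm_jump_sub_le_integral hA ht ht hφ hφ').trans (mul_le_mul_of_nonneg_left ?_
        (by positivity))))
  refine (le_abs_self _).trans (abs_integral_le_of_prob fun x => ?_)
  rw [abs_norm]
  refine (hA.norm_kern_sub_le ht x x p p' (hφ.mem x) (hφ'.mem x)).trans ?_
  rw [sub_self, norm_zero, zero_add]
  exact mul_le_mul_of_nonneg_left (add_le_add_right (hδ x) _) hA.lip_nonneg

theorem tendsto_jump {ι : Type*} {l : Filter ι} [l.IsCountablyGenerated] (hA : G.HypothesisA)
    {τ : ι → ℝ} {π θ : ι → ProbabilityMeasure (Euc d)} {ψ : ι → Euc d → Euc m}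
    (ht : t ∈ G.I) (hφ : G.IsControl φ) (hψ : ∀ i, G.IsControl (ψ i)) (hτI : ∀ i, τ i ∈ G.I)
    (hτ : Tendsto τ l (𝓝 t))
    (hψφ : ∀ x, Tendsto (fun i => ψ i x) l (𝓝 (φ x)))
    (hπ : Tendsto (fun i => probDual (π i)) l (𝓝 (probDual p)))
    (hθ : Tendsto (fun i => probDual (θ i)) l (𝓝 (probDual q))) :
    Tendsto (fun i => jump hA (τ i) (π i) (ψ i) (θ i)) l (𝓝 (jump hA t p φ q)) := by
  have h1 : Tendsto (fun i => ∫ x, ‖G.kern (τ i) x (π i) (ψ i x) - G.kern t x p (φ x)‖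
      ∂(q : Measure (Euc d))) l (𝓝 0) := by
    have : Tendsto (fun i => ∫ x, ‖G.kern (τ i) x (π i) (ψ i x) - G.kern t x p (φ x)‖
        ∂(q : Measure (Euc d))) l (𝓝 (∫ _, (0 : ℝ) ∂(q : Measure (Euc d)))) := by
      refine tendsto_integral_filter_of_dominated_convergence (fun _ => 2 * hA.mass)
        (Eventually.of_forall fun i => (((hψ i).continuous_kern hA (hτI i) (π i)).sub
          (hφ.continuous_kern hA ht p)).norm.aestronglyMeasurable)
        (Eventually.of_forall fun i => Eventually.of_forall fun x => ?_) (integrable_const _)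
        (Eventually.of_forall fun x => ?_)
      · rw [norm_norm]
        exact hA.norm_kern_sub_le_two (hτI i) ht x _ _ ((hψ i).mem x) (hφ.mem x)
      · exact tendsto_iff_norm_sub_tendsto_zero.1 (hA.tendsto_kern ht (hφ.mem x)
          (tendsto_nhdsWithin_iff.2 ⟨hτ, Eventually.of_forall hτI⟩) tendsto_const_nhds hπ (hψφ x)
          (Eventually.of_forall fun i => (hψ i).mem x))
    simpa using this
  rw [tendsto_iff_norm_sub_tendsto_zero]
  have h2 := (tendsto_iff_norm_sub_tendsto_zero.1 hθ).add (h1.const_mul (hA.mass⁻¹ * 2))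
  rw [mul_zero, add_zero] at h2
  refine squeeze_zero (fun _ => norm_nonneg _) (fun i => ?_) h2
  exact (norm_sub_le_norm_sub_add_norm_sub _ (jump hA (τ i) (π i) (ψ i) q) _).trans
    (add_le_add (norm_jump_sub_le hA (hτI i) (hψ i))
      (norm_jump_sub_le_integral hA (hτI i) ht (hψ i) hφ))

end MeanFieldGame

end

/-! ### The kinetic equation and the forward equation of a single player. -/

noncomputable section

namespace MeanFieldGame

open Filter Topology

variable {d m : ℕ} {G : MeanFieldGame d m} {t a : ℝ} {x : Euc d}
  {p q p₀ μ₀ : ProbabilityMeasure (Euc d)} {φ φ' : Euc d → Euc m} {γ γ' : ℝ → Euc d → Euc m}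
  {μ η η' : ℝ → ProbabilityMeasure (Euc d)}

/-- The probability measure that represents a functional, if there is one. -/
def toProb (Λ : C0Dual d) : ProbabilityMeasure (Euc d) :=
  Function.invFun probDual Λ

theorem toProb_probDual (p : ProbabilityMeasure (Euc d)) : toProb (probDual p) = p :=
  Function.leftInverse_invFun probDual_injective p

theorem probDual_toProb {Λ : C0Dual d} (h : Λ ∈ probSet d) : probDual (toProb Λ) = Λ := by
  obtain ⟨p, rfl⟩ := h
  rw [toProb_probDual]

/-- Continuous feedback controls. -/
structure IsContFeedback (G : MeanFieldGame d m) (γ : ℝ → Euc d → Euc m) : Prop where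
  continuous : Continuous fun q : ℝ × Euc d => γ q.1 q.2
  mem : ∀ t x, γ t x ∈ G.U

theorem IsContFeedback.isControl (hγ : G.IsContFeedback γ) (t : ℝ) : G.IsControl (γ t) :=
  ⟨hγ.continuous.comp (f := fun x => (t, x)) (by fun_prop), hγ.mem t⟩

theorem continuousOn_jump (hA : G.HypothesisA) (hγ : G.IsContFeedback γ)
    (hμ : ContinuousOn (fun t => probDual (μ t)) G.I)
    (hη : ContinuousOn (fun t => probDual (η t)) G.I) :
    ContinuousOn (fun t => jump hA t (μ t) (γ t) (η t)) G.I := by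
  rw [continuousOn_iff_continuous_domRestrict] at *
  refine continuous_iff_continuousAt.2 fun t => ?_
  exact tendsto_jump (l := 𝓝 t) (τ := fun s : G.I => (s : ℝ)) (π := fun s : G.I => μ s)
    (θ := fun s : G.I => η s) (ψ := fun s : G.I => γ s) hA t.2 (hγ.isControl _)
    (fun s => hγ.isControl _) (fun s => s.2) continuous_subtype_val.continuousAt
    (fun x => (hγ.continuous.comp (f := fun s : G.I => ((s : ℝ), x)) (by fun_prop)).continuousAt)
    hμ.continuousAt hη.continuousAt

/-- A Lipschitz constant of `jump` in the law. -/
def HypothesisA.jumpLip (hA : G.HypothesisA) : ℝ := 1 + hA.mass⁻¹ * 2 * hA.lip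

theorem HypothesisA.jumpLip_nonneg (hA : G.HypothesisA) : 0 ≤ hA.jumpLip := by
  have := hA.mass_pos
  have := hA.lip_nonneg
  unfold jumpLip
  positivity

/-- The hypothesis on `p` covers `p = q`, for the kinetic equation, as well as `p` independent of
`q`, for a single player in a given flow. -/
theorem dist_jump_le (hA : G.HypothesisA) (ht : t ∈ G.I) (hφ : G.IsControl φ)
    {p p' q q' : ProbabilityMeasure (Euc d)}
    (hp : ‖probDual p - probDual p'‖ ≤ ‖probDual q - probDual q'‖) :
    dist (jump hA t p φ q) (jump hA t p' φ q') ≤ hA.jumpLip * dist (probDual q) (probDual q') := by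
  rw [dist_eq_norm, dist_eq_norm]
  have h1 := norm_jump_sub_jump_le (p := p) (p' := p') (q := q) (q' := q') (δ := 0) hA ht hφ hφ
    (by simp)
  have hC := hA.mass_pos
  have hl := hA.lip_nonneg
  have h2 : hA.mass⁻¹ * 2 * (hA.lip * (‖probDual p - probDual p'‖ + 0))
      ≤ hA.mass⁻¹ * 2 * (hA.lip * ‖probDual q - probDual q'‖) := by
    rw [add_zero]; gcongr
  rw [HypothesisA.jumpLip]
  linarith

/-- Existence of forward flows, with an approximation that is uniform in the control. -/
theorem exists_flow (hA : G.HypothesisA) (ha : a ∈ G.I) (p₀ : ProbabilityMeasure (Euc d))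
    (hγ : G.IsContFeedback γ)
    {P : ℝ → ProbabilityMeasure (Euc d) → ProbabilityMeasure (Euc d)}
    (hP : ∀ t ∈ G.I, ∀ q q', ‖probDual (P t q) - probDual (P t q')‖ ≤ ‖probDual q - probDual q'‖)
    (hPc : ∀ η : ℝ → ProbabilityMeasure (Euc d), Continuous (fun t => probDual (η t)) →
      ContinuousOn (fun t => probDual (P t (η t))) G.I) :
    ∃ η : ℝ → ProbabilityMeasure (Euc d), Continuous (fun t => probDual (η t)) ∧ η a = p₀ ∧
      (∀ t ∈ Icc a G.T, HasDerivWithinAt (fun t => probDual (η t))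
        (hA.mass • (jump hA t (P t (η t)) (γ t) (η t) - probDual (η t))) (Icc a G.T) t) ∧
      ∀ S : ℕ → Set (C0Dual d), (∀ n, Convex ℝ (S n) ∧ IsClosed (S n) ∧ S n ⊆ probSet d ∧
          probDual p₀ ∈ S n) →
        (∀ n, ∀ t ∈ Icc a G.T, ∀ q, probDual q ∈ S n → jump hA t (P t q) (γ t) q ∈ S (n + 1)) →
        ∀ n, ∀ t ∈ Icc a G.T, ∃ y ∈ S n, dist y (probDual (η t))
          ≤ 2 * expTail (hA.jumpLip * hA.mass * (G.T - a)) n := by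
  have hsub : Icc a G.T ⊆ G.I := Icc_subset_Icc_left ha.1
  -- Here `P t q` is the population law that the kernel sees when the state has law `q`. The
  -- relaxation equation is solved among functionals, with `toProb` translating back to measures.
  obtain ⟨Λ, hc, hmem, h0, hd, hS⟩ := exists_relaxation_solution (a := a) (b := G.T)
    (k₀ := probDual p₀) (C := hA.mass) convex_probSet isClosed_probSet (R := 2)
    (fun x hx y hy => by
      rw [dist_eq_norm]
      have := (norm_sub_le x y).trans
        (add_le_add (norm_le_of_mem_probSet hx) (norm_le_of_mem_probSet hy))
      linarith) ha.2 hA.mass_pos.le hA.jumpLip_nonneg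
    (F := fun t Λ => jump hA t (P t (toProb Λ)) (γ t) (toProb Λ))
    (fun t ht Λ _ => jump_mem_probSet hA (hsub ht) (hγ.isControl t))
    (by
      rintro t ht _ ⟨q, rfl⟩ _ ⟨q', rfl⟩
      simp only [toProb_probDual]
      exact dist_jump_le hA (hsub ht) (hγ.isControl t) (hP t (hsub ht) q q'))
    (by
      intro η hη hηK
      have hη' : Continuous fun t => probDual (toProb (η t)) := by
        simpa only [probDual_toProb (hηK _)] using hη
      exact (continuousOn_jump hA hγ (hPc _ hη') hη'.continuousOn).mono hsub) ⟨p₀, rfl⟩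
  refine ⟨fun t => toProb (Λ t), ?_, ?_, fun t ht => ?_, fun S h1 h2 n t ht => ?_⟩
  · simpa only [probDual_toProb (hmem _)] using hc
  · simp only [h0, toProb_probDual]
  · simpa only [probDual_toProb (hmem _)] using hd t ht
  · obtain ⟨y, hy, hyd⟩ := hS S h1 (fun n t ht Λ' hΛ' => by
      refine h2 n t ht _ ?_
      rwa [probDual_toProb ((h1 n).2.2.1 hΛ')]) n t ht
    exact ⟨y, hy, by rwa [probDual_toProb (hmem _)]⟩

/-- Uniformization: the adjoint generator is `C (jump - 1)`, which makes the forward equations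
relaxation equations. -/
theorem mass_smul_jump_sub_apply (hA : G.HypothesisA) (ht : t ∈ G.I) (hφ : G.IsControl φ)
    (g : C₀(Euc d, ℝ)) :
    (hA.mass • (jump hA t p φ q - probDual q)) g
      = ∫ x, G.gen t x (probToSigned p) (φ x) g ∂(q : Measure (Euc d)) := by
  have hgi : Integrable (fun x => G.gen t x (probToSigned p) (φ x) g) (q : Measure (Euc d)) :=
    integrable_of_continuous_of_abs_le (hφ.continuous_gen hA ht p g)
      fun x => hA.abs_gen_le ht (hφ.mem x) g.abs_apply_le x
  rw [C0Dual.smul_apply, C0Dual.sub_apply, jump_apply hA ht hφ, probDual_apply,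
    integral_add (g.integrable _) (hgi.const_mul _), integral_const_mul, add_sub_cancel_left,
    mul_inv_cancel_left₀ hA.mass_pos.ne']

/-- The kinetic equation as an ordinary differential equation in the dual of `C_∞(ℝ^d)`. -/
theorem isKineticSolution_iff (hA : G.HypothesisA) (hγ : G.IsContFeedback γ) :
    G.IsKineticSolution μ₀ γ η ↔ η 0 = μ₀ ∧ ∀ t ∈ G.I, HasDerivWithinAt (fun t => probDual (η t))
      (hA.mass • (jump hA t (η t) (γ t) (η t) - probDual (η t))) G.I t := by
  have key : ∀ t ∈ G.I, HasDerivWithinAt (fun t => probDual (η t))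
      (hA.mass • (jump hA t (η t) (γ t) (η t) - probDual (η t))) G.I t ↔
      ∀ ε > 0, ∃ δ > 0, ∀ s ∈ G.I, |s - t| < δ → ∀ g : C₀(Euc d, ℝ), ‖g‖ ≤ 1 →
      |∫ x, g x ∂(η s : Measure (Euc d)) - ∫ x, g x ∂(η t : Measure (Euc d))
        - (s - t) * ∫ x, G.gen t x (probToSigned (η t)) (γ t x) g ∂(η t : Measure (Euc d))|
      ≤ ε * |s - t| := by
    intro t ht
    rw [hasDerivWithinAt_iff_isLittleO, Asymptotics.isLittleO_iff]
    refine forall₂_congr fun ε hε => ?_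
    rw [eventually_nhdsWithin_iff, Metric.eventually_nhds_iff]
    simp only [Real.dist_eq, Real.norm_eq_abs]
    refine exists_congr fun δ => and_congr_right fun hδ => ⟨fun h s hs hst g hg => ?_,
      fun h s hst hs => C0Dual.norm_le (by positivity) fun g hg => ?_⟩
    · have := (C0Dual.le_opNorm (probDual (η s) - probDual (η t) - (s - t) • hA.mass •
        (jump hA t (η t) (γ t) (η t) - probDual (η t))) g).trans
        (mul_le_of_le_one_right (norm_nonneg _) hg)
      have := this.trans (h hst hs)
      rwa [C0Dual.sub_apply, C0Dual.sub_apply, C0Dual.smul_apply,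
        mass_smul_jump_sub_apply hA ht (hγ.isControl t)] at this
    · rw [C0Dual.sub_apply, C0Dual.sub_apply, C0Dual.smul_apply,
        mass_smul_jump_sub_apply hA ht (hγ.isControl t)]
      exact h s hs hst g hg
  constructor
  · exact fun h => ⟨h.initial, fun t ht => (key t ht).2 (h.equation t ht)⟩
  · exact fun h => ⟨isCurve_iff.2 fun t ht => (h.2 t ht).continuousWithinAt, h.1,
      fun t ht => (key t ht).1 (h.2 t ht)⟩

theorem exists_isKineticSolution (hA : G.HypothesisA) (hγ : G.IsContFeedback γ)
    (μ₀ : ProbabilityMeasure (Euc d)) :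
    ∃ η, G.IsKineticSolution μ₀ γ η ∧
      ∀ S : ℕ → Set (C0Dual d), (∀ n, Convex ℝ (S n) ∧ IsClosed (S n) ∧ S n ⊆ probSet d ∧
          probDual μ₀ ∈ S n) →
        (∀ n, ∀ t ∈ G.I, ∀ q, probDual q ∈ S n → jump hA t q (γ t) q ∈ S (n + 1)) →
        ∀ n, ∀ t ∈ G.I, ∃ y ∈ S n, dist y (probDual (η t))
          ≤ 2 * expTail (hA.jumpLip * hA.mass * (G.T - 0)) n := by
  obtain ⟨η, hc, h0, hd, hS⟩ := exists_flow (P := fun _ q => q) hA G.left_mem_I μ₀ hγ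
    (fun _ _ _ _ => le_rfl) fun η hη => hη.continuousOn
  exact ⟨η, (isKineticSolution_iff hA hγ).2 ⟨h0, hd⟩, hS⟩

/-- The control enters only through `jump`, so the uniform distance of the controls bounds the
perturbation in `dist_relaxation_solution_le`. -/
theorem dist_kineticSolution_le (hA : G.HypothesisA) (hγ : G.IsContFeedback γ)
    (hγ' : G.IsContFeedback γ') (hη : G.IsKineticSolution μ₀ γ η)
    (hη' : G.IsKineticSolution μ₀ γ' η') {δ : ℝ} (hδ : ∀ t x, ‖γ t x - γ' t x‖ ≤ δ) :
    ∀ t ∈ G.I, dist (probDual (η t)) (probDual (η' t))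
      ≤ hA.mass⁻¹ * 2 * (hA.lip * δ) * Real.exp (hA.mass * (hA.jumpLip + 1) * (G.T - 0)) := by
  have hδ0 : 0 ≤ δ := (norm_nonneg _).trans (hδ 0 0)
  obtain ⟨h0, hd⟩ := (isKineticSolution_iff hA hγ).1 hη
  obtain ⟨h0', hd'⟩ := (isKineticSolution_iff hA hγ').1 hη'
  have hl := hA.lip_nonneg
  have hC := hA.mass_pos
  refine dist_relaxation_solution_le (K := probSet d) hA.mass_pos hA.jumpLip_nonneg
    (by positivity)
    (F := fun t Λ => jump hA t (toProb Λ) (γ t) (toProb Λ))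
    (F' := fun t Λ => jump hA t (toProb Λ) (γ' t) (toProb Λ)) ?_ (fun t _ => ⟨η t, rfl⟩)
    (fun t _ => ⟨η' t, rfl⟩) (by rw [h0, h0']) ?_ ?_ fun t ht => ?_
  · rintro t ht _ ⟨q, rfl⟩ _ ⟨q', rfl⟩
    simp only [toProb_probDual]
    exact dist_jump_le hA ht (hγ.isControl t) le_rfl
  · simpa only [toProb_probDual, I] using hd
  · simpa only [toProb_probDual, I] using hd'
  · simp only [toProb_probDual]
    rw [dist_comm, dist_eq_norm]
    have := norm_jump_sub_jump_le (p := η' t) (p' := η' t) (q := η' t) (q' := η' t) hA ht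
      (hγ.isControl t) (hγ'.isControl t) (hδ t)
    rwa [sub_self, norm_zero, zero_add, zero_add] at this

theorem IsKineticSolution.unique (hA : G.HypothesisA) (hγ : G.IsContFeedback γ)
    (hη : G.IsKineticSolution μ₀ γ η) (hη' : G.IsKineticSolution μ₀ γ η') : EqOn η η' G.I := by
  intro t ht
  have := dist_kineticSolution_le hA hγ hγ hη hη' (δ := 0) (by simp) t ht
  rw [mul_zero, mul_zero, zero_mul] at this
  exact probDual_injective (dist_le_zero.1 this)

theorem IsKineticSolution.congr (hA : G.HypothesisA) (hγ : G.IsContFeedback γ)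
    (hη : G.IsKineticSolution μ₀ γ η) (h : EqOn η' η G.I) : G.IsKineticSolution μ₀ γ η' := by
  obtain ⟨h0, hd⟩ := (isKineticSolution_iff hA hγ).1 hη
  refine (isKineticSolution_iff hA hγ).2 ⟨by rw [h G.left_mem_I, h0], fun t ht => ?_⟩
  rw [h ht]
  exact (hd t ht).congr_of_mem (fun s hs => by rw [h hs]) ht

/-- The derivative is `C` times a difference of two probability measures, whatever the control. This
provides the equicontinuity of the responses. -/
theorem IsKineticSolution.norm_probDual_sub_le (hA : G.HypothesisA) (hγ : G.IsContFeedback γ)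
    (hη : G.IsKineticSolution μ₀ γ η) {s t : ℝ} (hs : s ∈ G.I) (ht : t ∈ G.I) :
    ‖probDual (η s) - probDual (η t)‖ ≤ hA.mass * 2 * ‖s - t‖ := by
  refine (convex_Icc 0 G.T).norm_image_sub_le_of_norm_hasDerivWithin_le
    ((isKineticSolution_iff hA hγ).1 hη).2 (fun r hr => ?_) ht hs
  rw [norm_smul, Real.norm_of_nonneg hA.mass_pos.le]
  refine mul_le_mul_of_nonneg_left ?_ hA.mass_pos.le
  have := (norm_sub_le _ _).trans (add_le_add
    (norm_le_of_mem_probSet (jump_mem_probSet (p := η r) (q := η r) hA hr (hγ.isControl r)))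
    (norm_probDual_le (η r)))
  linarith

/-- Existence of the law of a player who uses a continuous feedback control. -/
theorem exists_isStateLaw (hA : G.HypothesisA) (hμ : G.IsCurve μ) (hγ : G.IsContFeedback γ)
    (ht : t ∈ G.I) (x : Euc d) : ∃ p, G.IsStateLaw μ γ t x p := by
  obtain ⟨η, hc, h0, hd, -⟩ := exists_flow (P := fun t _ => μ t) hA ht
    ⟨Measure.dirac x, inferInstance⟩ hγ (fun _ _ _ _ => by simp) fun η _ => isCurve_iff.1 hμ
  have hsub : Icc t G.T ⊆ G.I := Icc_subset_Icc_left ht.1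
  refine ⟨η, fun s hs g => ?_⟩
  have hsub' : Icc t s ⊆ Icc t G.T := Icc_subset_Icc_right hs.2
  have hder : ∀ r ∈ Icc t G.T, HasDerivWithinAt (fun r => ∫ y, g y ∂(η r : Measure (Euc d)))
      (∫ y, G.gen r y (probToSigned (μ r)) (γ r y) g ∂(η r : Measure (Euc d))) (Icc t G.T) r := by
    intro r hr
    rw [← mass_smul_jump_sub_apply hA (hsub hr) (hγ.isControl r)]
    exact (C0Dual.eval g).hasFDerivAt.comp_hasDerivWithinAt r (hd r hr)
  have hcont : ContinuousOn
      (fun r => ∫ y, G.gen r y (probToSigned (μ r)) (γ r y) g ∂(η r : Measure (Euc d)))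
      (Icc t G.T) := by
    have h1 := (((continuousOn_jump hA hγ (isCurve_iff.1 hμ) hc.continuousOn).sub
      hc.continuousOn).const_smul hA.mass).mono hsub
    refine ((C0Dual.eval g).continuous.comp_continuousOn h1).congr fun r hr => ?_
    exact (mass_smul_jump_sub_apply hA (hsub hr) (hγ.isControl r) g).symm
  have := intervalIntegral.integral_eq_sub_of_hasDeriv_right_of_le hs.1
    (fun r hr => ((hder r (hsub' hr)).continuousWithinAt).mono hsub')
    (fun r hr => ((hder r ⟨hr.1.le, hr.2.le.trans hs.2⟩).mono_of_mem_nhdsWithin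
      (mem_nhdsGT_iff_exists_Ioo_subset.2 ⟨G.T, hr.2.trans_le hs.2,
        fun z hz => ⟨hr.1.le.trans hz.1.le, hz.2.le⟩⟩)))
    ((hcont.mono hsub').intervalIntegrable_of_Icc hs.1)
  rw [this, h0]
  simp

end MeanFieldGame

end

/-! ### Compactness in total variation of the laws reachable with Lipschitz controls. -/

noncomputable section

open Filter Topology

theorem totallyBounded_of_forall_exists_dist_le {X : Type*} [PseudoMetricSpace X] {A : Set X}
    (h : ∀ ε > 0, ∃ B, TotallyBounded B ∧ ∀ x ∈ A, ∃ y ∈ B, dist x y ≤ ε) : TotallyBounded A := by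
  rw [Metric.totallyBounded_iff]
  intro ε hε
  obtain ⟨B, hB, hAB⟩ := h (ε / 2) (half_pos hε)
  obtain ⟨N, hN, hcov⟩ := Metric.totallyBounded_iff.1 hB (ε / 2) (half_pos hε)
  refine ⟨N, hN, fun x hx => ?_⟩
  obtain ⟨y, hy, hxy⟩ := hAB x hx
  have := hcov hy
  simp only [mem_iUnion, Metric.mem_ball, exists_prop] at this ⊢
  obtain ⟨n, hn, hyn⟩ := this
  exact ⟨n, hn, by linarith [dist_triangle x y n]⟩

namespace MeanFieldGame

variable {d m : ℕ} {G : MeanFieldGame d m} {t a L : ℝ} {x : Euc d}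
  {p q p₀ μ₀ : ProbabilityMeasure (Euc d)} {φ φ' : Euc d → Euc m} {γ γ' : ℝ → Euc d → Euc m}
  {μ η η' : ℝ → ProbabilityMeasure (Euc d)}

/-- Controls that are Lipschitz with the given constant. -/
def lipControls (G : MeanFieldGame d m) (L : ℝ) : Set (Euc d → Euc m) :=
  {φ | (∀ x, φ x ∈ G.U) ∧ ∀ x x', ‖φ x - φ x'‖ ≤ L * ‖x - x'‖}

theorem isControl_of_mem_lipControls (hφ : φ ∈ G.lipControls L) : G.IsControl φ :=
  ⟨(LipschitzWith.of_dist_le' (K := L) fun x y => by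
    rw [dist_eq_norm, dist_eq_norm]; exact hφ.2 x y).continuous, hφ.1⟩

/-- Finite nets of Lipschitz controls for the uniform distance on a ball. -/
theorem exists_lipControls_net (hU : IsCompact G.U) (L R : ℝ) {ε : ℝ} (hε : 0 < ε) :
    ∃ N ⊆ G.lipControls L, N.Finite ∧ ∀ φ ∈ G.lipControls L, ∃ ψ ∈ N, ∀ x, ‖x‖ ≤ R →
      ‖φ x - ψ x‖ ≤ ε := by
  classical
  have hcpt : CompactSpace (Metric.closedBall (0 : Euc d) R) :=
    isCompact_iff_compactSpace.1 (isCompact_closedBall _ _)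
  -- Arzelà–Ascoli applies to the restrictions to the ball; the net is taken among them and lifted
  -- back to controls on the whole space.
  let r : G.lipControls L → (Metric.closedBall (0 : Euc d) R →ᵇ Euc m) := fun φ =>
    BoundedContinuousFunction.mkOfCompact
      ⟨fun x => φ.1 x, (isControl_of_mem_lipControls φ.2).continuous.comp continuous_subtype_val⟩
  have hcl : IsCompact (closure (range r)) := by
    refine BoundedContinuousFunction.arzela_ascoli G.U hU _ ?_ ?_
    · rintro _ x ⟨φ, rfl⟩
      exact φ.2.1 x
    · refine UniformEquicontinuous.equicontinuous (LipschitzWith.uniformEquicontinuous _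
        (Real.toNNReal L) ?_)
      rintro ⟨_, φ, rfl⟩
      refine LipschitzWith.of_dist_le' fun x y => ?_
      rw [dist_eq_norm, Subtype.dist_eq, dist_eq_norm]
      exact φ.2.2 x y
  obtain ⟨F, hFr, hF, hcov⟩ := Metric.finite_approx_of_totallyBounded
    (hcl.totallyBounded.subset subset_closure) ε hε
  have hF' := hF.to_subtype
  have hex : ∀ f : F, ∃ φ, r φ = f := fun f => hFr f.2
  choose g hg using hex
  refine ⟨range fun f => (g f).1, ?_, finite_range _, fun φ hφ => ?_⟩
  · rintro _ ⟨f, rfl⟩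
    exact (g f).2
  · obtain ⟨f, hf, hd⟩ := mem_iUnion₂.1 (hcov (mem_range_self ⟨φ, hφ⟩))
    refine ⟨_, mem_range_self ⟨f, hf⟩, fun x hx => ?_⟩
    replace hd : dist (r ⟨φ, hφ⟩) (r (g ⟨f, hf⟩)) < ε := by rw [hg]; exact hd
    have := (BoundedContinuousFunction.dist_coe_le_dist
      (⟨x, mem_closedBall_zero_iff.2 hx⟩ : Metric.closedBall (0 : Euc d) R)).trans hd.le
    rwa [dist_eq_norm] at this

/-- The laws after one jump, with a Lipschitz control, are a totally bounded set if the initial laws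
are. -/
theorem totallyBounded_jump (hA : G.HypothesisA) (hU : IsCompact G.U) (L : ℝ)
    {A : Set (C0Dual d)} (hAP : A ⊆ probSet d) (hAtb : TotallyBounded A) :
    TotallyBounded {Λ | ∃ t ∈ G.I, ∃ q, probDual q ∈ A ∧ ∃ φ ∈ G.lipControls L,
      Λ = jump hA t q φ q} := by
  have hC := hA.mass_pos
  have hl := hA.lip_nonneg
  -- For a fixed initial law, finitely many controls suffice up to a small tail mass, and for each
  -- of them the time interval is compact. The Lipschitz dependence on `q` then reduces the claim to
  -- finitely many initial laws.
  have hfix : ∀ q : ProbabilityMeasure (Euc d), TotallyBounded {Λ | ∃ t ∈ G.I,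
      ∃ φ ∈ G.lipControls L, Λ = jump hA t q φ q} := by
    intro q
    refine totallyBounded_of_forall_exists_dist_le fun ε hε => ?_
    -- Makes the total error `mass⁻¹ * 2 * (lip * δ + 2 * mass * δ) = K * δ` equal to `ε`: closeness
    -- of controls on the ball plus tail mass.
    set K := hA.mass⁻¹ * 2 * hA.lip + 4 with hK
    have hK0 : 0 < K := by positivity
    set δ := ε / K with hδ
    have hδ0 : 0 < δ := by positivity
    have htight := tight_of_mem_probSet (d := d) ⟨q, rfl⟩
    obtain ⟨n, hn⟩ := (htight.eventually (lt_mem_nhds (show 1 - δ < 1 by linarith))).exists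
    -- The radius is `n + 1` because the `n`-th cutoff vanishes only beyond it.
    obtain ⟨N, hNL, hNf, hcov⟩ := exists_lipControls_net hU L (n + 1) hδ0
    refine ⟨⋃ ψ ∈ N, (fun t => jump hA t q ψ q) '' G.I,
      (totallyBounded_biUnion hNf).2 fun ψ hψ => ?_, ?_⟩
    · have hψ' := isControl_of_mem_lipControls (hNL hψ)
      refine (isCompact_Icc.image_of_continuousOn (continuousOn_jump (γ := fun _ => ψ)
        (μ := fun _ => q) (η := fun _ => q) hA ⟨hψ'.continuous.comp continuous_snd,
        fun _ => hψ'.mem⟩ continuousOn_const continuousOn_const)).totallyBounded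
    · rintro _ ⟨t, ht, φ, hφ, rfl⟩
      obtain ⟨ψ, hψ, hd⟩ := hcov φ hφ
      refine ⟨_, mem_biUnion hψ (mem_image_of_mem _ ht), ?_⟩
      have hφ' := isControl_of_mem_lipControls hφ
      have hψ' := isControl_of_mem_lipControls (hNL hψ)
      rw [dist_eq_norm]
      refine (norm_jump_sub_le_integral hA ht ht hφ' hψ').trans ?_
      have hpt : ∀ x, ‖G.kern t x q (φ x) - G.kern t x q (ψ x)‖
          ≤ hA.lip * δ + 2 * hA.mass * (1 - trunc 1 n x) := by
        intro x
        rw [trunc_apply, ContinuousMap.one_apply, one_mul]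
        have hcut := cutoff_le_one n x
        by_cases hx : ‖x‖ ≤ n + 1
        · refine (hA.norm_kern_sub_le ht x x q q (hφ'.mem x) (hψ'.mem x)).trans ?_
          rw [sub_self, sub_self, norm_zero, norm_zero, zero_add, zero_add]
          have h1 := mul_le_mul_of_nonneg_left (hd x hx) hl
          have h2 : 0 ≤ 2 * hA.mass * (1 - cutoff d n x) := mul_nonneg (by positivity) (by linarith)
          linarith
        · have h0 : cutoff d n x = 0 := by
            rw [cutoff, max_eq_left]
            exact (min_le_right _ _).trans (by linarith)
          rw [h0, sub_zero, mul_one]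
          have := hA.norm_kern_sub_le_two ht ht x q q (hφ'.mem x) (hψ'.mem x)
          have h2 : 0 ≤ hA.lip * δ := by positivity
          linarith
      have hti := (trunc (1 : C(Euc d, ℝ)) n).integrable (q : Measure (Euc d))
      have hint : ∫ x, ‖G.kern t x q (φ x) - G.kern t x q (ψ x)‖ ∂(q : Measure (Euc d))
          ≤ hA.lip * δ + 2 * hA.mass * δ := by
        have h1 : Integrable (fun x => 1 - trunc 1 n x) (q : Measure (Euc d)) :=
          (integrable_const 1).sub hti
        refine (integral_mono (g := fun x => hA.lip * δ + 2 * hA.mass * (1 - trunc 1 n x))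
          (integrable_of_continuous_of_abs_le (M := 2 * hA.mass)
          ((hφ'.continuous_kern hA ht q).sub (hψ'.continuous_kern hA ht q)).norm fun x => ?_)
          ((integrable_const _).add (h1.const_mul _)) hpt).trans ?_
        · rw [abs_norm]
          exact hA.norm_kern_sub_le_two ht ht x q q (hφ'.mem x) (hψ'.mem x)
        · rw [integral_add (integrable_const _) (h1.const_mul _), integral_const_mul, integral_const_mul,
            integral_sub (integrable_const _) hti]
          simp only [integral_const, probReal_univ, smul_eq_mul, one_mul]
          have : 1 - ∫ x, trunc 1 n x ∂(q : Measure (Euc d)) ≤ δ := by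
            rw [← probDual_apply]; linarith
          have := mul_le_mul_of_nonneg_left this (by positivity : 0 ≤ 2 * hA.mass)
          linarith
      refine (mul_le_mul_of_nonneg_left hint (by positivity)).trans (le_of_eq ?_)
      have : ε = K * δ := by rw [hδ]; field_simp
      rw [this, hK]
      field_simp
      ring
  refine totallyBounded_of_forall_exists_dist_le fun ε hε => ?_
  have hJ : 0 < hA.jumpLip := by unfold HypothesisA.jumpLip; positivity
  obtain ⟨N, hNA, hN, hcov⟩ := (totallyBounded_iff_subset.1 hAtb) _
    (Metric.dist_mem_uniformity (div_pos hε hJ))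
  refine ⟨_, (totallyBounded_biUnion hN).2 fun Λ _ => hfix (toProb Λ), ?_⟩
  rintro _ ⟨t, ht, q, hq, φ, hφ, rfl⟩
  have := hcov hq
  simp only [mem_iUnion, mem_ofPred_eq, exists_prop] at this
  obtain ⟨Λ, hΛ, hd⟩ := this
  refine ⟨jump hA t (toProb Λ) φ (toProb Λ), mem_biUnion hΛ ⟨t, ht, φ, hφ, rfl⟩, ?_⟩
  refine (dist_jump_le hA ht (isControl_of_mem_lipControls hφ) le_rfl).trans ?_
  rw [probDual_toProb (hAP (hNA hΛ)), ← le_div_iff₀' hJ]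
  exact hd.le

/-- Sets that contain the Picard iterates of the kinetic equation for all Lipschitz controls. -/
def picardSet (hA : G.HypothesisA) (μ₀ : ProbabilityMeasure (Euc d)) (L : ℝ) : ℕ → Set (C0Dual d)
  | 0 => {probDual μ₀}
  -- A Picard step averages `μ₀` and jumps over time, hence the closed convex hull; it preserves
  -- total boundedness.
  | n + 1 => closure (convexHull ℝ (insert (probDual μ₀) {Λ | ∃ t ∈ G.I, ∃ q,
      probDual q ∈ picardSet hA μ₀ L n ∧ ∃ φ ∈ G.lipControls L, Λ = jump hA t q φ q}))

theorem picardSet_spec (hA : G.HypothesisA) (hU : IsCompact G.U) (μ₀ : ProbabilityMeasure (Euc d))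
    (L : ℝ) (n : ℕ) : (Convex ℝ (picardSet hA μ₀ L n) ∧ IsClosed (picardSet hA μ₀ L n) ∧
      picardSet hA μ₀ L n ⊆ probSet d ∧ probDual μ₀ ∈ picardSet hA μ₀ L n) ∧
      TotallyBounded (picardSet hA μ₀ L n) := by
  induction n with
  | zero =>
    exact ⟨⟨convex_singleton _, isClosed_singleton, singleton_subset_iff.2 ⟨μ₀, rfl⟩, rfl⟩,
      (finite_singleton _).totallyBounded⟩
  | succ n ih =>
    refine ⟨⟨(convex_convexHull ℝ _).closure, isClosed_closure, ?_,
      subset_closure (subset_convexHull ℝ _ (mem_insert _ _))⟩, ?_⟩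
    · refine closure_minimal (convexHull_min ?_ convex_probSet) isClosed_probSet
      rintro Λ (rfl | ⟨t, ht, q, -, φ, hφ, rfl⟩)
      · exact ⟨μ₀, rfl⟩
      · exact jump_mem_probSet hA ht (isControl_of_mem_lipControls hφ)
    · refine TotallyBounded.closure (totallyBounded_convexHull.2 ?_)
      exact (totallyBounded_insert _).2 (totallyBounded_jump hA hU L ih.1.2.2.1 ih.2)

/-- The laws that solutions of the kinetic equation with Lipschitz controls reach. -/
def reachSet (G : MeanFieldGame d m) (μ₀ : ProbabilityMeasure (Euc d)) (L : ℝ) : Set (C0Dual d) :=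
  {Λ | ∃ γ η, G.IsContFeedback γ ∧ (∀ t, γ t ∈ G.lipControls L) ∧ G.IsKineticSolution μ₀ γ η ∧
    ∃ t ∈ G.I, Λ = probDual (η t)}

/-- Picard iteration converges at one rate for all admissible controls, so a single `picardSet`
approximates every reachable law to a given accuracy. -/
theorem totallyBounded_reachSet (hA : G.HypothesisA) (hU : IsCompact G.U)
    (μ₀ : ProbabilityMeasure (Euc d)) (L : ℝ) : TotallyBounded (G.reachSet μ₀ L) := by
  refine totallyBounded_of_forall_exists_dist_le fun ε hε => ?_
  have h0 := (tendsto_expTail (hA.jumpLip * hA.mass * (G.T - 0))).const_mul 2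
  rw [mul_zero] at h0
  obtain ⟨n, hn⟩ := (h0.eventually (gt_mem_nhds hε)).exists
  refine ⟨picardSet hA μ₀ L n, (picardSet_spec hA hU μ₀ L n).2, ?_⟩
  rintro _ ⟨γ, η, hγ, hγL, hη, t, ht, rfl⟩
  obtain ⟨η', hη', hS⟩ := exists_isKineticSolution hA hγ μ₀
  obtain ⟨y, hy, hd⟩ := hS (picardSet hA μ₀ L) (fun n => (picardSet_spec hA hU μ₀ L n).1)
    (fun n s hs q hq => subset_closure (subset_convexHull ℝ _
      (mem_insert_of_mem _ ⟨s, hs, q, hq, γ s, hγL s, rfl⟩))) n t ht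
  refine ⟨y, hy, ?_⟩
  rw [hη.unique hA hγ hη' ht, dist_comm]
  exact hd.trans hn.le

end MeanFieldGame

end

/-! ### Measurability and integrability for Borel feedback controls. -/

noncomputable section

open Filter Topology

/-- Primitives are measurable, whether or not the integrand is integrable. -/
theorem measurable_integral_max (f : ℝ → ℝ) (a : ℝ) :
    Measurable fun s => ∫ r in a..max a s, f r := by
  classical
  -- The times up to which `f` is integrable form a lower set. The primitive is continuous there and
  -- zero by convention elsewhere.
  set A := {s | IntervalIntegrable f volume a (max a s)} with hA
  have hlow : IsLowerSet A := fun s s' hs' hs => hs.mono_set (by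
    rw [uIcc_of_le (le_max_left _ _), uIcc_of_le (le_max_left _ _)]
    exact Icc_subset_Icc_right (max_le_max_left _ hs'))
  have hA' : MeasurableSet A := hlow.ordConnected.measurableSet
  have hcont : ContinuousOn (fun s => ∫ r in a..max a s, f r) A := by
    have hIic : ∀ s ∈ A, ContinuousOn (fun s => ∫ r in a..max a s, f r) (Iic s) := fun s hs => by
      refine (intervalIntegral.continuousOn_primitive_interval' hs left_mem_uIcc).comp
        (f := fun s => max a s) (by fun_prop) fun z hz => ?_
      rw [uIcc_of_le (le_max_left _ _)]
      exact ⟨le_max_left _ _, max_le_max_left _ hz⟩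
    intro s hs
    by_cases h : ∃ s' ∈ A, s < s'
    · obtain ⟨s', hs', hlt⟩ := h
      exact ((hIic s' hs').continuousAt (Iic_mem_nhds hlt)).continuousWithinAt
    · push Not at h
      exact (hIic s hs s self_mem_Iic).mono h
  convert hcont.measurable_piecewise (continuousOn_const (c := (0 : ℝ))) hA' using 1
  ext s
  by_cases h : s ∈ A
  · rw [piecewise_eq_of_mem _ _ _ h]
  · rw [piecewise_eq_of_notMem _ _ _ h, intervalIntegral.integral_undef h]

/-- A family of probability measures is measurable if its integrals of functions in `C_∞(ℝ^d)` are. -/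
theorem measurable_probabilityMeasure {d : ℕ} {α : Type*} [MeasurableSpace α]
    {p : α → ProbabilityMeasure (Euc d)}
    (h : ∀ g : C₀(Euc d, ℝ), Measurable fun a => ∫ y, g y ∂(p a : Measure (Euc d))) :
    Measurable fun a => (p a : Measure (Euc d)) := by
  refine .measure_of_isPiSystem_of_isProbabilityMeasure (S := {s | IsClosed s})
    (by rw [BorelSpace.measurable_eq (α := Euc d), borel_eq_generateFrom_isClosed])
    isPiSystem_isClosed fun F (hF : IsClosed F) => ?_
  refine measurable_of_tendsto_metrizable (f := fun n a =>
    ∫⁻ y, (hF.apprSeq n y : ENNReal) ∂(p a : Measure (Euc d))) (fun n => ?_)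
    (tendsto_pi_nhds.2 fun a => HasOuterApproxClosed.tendsto_lintegral_apprSeq hF _)
  have hc : Continuous fun y => ((hF.apprSeq n y : ℝ)) :=
    NNReal.continuous_coe.comp (hF.apprSeq n).continuous
  have hb : ∀ y, |((hF.apprSeq n y : ℝ))| ≤ 1 := fun y => by
    rw [abs_of_nonneg (NNReal.coe_nonneg _)]
    exact_mod_cast HasOuterApproxClosed.apprSeq_apply_le_one hF n y
  have hmeas : Measurable fun a => ∫ y, (hF.apprSeq n y : ℝ) ∂(p a : Measure (Euc d)) :=
    measurable_of_tendsto_metrizable (fun k => h (trunc ⟨_, hc⟩ k))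
      (tendsto_pi_nhds.2 fun a => tendsto_integral_trunc hb)
  have heq : (fun a => ∫⁻ y, (hF.apprSeq n y : ENNReal) ∂(p a : Measure (Euc d)))
      = fun a => ENNReal.ofReal (∫ y, (hF.apprSeq n y : ℝ) ∂(p a : Measure (Euc d))) :=
    funext fun a => lintegral_coe_eq_integral _ (integrable_of_continuous_of_abs_le hc hb)
  rw [heq]
  exact hmeas.ennreal_ofReal

namespace MeanFieldGame

variable {d m : ℕ} {G : MeanFieldGame d m} {t s s' C C' M : ℝ} {x : Euc d}
  {γ : ℝ → Euc d → Euc m} {μ p : ℝ → ProbabilityMeasure (Euc d)} {V : ℝ → Euc d → ℝ}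
  {H H' : ℝ → Euc d → Euc m → ℝ}

/-- Bounded functions on `[0, T] × ℝ^d × U` that are continuous in `(t, x)` and in `u`. -/
structure IsCost (G : MeanFieldGame d m) (H : ℝ → Euc d → Euc m → ℝ) (C : ℝ) : Prop where
  continuousOn_prod : ∀ u ∈ G.U, ContinuousOn (fun q : ℝ × Euc d => H q.1 q.2 u) (G.I ×ˢ univ)
  continuousOn_control : ∀ t ∈ G.I, ∀ x, ContinuousOn (H t x) G.U
  bound : ∀ t ∈ G.I, ∀ x, ∀ u ∈ G.U, |H t x u| ≤ C

theorem IsCost.sub (hH : G.IsCost H C) (hH' : G.IsCost H' C') :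
    G.IsCost (fun t x u => H t x u - H' t x u) (C + C') :=
  ⟨fun u hu => (hH.continuousOn_prod u hu).sub (hH'.continuousOn_prod u hu),
    fun t ht x => (hH.continuousOn_control t ht x).sub (hH'.continuousOn_control t ht x),
    fun t ht x _ hu => (abs_sub _ _).trans (add_le_add (hH.bound t ht x _ hu) (hH'.bound t ht x _ hu))⟩

theorem continuousOn_gen_control (hA : G.HypothesisA) (hV : G.CbOn V M) (ht : t ∈ G.I) (x : Euc d)
    (p : ProbabilityMeasure (Euc d)) :
    ContinuousOn (fun u => G.gen t x (probToSigned p) u (V t)) G.U := fun _ hu =>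
  hA.tendsto_gen (τ := fun _ => t) (ξ := fun _ => x) (π := fun _ => p) hV ht hu
    (tendsto_nhdsWithin_iff.2 ⟨tendsto_const_nhds, Eventually.of_forall fun _ => ht⟩)
    tendsto_const_nhds tendsto_const_nhds (tendsto_id.mono_left nhdsWithin_le_nhds)
    self_mem_nhdsWithin

theorem isCost_gen (hA : G.HypothesisA) (hμ : G.IsCurve μ) (hV : G.CbOn V M) :
    G.IsCost (fun t x u => G.gen t x (probToSigned (μ t)) u (V t)) (2 * hA.mass * M) :=
  ⟨fun _ hu => continuousOn_gen_prod hA hμ hV hu,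
    fun _ ht x => continuousOn_gen_control hA hV ht x _,
    fun t ht x _ hu => hA.abs_gen_le ht hu (hV.bound t ht) x⟩

theorem isCost_J (hB : G.HypothesisB) (hμ : G.IsCurve μ) :
    G.IsCost (fun t x u => G.J t x (probToSigned (μ t)) u) hB.bJ :=
  ⟨fun _ hu => continuousOn_J_prod hB hμ hu, fun _ ht x => hB.continuousOn_J ht x _,
    fun _ ht x _ hu => hB.abs_J_le ht x _ hu⟩

theorem isCost_ham (hA : G.HypothesisA) (hB : G.HypothesisB) (hμ : G.IsCurve μ) (hV : G.CbOn V M) :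
    G.IsCost (fun t x _ => G.ham μ V t x) (hB.bJ + 2 * hA.mass * M) :=
  ⟨fun _ _ => continuousOn_ham hA hB hμ hV, fun _ _ _ => continuousOn_const,
    fun _ ht x _ _ => abs_ham_le hA hB hV ht x⟩

/-- Carathéodory: a function measurable in `(t, x)` and continuous in the control is jointly
measurable, and so can be composed with a Borel feedback. -/
theorem IsCost.measurable (hH : G.IsCost H C) (hγ : G.IsFeedback γ) :
    Measurable fun b : G.I × Euc d => H b.1 b.2 (γ b.1 b.2) := by
  have h1 : Measurable (Function.uncurry fun (u : G.U) (b : G.I × Euc d) => H b.1 b.2 u) :=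
    measurable_uncurry_of_continuous_of_measurable
      (fun b => continuousOn_iff_continuous_domRestrict.1 (hH.continuousOn_control _ b.1.2 _))
      fun u => ((hH.continuousOn_prod u u.2).comp_continuous
        (f := fun b : G.I × Euc d => ((b.1 : ℝ), b.2)) (by fun_prop)
        fun b => ⟨b.1.2, mem_univ _⟩).measurable
  exact h1.comp ((hγ.measurable.subtype_mk (h := fun b => hγ.mem _ b.1.2 _)).prodMk measurable_id)

theorem IsCost.measurable_slice (hH : G.IsCost H C) (hγ : G.IsFeedback γ) (ht : t ∈ G.I) :
    Measurable fun y => H t y (γ t y) :=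
  (hH.measurable hγ).comp (g := fun b : G.I × Euc d => H b.1 b.2 (γ b.1 b.2))
    (f := fun y => (⟨t, ht⟩, y)) (by fun_prop)

theorem IsCost.integrable (hH : G.IsCost H C) (hγ : G.IsFeedback γ) (ht : t ∈ G.I)
    (q : ProbabilityMeasure (Euc d)) :
    Integrable (fun y => H t y (γ t y)) (q : Measure (Euc d)) :=
  Integrable.of_bound (hH.measurable_slice hγ ht).aestronglyMeasurable C
    (Eventually.of_forall fun y => hH.bound t ht y _ (hγ.mem t ht y))

/-- The projection onto `[t, T]`. -/
def clamp (G : MeanFieldGame d m) (t s : ℝ) : ℝ := max t (min G.T s)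

theorem clamp_of_mem (hs : s ∈ Icc t G.T) : G.clamp t s = s := by
  rw [clamp, min_eq_right hs.2, max_eq_right hs.1]

theorem clamp_mem (ht : t ∈ G.I) (s : ℝ) : G.clamp t s ∈ Icc t G.T :=
  ⟨le_max_left _ _, max_le ht.2 (min_le_left _ _)⟩

theorem clamp_mem_I (ht : t ∈ G.I) (s : ℝ) : G.clamp t s ∈ G.I :=
  Icc_subset_Icc_left ht.1 (clamp_mem ht s)

theorem continuous_clamp (t : ℝ) : Continuous (G.clamp t) := by
  unfold clamp; fun_prop

/-- State laws are not assumed measurable in time. The forward equation forces it, since each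
integral of a test function is a primitive; integrability of the integrand is not yet known here,
hence `measurable_integral_max`. -/
theorem IsStateLaw.measurable (hp : G.IsStateLaw μ γ t x p) (ht : t ∈ G.I) :
    Measurable fun s => (p (G.clamp t s) : Measure (Euc d)) := by
  refine measurable_probabilityMeasure fun g => ?_
  have h1 := (measurable_integral_max (fun r => ∫ y, G.gen r y (probToSigned (μ r)) (γ r y) g
    ∂(p r : Measure (Euc d))) t).comp (f := fun s => min G.T s) (by fun_prop)
  convert h1.const_add (g x) using 1
  ext s
  rw [hp _ (clamp_mem ht s) g]
  rfl

theorem IsCost.measurable_integral (hH : G.IsCost H C) (hγ : G.IsFeedback γ)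
    (hp : G.IsStateLaw μ γ t x p) (ht : t ∈ G.I) :
    Measurable fun s => ∫ y, H (G.clamp t s) y (γ (G.clamp t s) y)
      ∂(p (G.clamp t s) : Measure (Euc d)) := by
  let κ : ProbabilityTheory.Kernel ℝ (Euc d) := ⟨_, hp.measurable ht⟩
  have hκ : ProbabilityTheory.IsMarkovKernel κ := ⟨fun s => (p (G.clamp t s)).2⟩
  have h1 : Measurable fun b : ℝ × Euc d => H (G.clamp t b.1) b.2 (γ (G.clamp t b.1) b.2) :=
    (hH.measurable hγ).comp (g := fun b : G.I × Euc d => H b.1 b.2 (γ b.1 b.2))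
      (f := fun b : ℝ × Euc d => (⟨G.clamp t b.1, clamp_mem_I ht _⟩, b.2))
      ((((continuous_clamp t).measurable.comp measurable_fst).subtype_mk).prodMk measurable_snd)
  exact (h1.stronglyMeasurable.integral_kernel_prod_right' (κ := κ)).measurable

theorem IsCost.intervalIntegrable (hH : G.IsCost H C) (hγ : G.IsFeedback γ)
    (hp : G.IsStateLaw μ γ t x p) (ht : t ∈ G.I) (hs : s ∈ Icc t G.T) (hs' : s' ∈ Icc t G.T) :
    IntervalIntegrable (fun r => ∫ y, H r y (γ r y) ∂(p r : Measure (Euc d))) volume s s' := by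
  have h1 : IntervalIntegrable (fun r => ∫ y, H (G.clamp t r) y (γ (G.clamp t r) y)
      ∂(p (G.clamp t r) : Measure (Euc d))) volume s s' := by
    refine (intervalIntegrable_const (c := C)).mono_fun
      (hH.measurable_integral hγ hp ht).aestronglyMeasurable (Eventually.of_forall fun r => ?_)
    refine (abs_integral_le_of_prob fun y => hH.bound _ (clamp_mem_I ht r) y _
      (hγ.mem _ (clamp_mem_I ht r) y)).trans (le_abs_self _)
  refine h1.congr fun r hr => ?_
  have : r ∈ Icc t G.T := ordConnected_Icc.uIcc_subset hs hs' (uIoc_subset_uIcc hr)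
  simp only [clamp_of_mem this]

end MeanFieldGame

end

/-! ### The verification theorem. -/

noncomputable section

open Filter Topology

/-- A function with quadratically small increments is constant. -/
theorem eq_of_forall_abs_sub_le_sq {D : ℝ → ℝ} {a b K : ℝ} (hab : a ≤ b)
    (h : ∀ s ∈ Icc a b, ∀ s' ∈ Icc a b, s ≤ s' → |D s' - D s| ≤ K * (s' - s) ^ 2) : D b = D a := by
  have hd : ∀ s ∈ Icc a b, HasDerivWithinAt D 0 (Icc a b) s := by
    intro s hs
    have h1 : ∀ z ∈ Icc a b, |D z - D s| ≤ K * (z - s) ^ 2 := fun z hz => by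
      rcases le_total s z with hsz | hsz
      · exact h s hs z hz hsz
      · rw [abs_sub_comm, ← neg_sub s z, neg_sq]
        exact h z hz s hs hsz
    rw [hasDerivWithinAt_iff_isLittleO]
    have h2 : (fun z => D z - D s - (z - s) • (0 : ℝ)) =O[𝓝[Icc a b] s] fun z => (z - s) ^ 2 := by
      refine Asymptotics.IsBigO.of_bound K (eventually_nhdsWithin_of_forall fun z hz => ?_)
      rw [smul_zero, sub_zero, Real.norm_eq_abs, Real.norm_of_nonneg (sq_nonneg _)]
      exact h1 z hz
    refine h2.trans_isLittleO ?_
    have h3 := Asymptotics.isLittleO_pow_id (𝕜 := ℝ) (n := 2) one_lt_two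
    refine h3.comp_tendsto (k := fun z => z - s) ?_
    have : Tendsto (fun z => z - s) (𝓝 s) (𝓝 (s - s)) := (continuous_id.sub continuous_const).tendsto s
    rw [sub_self] at this
    exact this.mono_left nhdsWithin_le_nhds
  exact constant_of_has_deriv_right_zero (fun s hs => (hd s hs).continuousWithinAt)
    (fun s hs => ((hd s (Ico_subset_Icc_self hs)).mono
      (Icc_subset_Icc_left hs.1)).mono_of_mem_nhdsWithin (Icc_mem_nhdsGE hs.2)) b
    (right_mem_Icc.2 hab)

namespace MeanFieldGame

variable {d m : ℕ} {G : MeanFieldGame d m} {t s s' C C' M : ℝ} {x : Euc d}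
  {γ : ℝ → Euc d → Euc m} {μ p : ℝ → ProbabilityMeasure (Euc d)} {V : ℝ → Euc d → ℝ}
  {f : Euc d → ℝ}

theorem cbOn_const_of_continuous (hf : Continuous f) (hM : ∀ x, |f x| ≤ M) :
    G.CbOn (fun _ => f) M :=
  ⟨(hf.comp continuous_snd).continuousOn, fun _ _ => hM⟩

/-- The forward equation for bounded continuous test functions. -/
theorem IsStateLaw.integral_eq (hA : G.HypothesisA) (hμ : G.IsCurve μ) (hγ : G.IsFeedback γ)
    (ht : t ∈ G.I) (hp : G.IsStateLaw μ γ t x p) (hf : Continuous f) (hM : ∀ x, |f x| ≤ M)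
    (hs : s ∈ Icc t G.T) :
    ∫ y, f y ∂(p s : Measure (Euc d)) = f x +
      ∫ r in t..s, ∫ y, G.gen r y (probToSigned (μ r)) (γ r y) f ∂(p r : Measure (Euc d)) := by
  let F : C(Euc d, ℝ) := ⟨f, hf⟩
  have hMn : ∀ n x, |trunc F n x| ≤ M := fun n x => (abs_trunc_le F n x).trans (hM x)
  have htt : t ∈ Icc t G.T := left_mem_Icc.2 ht.2
  have hcost : ∀ n, G.IsCost (fun r y u => G.gen r y (probToSigned (μ r)) u (trunc F n))
      (2 * hA.mass * M) := fun n =>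
    isCost_gen hA hμ (cbOn_const_of_continuous (trunc F n).continuous (hMn n))
  have hlim : ∀ r ∈ G.I, Tendsto
      (fun n => ∫ y, G.gen r y (probToSigned (μ r)) (γ r y) (trunc F n) ∂(p r : Measure (Euc d)))
      atTop (𝓝 (∫ y, G.gen r y (probToSigned (μ r)) (γ r y) f ∂(p r : Measure (Euc d)))) := by
    intro r hr
    refine tendsto_integral_of_dominated_convergence (fun _ => 2 * hA.mass * M)
      (fun n => ((hcost n).measurable_slice hγ hr).aestronglyMeasurable) (integrable_const _)
      (fun n => Eventually.of_forall fun y => (hcost n).bound r hr y _ (hγ.mem r hr y))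
      (Eventually.of_forall fun y => ?_)
    have h1 := (tendsto_integral_trunc (f := F)
      (m := (G.ν r y (probToSigned (μ r)) (γ r y) : Measure (Euc d))) hM).sub
      ((tendsto_trunc F y).const_mul
        ((G.ν r y (probToSigned (μ r)) (γ r y) : Measure (Euc d)).real univ))
    rw [gen_eq_sub hf hM]
    exact h1.congr fun n => (gen_coe_eq_sub _ _).symm
  have h1 := tendsto_integral_trunc (f := F) (m := (p s : Measure (Euc d))) hM
  have h2 : Tendsto (fun n => ∫ r in t..s, ∫ y, G.gen r y (probToSigned (μ r)) (γ r y) (trunc F n)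
      ∂(p r : Measure (Euc d))) atTop (𝓝 (∫ r in t..s, ∫ y, G.gen r y (probToSigned (μ r)) (γ r y) f
      ∂(p r : Measure (Euc d)))) := by
    have hmem : ∀ r ∈ uIoc t s, r ∈ G.I := fun r hr => Icc_subset_Icc_left ht.1
      (ordConnected_Icc.uIcc_subset htt hs (uIoc_subset_uIcc hr))
    refine intervalIntegral.tendsto_integral_filter_of_dominated_convergence
      (fun _ => 2 * hA.mass * M)
      (Eventually.of_forall fun n => (intervalIntegrable_iff.1
        ((hcost n).intervalIntegrable hγ hp ht htt hs)).aestronglyMeasurable)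
      (Eventually.of_forall fun n => Eventually.of_forall fun r hr =>
        abs_integral_le_of_prob fun y => (hcost n).bound r (hmem r hr) y _ (hγ.mem r (hmem r hr) y))
      intervalIntegrable_const (Eventually.of_forall fun r hr => hlim r (hmem r hr))
  refine tendsto_nhds_unique h1 ?_
  refine ((tendsto_trunc F x).add h2).congr fun n => ?_
  exact (hp s hs (trunc F n)).symm

theorem IsStateLaw.integral_sub_integral (hA : G.HypothesisA) (hμ : G.IsCurve μ)
    (hγ : G.IsFeedback γ) (ht : t ∈ G.I) (hp : G.IsStateLaw μ γ t x p) (hf : Continuous f)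
    (hM : ∀ x, |f x| ≤ M) (hs : s ∈ Icc t G.T) (hs' : s' ∈ Icc t G.T) :
    ∫ y, f y ∂(p s' : Measure (Euc d)) - ∫ y, f y ∂(p s : Measure (Euc d)) =
      ∫ r in s..s', ∫ y, G.gen r y (probToSigned (μ r)) (γ r y) f ∂(p r : Measure (Euc d)) := by
  have hcost := isCost_gen hA hμ (cbOn_const_of_continuous (G := G) hf hM)
  have htt : t ∈ Icc t G.T := left_mem_Icc.2 ht.2
  rw [hp.integral_eq hA hμ hγ ht hf hM hs', hp.integral_eq hA hμ hγ ht hf hM hs,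
    add_sub_add_left_eq_sub, intervalIntegral.integral_interval_sub_left
      (hcost.intervalIntegrable hγ hp ht htt hs') (hcost.intervalIntegrable hγ hp ht htt hs)]

theorem IsStateLaw.abs_integral_sub_integral_le (hA : G.HypothesisA) (hμ : G.IsCurve μ)
    (hγ : G.IsFeedback γ) (ht : t ∈ G.I) (hp : G.IsStateLaw μ γ t x p) (hf : Continuous f)
    (hM : ∀ x, |f x| ≤ M) (hs : s ∈ Icc t G.T) (hs' : s' ∈ Icc t G.T) :
    |∫ y, f y ∂(p s' : Measure (Euc d)) - ∫ y, f y ∂(p s : Measure (Euc d))|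
      ≤ 2 * hA.mass * M * |s' - s| := by
  rw [hp.integral_sub_integral hA hμ hγ ht hf hM hs hs', ← Real.norm_eq_abs]
  refine intervalIntegral.norm_integral_le_of_norm_le_const fun r hr =>
    abs_integral_le_of_prob fun y => ?_
  have hr' : r ∈ G.I := Icc_subset_Icc_left ht.1
    (ordConnected_Icc.uIcc_subset hs hs' (uIoc_subset_uIcc hr))
  exact hA.abs_gen_le hr' (hγ.mem r hr' y) hM y

theorem IsHJBSolution.sub_eq_integral (hA : G.HypothesisA) (hB : G.HypothesisB) (hμ : G.IsCurve μ)
    (hV : G.IsHJBSolution μ V) (hs : s ∈ G.I) (hs' : s' ∈ G.I) (y : Euc d) :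
    V s y - V s' y = ∫ r in s..s', G.ham μ V (G.pr r) y := by
  have h := ((isHJBSolution_iff hA hB hμ).1 hV).2
  have hi := fun a b => (continuous_ham_pr_time hA hB hμ (hV.cbOn hA hB hμ) y).intervalIntegrable
    (μ := volume) a b
  rw [h s hs y, h s' hs' y, add_sub_add_left_eq_sub,
    intervalIntegral.integral_interval_sub_interval_comm (hi _ _) (hi _ _) (hi _ _),
    intervalIntegral.integral_same, sub_zero]

/-- A bound for the Hamiltonian along the value functions. -/
def hamBound (hA : G.HypothesisA) (hB : G.HypothesisB) : ℝ :=
  hB.bJ + 2 * hA.mass * valueBound hA hB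

theorem IsHJBSolution.abs_sub_le (hA : G.HypothesisA) (hB : G.HypothesisB) (hμ : G.IsCurve μ)
    (hV : G.IsHJBSolution μ V) (hs : s ∈ G.I) (hs' : s' ∈ G.I) (y : Euc d) :
    |V s y - V s' y| ≤ hamBound hA hB * |s' - s| := by
  rw [hV.sub_eq_integral hA hB hμ hs hs' y, ← Real.norm_eq_abs]
  exact intervalIntegral.norm_integral_le_of_norm_le_const fun r _ =>
    abs_ham_le hA hB (hV.cbOn hA hB hμ) (G.pr r).2 y

/-- The derivative of `∫ V_s dp_s`, up to a quadratic error. -/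
theorem IsStateLaw.abs_value_sub_le (hA : G.HypothesisA) (hB : G.HypothesisB) (hμ : G.IsCurve μ)
    (hV : G.IsHJBSolution μ V) (hγ : G.IsFeedback γ) (ht : t ∈ G.I) (hp : G.IsStateLaw μ γ t x p)
    (hs : s ∈ Icc t G.T) (hs' : s' ∈ Icc t G.T) (hss' : s ≤ s') :
    |∫ y, V s' y ∂(p s' : Measure (Euc d)) - ∫ y, V s y ∂(p s : Measure (Euc d))
      - ∫ r in s..s', ∫ y, (G.gen r y (probToSigned (μ r)) (γ r y) (V r) - G.ham μ V r y)
        ∂(p r : Measure (Euc d))| ≤ 4 * hA.mass * hamBound hA hB * (s' - s) ^ 2 := by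
  have hVb := hV.cbOn hA hB hμ
  have hsub : Icc t G.T ⊆ G.I := Icc_subset_Icc_left ht.1
  have hsI := hsub hs
  have hsI' := hsub hs'
  have hmem : ∀ r ∈ Icc s s', r ∈ Icc t G.T := fun r hr => ⟨hs.1.trans hr.1, hr.2.trans hs'.2⟩
  have hcV := hVb.continuous hsI'
  have hint : ∀ q : ProbabilityMeasure (Euc d), ∀ r ∈ G.I, Integrable (V r) (q : Measure (Euc d)) :=
    fun q r hr => integrable_of_continuous_of_abs_le (hVb.continuous hr) (hVb.bound r hr)
  -- The increment splits into the change of the law tested on the fixed function `V s'`, and, in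
  -- `e2`, the change of `V` under the fixed law `p s`.
  have e1 := hp.integral_sub_integral hA hμ hγ ht hcV (hVb.bound s' hsI') hs hs'
  have hprod : Integrable (Function.uncurry fun (r : ℝ) y => G.ham μ V (G.pr r) y)
      ((volume.restrict (uIoc s s')).prod (p s : Measure (Euc d))) := by
    have : IsFiniteMeasure (volume.restrict (uIoc s s')) := by
      rw [uIoc_of_le hss']; infer_instance
    exact Integrable.of_bound (continuous_ham_pr hA hB hμ hVb).aestronglyMeasurable
      (hB.bJ + 2 * hA.mass * valueBound hA hB)
      (Eventually.of_forall fun b => abs_ham_le hA hB hVb (G.pr b.1).2 b.2)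
  have e2 : ∫ y, V s y ∂(p s : Measure (Euc d)) - ∫ y, V s' y ∂(p s : Measure (Euc d))
      = ∫ r in s..s', ∫ y, G.ham μ V (G.pr r) y ∂(p s : Measure (Euc d)) := by
    rw [intervalIntegral_integral_swap hprod, ← integral_sub (hint _ s hsI) (hint _ s' hsI')]
    exact integral_congr_ae (Eventually.of_forall fun y => hV.sub_eq_integral hA hB hμ hsI hsI' y)
  have hi2 : IntervalIntegrable (fun r => ∫ y, G.ham μ V (G.pr r) y ∂(p s : Measure (Euc d)))
      volume s s' := by
    rw [intervalIntegrable_iff]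
    exact hprod.integral_prod_left
  have hc1 := isCost_gen hA hμ (cbOn_const_of_continuous (G := G) hcV (hVb.bound s' hsI'))
  have hc2 := (isCost_gen hA hμ hVb).sub (isCost_ham hA hB hμ hVb)
  have hi1 := hc1.intervalIntegrable hγ hp ht hs hs'
  have hi3 := hc2.intervalIntegrable hγ hp ht hs hs'
  have e3 : ∫ y, V s' y ∂(p s' : Measure (Euc d)) - ∫ y, V s y ∂(p s : Measure (Euc d))
      - ∫ r in s..s', ∫ y, (G.gen r y (probToSigned (μ r)) (γ r y) (V r) - G.ham μ V r y)
        ∂(p r : Measure (Euc d))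
      = ∫ r in s..s', (((∫ y, G.gen r y (probToSigned (μ r)) (γ r y) (V s')
          ∂(p r : Measure (Euc d))) - ∫ y, G.ham μ V (G.pr r) y ∂(p s : Measure (Euc d)))
        - ∫ y, (G.gen r y (probToSigned (μ r)) (γ r y) (V r) - G.ham μ V r y)
          ∂(p r : Measure (Euc d))) := by
    rw [intervalIntegral.integral_sub (hi1.sub hi2) hi3, intervalIntegral.integral_sub hi1 hi2,
      ← e1, ← e2]
    ring
  rw [e3]
  have hK : 0 ≤ hamBound hA hB := by
    have := hB.bJ_nonneg
    have := hA.mass_pos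
    have := valueBound_nonneg hA hB
    unfold hamBound
    positivity
  have hm := hA.mass_pos
  have := intervalIntegral.norm_integral_le_of_norm_le_const (a := s) (b := s')
    (C := 4 * hA.mass * hamBound hA hB * (s' - s)) (f := fun r =>
      (((∫ y, G.gen r y (probToSigned (μ r)) (γ r y) (V s')
          ∂(p r : Measure (Euc d))) - ∫ y, G.ham μ V (G.pr r) y ∂(p s : Measure (Euc d)))
        - ∫ y, (G.gen r y (probToSigned (μ r)) (γ r y) (V r) - G.ham μ V r y)
          ∂(p r : Measure (Euc d)))) fun r hr => ?_
  · refine this.trans_eq ?_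
    rw [abs_of_nonneg (sub_nonneg.2 hss')]
    ring
  · rw [uIoc_of_le hss'] at hr
    have hr' : r ∈ Icc s s' := Ioc_subset_Icc_self hr
    have hrT := hmem r hr'
    have hrI := hsub hrT
    rw [coe_pr_of_mem hrI, integral_sub ((isCost_gen hA hμ hVb).integrable hγ hrI _)
      ((isCost_ham hA hB hμ hVb).integrable hγ hrI _)]
    have hch : Continuous (G.ham μ V r) :=
      (continuousOn_ham hA hB hμ hVb).comp_continuous (f := fun y => (r, y)) (by fun_prop)
        fun y => ⟨hrI, mem_univ _⟩
    -- Replacing `V s'` by `V r`, and in `b2` the law `p s` by `p r`, costs a multiple of `s' - s`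
    -- each; integration over `[s, s']` makes the error quadratic.
    have b1 : |∫ y, G.gen r y (probToSigned (μ r)) (γ r y) (V s') ∂(p r : Measure (Euc d))
        - ∫ y, G.gen r y (probToSigned (μ r)) (γ r y) (V r) ∂(p r : Measure (Euc d))|
        ≤ 2 * hA.mass * (hamBound hA hB * (s' - s)) := by
      rw [← integral_sub (hc1.integrable hγ hrI _) ((isCost_gen hA hμ hVb).integrable hγ hrI _)]
      refine abs_integral_le_of_prob fun y => ?_
      refine hA.abs_gen_sub_gen_le hrI (hγ.mem r hrI y) hcV (hVb.bound s' hsI')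
        (hVb.continuous hrI) (hVb.bound r hrI) (fun z => ?_) y
      refine (hV.abs_sub_le hA hB hμ hsI' hrI z).trans (mul_le_mul_of_nonneg_left ?_ hK)
      rw [abs_sub_comm, abs_of_nonneg (sub_nonneg.2 hr'.2)]
      linarith [hr'.1]
    have b2 := hp.abs_integral_sub_integral_le hA hμ hγ ht hch
      (fun y => abs_ham_le hA hB hVb hrI y) hs hrT
    rw [abs_of_nonneg (sub_nonneg.2 hr'.1)] at b2
    have b3 : 2 * hA.mass * hamBound hA hB * (r - s) ≤ 2 * hA.mass * hamBound hA hB * (s' - s) :=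
      mul_le_mul_of_nonneg_left (by linarith [hr'.2]) (by positivity)
    have b2' := abs_le.1 (b2.trans b3)
    have b1' := abs_le.1 b1
    rw [Real.norm_eq_abs, abs_le]
    constructor <;> linarith [b1'.1, b1'.2, b2'.1, b2'.2]

/-- The payoff of a feedback control is the value minus the expected deficit of the control. -/
theorem IsStateLaw.payoff_eq (hA : G.HypothesisA) (hB : G.HypothesisB) (hμ : G.IsCurve μ)
    (hV : G.IsHJBSolution μ V) (hγ : G.IsFeedback γ) (ht : t ∈ G.I) (hp : G.IsStateLaw μ γ t x p) :
    G.payoff μ γ t p = V t x + ∫ r in t..G.T, ∫ y, (G.Theta μ V r y (γ r y) - G.ham μ V r y)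
      ∂(p r : Measure (Euc d)) := by
  have hVb := hV.cbOn hA hB hμ
  have htt : t ∈ Icc t G.T := left_mem_Icc.2 ht.2
  have hTT : G.T ∈ Icc t G.T := right_mem_Icc.2 ht.2
  have hcJ := isCost_J hB hμ
  have hc2 := (isCost_gen hA hμ hVb).sub (isCost_ham hA hB hμ hVb)
  have hi := fun {a b} (ha : a ∈ Icc t G.T) (hb : b ∈ Icc t G.T) =>
    hc2.intervalIntegrable hγ hp ht ha hb
  -- For a merely Borel feedback `s ↦ ∫ V_s dp_s` need not be differentiable at every `s`; the
  -- quadratic error estimate avoids differentiating it.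
  have hconst := eq_of_forall_abs_sub_le_sq (a := t) (b := G.T)
    (K := 4 * hA.mass * hamBound hA hB) (D := fun s => ∫ y, V s y ∂(p s : Measure (Euc d))
      - ∫ r in t..s, ∫ y, (G.gen r y (probToSigned (μ r)) (γ r y) (V r) - G.ham μ V r y)
        ∂(p r : Measure (Euc d))) ht.2 fun s hs s' hs' hss' => by
    have := hp.abs_value_sub_le hA hB hμ hV hγ ht hs hs' hss'
    rw [← intervalIntegral.integral_interval_sub_left (hi htt hs') (hi htt hs)] at this
    convert this using 2
    ring
  simp only [intervalIntegral.integral_same, sub_zero] at hconst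
  have hstart := hp.integral_eq hA hμ hγ ht (hVb.continuous ht) (hVb.bound t ht) htt
  rw [intervalIntegral.integral_same, add_zero] at hstart
  rw [hstart] at hconst
  have hterm : ∫ y, G.VT y (probToSigned (μ G.T)) ∂(p G.T : Measure (Euc d))
      = ∫ y, V G.T y ∂(p G.T : Measure (Euc d)) := by simp only [hV.terminal]
  have hsum : ∫ r in t..G.T, ∫ y, (G.Theta μ V r y (γ r y) - G.ham μ V r y)
      ∂(p r : Measure (Euc d))
      = (∫ r in t..G.T, ∫ y, G.J r y (probToSigned (μ r)) (γ r y) ∂(p r : Measure (Euc d)))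
      + ∫ r in t..G.T, ∫ y, (G.gen r y (probToSigned (μ r)) (γ r y) (V r) - G.ham μ V r y)
        ∂(p r : Measure (Euc d)) := by
    rw [← intervalIntegral.integral_add (hcJ.intervalIntegrable hγ hp ht htt hTT) (hi htt hTT)]
    refine intervalIntegral.integral_congr fun r hr => ?_
    rw [uIcc_of_le ht.2] at hr
    have hrI : r ∈ G.I := Icc_subset_Icc_left ht.1 hr
    rw [← integral_add (hcJ.integrable hγ hrI _) (hc2.integrable hγ hrI _)]
    congr 1
    ext y
    rw [Theta]
    ring
  rw [payoff, hterm, hsum]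
  linarith

theorem payoff_le (hA : G.HypothesisA) (hB : G.HypothesisB) (hμ : G.IsCurve μ)
    (hV : G.IsHJBSolution μ V) (hγ : G.IsFeedback γ) (ht : t ∈ G.I) (hp : G.IsStateLaw μ γ t x p) :
    G.payoff μ γ t p ≤ V t x := by
  rw [hp.payoff_eq hA hB hμ hV hγ ht]
  refine add_le_of_nonpos_right ?_
  rw [← neg_nonneg, ← intervalIntegral.integral_neg]
  refine intervalIntegral.integral_nonneg ht.2 fun r hr => ?_
  have hrI : r ∈ G.I := Icc_subset_Icc_left ht.1 hr
  rw [neg_nonneg]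
  refine integral_nonpos fun y => sub_nonpos.2 ?_
  exact (isGreatest_ham hA hB (hV.cbOn hA hB hμ) hrI y).2 (mem_image_of_mem _ (hγ.mem r hrI y))

theorem payoff_argmax (hA : G.HypothesisA) (hB : G.HypothesisB) (hμ : G.IsCurve μ)
    (hV : G.IsHJBSolution μ V) (ht : t ∈ G.I) (hp : G.IsStateLaw μ (G.argmax μ V) t x p) :
    G.payoff μ (G.argmax μ V) t p = V t x := by
  rw [hp.payoff_eq hA hB hμ hV (isFeedback_argmax hA hB hμ hV) ht, add_eq_left,
    ← intervalIntegral.integral_zero (a := t) (b := G.T) (μ := volume)]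
  refine intervalIntegral.integral_congr fun r hr => ?_
  rw [uIcc_of_le ht.2] at hr
  have hrI : r ∈ G.I := Icc_subset_Icc_left ht.1 hr
  rw [← integral_zero (Euc d) ℝ (μ := (p r : Measure (Euc d)))]
  congr 1
  ext y
  have := Theta_argmax (μ := μ) hA hB (hV.cbOn hA hB hμ) r y
  rw [coe_pr_of_mem hrI] at this
  rw [this, sub_self]

theorem isContFeedback_argmax (hA : G.HypothesisA) (hB : G.HypothesisB) (hμ : G.IsCurve μ)
    (hV : G.IsHJBSolution μ V) : G.IsContFeedback (G.argmax μ V) :=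
  ⟨continuous_argmax hA hB hμ hV,
    fun t x => (isMaximizer_argmax (μ := μ) hA hB (hV.cbOn hA hB hμ) t x).1⟩

/-- **Verification theorem.** The value function is the solution of the Hamilton-Jacobi-Bellman
equation, and its maximizer is an optimal feedback control. -/
theorem isOptimalFeedback_argmax (hA : G.HypothesisA) (hB : G.HypothesisB) (hμ : G.IsCurve μ)
    (hV : G.IsHJBSolution μ V) : G.IsOptimalFeedback μ V (G.argmax μ V) := by
  refine ⟨isFeedback_argmax hA hB hμ hV, fun t ht x => ?_⟩
  obtain ⟨p, hp⟩ := exists_isStateLaw hA hμ (isContFeedback_argmax hA hB hμ hV) ht x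
  refine ⟨⟨⟨_, p, isFeedback_argmax hA hB hμ hV, hp, (payoff_argmax hA hB hμ hV ht hp).symm⟩, ?_⟩,
    p, hp, payoff_argmax hA hB hμ hV ht hp⟩
  rintro _ ⟨γ, q, hγ, hq, rfl⟩
  exact payoff_le hA hB hμ hV hγ ht hq

end MeanFieldGame

end

/-! ### The response map and its fixed point. -/

noncomputable section

namespace MeanFieldGame

open Filter Topology

variable {d m : ℕ} {G : MeanFieldGame d m} {μ μ' η : ℝ → ProbabilityMeasure (Euc d)}
  {μ₀ : ProbabilityMeasure (Euc d)}

/-- The solution of the Hamilton-Jacobi-Bellman equation for the flow `μ`. -/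
def value (G : MeanFieldGame d m) (μ : ℝ → ProbabilityMeasure (Euc d)) : ℝ → Euc d → ℝ :=
  Classical.epsilon (G.IsHJBSolution μ)

theorem isHJBSolution_value (hA : G.HypothesisA) (hB : G.HypothesisB) (hμ : G.IsCurve μ) :
    G.IsHJBSolution μ (G.value μ) :=
  Classical.epsilon_spec (p := G.IsHJBSolution μ)
    ((exists_isHJBSolution hA hB hμ).imp fun _ h => h.1)

/-- The optimal feedback control against the flow `μ`. -/
def control (G : MeanFieldGame d m) (μ : ℝ → ProbabilityMeasure (Euc d)) : ℝ → Euc d → Euc m :=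
  G.argmax μ (G.value μ)

theorem isContFeedback_control (hA : G.HypothesisA) (hB : G.HypothesisB) (hμ : G.IsCurve μ) :
    G.IsContFeedback (G.control μ) :=
  isContFeedback_argmax hA hB hμ (isHJBSolution_value hA hB hμ)

theorem control_mem_lipControls (hA : G.HypothesisA) (hB : G.HypothesisB) (hμ : G.IsCurve μ)
    (t : ℝ) : G.control μ t ∈ G.lipControls (hB.lΘ / hB.conc) :=
  ⟨(isContFeedback_control hA hB hμ).mem t,
    norm_argmax_sub_le hA hB hμ (isHJBSolution_value hA hB hμ) t⟩

/-- The flow of the population that uses the optimal feedback control against the flow `μ`. -/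
def response (G : MeanFieldGame d m) (μ₀ : ProbabilityMeasure (Euc d))
    (μ : ℝ → ProbabilityMeasure (Euc d)) : ℝ → ProbabilityMeasure (Euc d) :=
  Classical.epsilon (G.IsKineticSolution μ₀ (G.control μ))

theorem isKineticSolution_response (hA : G.HypothesisA) (hB : G.HypothesisB) (hμ : G.IsCurve μ) :
    G.IsKineticSolution μ₀ (G.control μ) (G.response μ₀ μ) :=
  Classical.epsilon_spec (p := G.IsKineticSolution μ₀ (G.control μ))
    ((exists_isKineticSolution hA (isContFeedback_control hA hB hμ) μ₀).imp fun _ h => h.1)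

/-- The modulus of continuity of the response map. -/
def responseModulus (hA : G.HypothesisA) (hB : G.HypothesisB) (e : ℝ) : ℝ :=
  hA.mass⁻¹ * 2 * (hA.lip * √(argmaxHolder hA hB * e))
    * Real.exp (hA.mass * (hA.jumpLip + 1) * (G.T - 0))

/-- Hölder dependence of the control on the flow is followed by Lipschitz dependence of the kinetic
solution on the control. -/
theorem dist_response_le (hA : G.HypothesisA) (hB : G.HypothesisB) (hμ : G.IsCurve μ)
    (hμ' : G.IsCurve μ') {e : ℝ} (he : ∀ t ∈ G.I, ‖probDual (μ t) - probDual (μ' t)‖ ≤ e) :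
    ∀ t ∈ G.I, dist (probDual (G.response μ₀ μ t)) (probDual (G.response μ₀ μ' t))
      ≤ responseModulus hA hB e :=
  dist_kineticSolution_le hA (isContFeedback_control hA hB hμ) (isContFeedback_control hA hB hμ')
    (isKineticSolution_response hA hB hμ) (isKineticSolution_response hA hB hμ') fun t x =>
      Real.le_sqrt_of_sq_le (norm_argmax_sub_argmax_sq_le hA hB hμ hμ'
        (isHJBSolution_value hA hB hμ) (isHJBSolution_value hA hB hμ') he t x)

theorem tendsto_responseModulus (hA : G.HypothesisA) (hB : G.HypothesisB) :
    Tendsto (responseModulus hA hB) (𝓝 0) (𝓝 0) := by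
  have : Continuous (responseModulus hA hB) := by
    unfold responseModulus
    fun_prop
  simpa [responseModulus] using this.tendsto 0

/-- Curves of probability measures, as continuous functions into the dual of `C_∞(ℝ^d)`. -/
def flowSet (G : MeanFieldGame d m) : Set (G.I →ᵇ C0Dual d) := {f | ∀ t, f t ∈ probSet d}

/-- The curve of probability measures that a continuous function describes. -/
def toFlow (f : G.I →ᵇ C0Dual d) (t : ℝ) : ProbabilityMeasure (Euc d) := toProb (f (G.pr t))

theorem probDual_toFlow {f : G.I →ᵇ C0Dual d} (hf : f ∈ G.flowSet) (t : ℝ) :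
    probDual (toFlow f t) = f (G.pr t) :=
  probDual_toProb (hf _)

theorem isCurve_toFlow {f : G.I →ᵇ C0Dual d} (hf : f ∈ G.flowSet) : G.IsCurve (toFlow f) := by
  rw [isCurve_iff]
  simp only [probDual_toFlow hf]
  exact (f.continuous.comp G.continuous_pr).continuousOn

theorem isClosed_flowSet : IsClosed (G.flowSet) := by
  have : G.flowSet = ⋂ t : G.I, (fun f : G.I →ᵇ C0Dual d => f t) ⁻¹' probSet d := by
    ext f; simp [flowSet]
  rw [this]
  exact isClosed_iInter fun t =>
    isClosed_probSet.preimage (continuous_eval_const t)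

theorem convex_flowSet : Convex ℝ (G.flowSet) := fun _ hf _ hg _ _ ha hb hab t =>
  convex_probSet (hf t) (hg t) ha hb hab

/-- The response map has a fixed point. -/
theorem exists_response_eq (hA : G.HypothesisA) (hB : G.HypothesisB)
    (μ₀ : ProbabilityMeasure (Euc d)) :
    ∃ μ, G.IsCurve μ ∧ EqOn (G.response μ₀ μ) μ G.I := by
  have hcpt : CompactSpace G.I := isCompact_iff_compactSpace.1 isCompact_Icc
  have hsol := fun (f : G.I →ᵇ C0Dual d) (hf : f ∈ G.flowSet) =>
    isKineticSolution_response (μ₀ := μ₀) hA hB (isCurve_toFlow hf)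
  have hex : ∀ f ∈ G.flowSet, ∃ g : G.I →ᵇ C0Dual d,
      ∀ t : G.I, g t = probDual (G.response μ₀ (toFlow f) t) := fun f hf =>
    ⟨BoundedContinuousFunction.mkOfCompact ⟨_, continuousOn_iff_continuous_domRestrict.1
      (isCurve_iff.1 (hsol f hf).curve)⟩, fun _ => rfl⟩
  choose! Φ hΦ using hex
  have hmaps : MapsTo Φ G.flowSet G.flowSet := fun f hf t => ⟨_, (hΦ f hf t).symm⟩
  have hcont : ContinuousOn Φ G.flowSet := by
    intro f hf
    rw [ContinuousWithinAt, tendsto_iff_dist_tendsto_zero]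
    have h1 : Tendsto (fun g => dist g f) (𝓝[G.flowSet] f) (𝓝 0) :=
      (tendsto_iff_dist_tendsto_zero.1 tendsto_id).mono_left nhdsWithin_le_nhds
    refine squeeze_zero' (Eventually.of_forall fun _ => dist_nonneg) ?_
      ((tendsto_responseModulus hA hB).comp h1)
    filter_upwards [self_mem_nhdsWithin] with g hg
    have : Nonempty G.I := ⟨⟨0, G.left_mem_I⟩⟩
    refine (BoundedContinuousFunction.dist_le_iff_of_nonempty).2 fun t => ?_
    rw [hΦ g hg, hΦ f hf]
    refine dist_response_le hA hB (isCurve_toFlow hg) (isCurve_toFlow hf) (fun s _ => ?_) t t.2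
    rw [probDual_toFlow hg, probDual_toFlow hf, ← dist_eq_norm]
    exact BoundedContinuousFunction.dist_coe_le_dist _
  -- Arzelà–Ascoli in the space of curves: pointwise compactness comes from the reachable set for
  -- the common Lipschitz constant of the controls, equicontinuity from the uniform bound on the
  -- time derivative.
  have hK : IsCompact (closure (Φ '' G.flowSet)) := by
    refine BoundedContinuousFunction.arzela_ascoli
      (closure (G.reachSet μ₀ (hB.lΘ / hB.conc)))
      ((totallyBounded_reachSet hA hB.U_compact μ₀ _).closure.isCompact_of_isClosed
        isClosed_closure) _ ?_ ?_
    · rintro _ t ⟨f, hf, rfl⟩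
      rw [hΦ f hf]
      exact subset_closure ⟨_, _, isContFeedback_control hA hB (isCurve_toFlow hf),
        control_mem_lipControls hA hB (isCurve_toFlow hf), hsol f hf, t, t.2, rfl⟩
    · refine UniformEquicontinuous.equicontinuous (LipschitzWith.uniformEquicontinuous _
        (Real.toNNReal (hA.mass * 2)) ?_)
      rintro ⟨_, f, hf, rfl⟩
      refine LipschitzWith.of_dist_le' fun s t => ?_
      change dist (Φ f s) (Φ f t) ≤ _
      rw [hΦ f hf, hΦ f hf, dist_eq_norm, Subtype.dist_eq, dist_eq_norm]
      exact (hsol f hf).norm_probDual_sub_le hA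
        (isContFeedback_control hA hB (isCurve_toFlow hf)) s.2 t.2
  obtain ⟨f, hf, hfix⟩ := exists_fixedPoint_of_isCompact convex_flowSet
    ⟨BoundedContinuousFunction.const _ (probDual μ₀), fun _ => ⟨μ₀, rfl⟩⟩ isClosed_flowSet hcont
    hmaps hK fun f hf => subset_closure (mem_image_of_mem _ hf)
  refine ⟨toFlow f, isCurve_toFlow hf, fun t ht => probDual_injective ?_⟩
  have := hΦ f hf ⟨t, ht⟩
  rw [hfix] at this
  rw [probDual_toFlow hf, pr_of_mem ht, this]

end MeanFieldGame

end

/-! ### The main theorem, assembled. -/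

open MeanFieldGame in
theorem mainTheorem4 {d m : ℕ} (G : MeanFieldGame d m) (hA : G.HypothesisA) (hB : G.HypothesisB)
    (μ₀ : ProbabilityMeasure (Euc d)) :
    ∃ (𝒱 : (ℝ → ProbabilityMeasure (Euc d)) → ℝ → Euc d → ℝ)
      (Γ : (ℝ → ProbabilityMeasure (Euc d)) → ℝ → Euc d → Euc m)
      (𝒯 : (ℝ → ProbabilityMeasure (Euc d)) → ℝ → ProbabilityMeasure (Euc d)),
      (∀ μ, G.IsCurve μ →
        (∀ V, G.IsHJBSolution μ V ↔ ∀ t ∈ G.I, ∀ x, V t x = 𝒱 μ t x) ∧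
        (∀ t ∈ G.I, ∀ x u, G.IsMaximizer μ (𝒱 μ) t x u ↔ u = Γ μ t x) ∧
        G.IsOptimalFeedback μ (𝒱 μ) (Γ μ) ∧
        (∀ η, G.IsKineticSolution μ₀ (Γ μ) η ↔ EqOn η (𝒯 μ) G.I)) ∧
      ∃ μ, G.IsCurve μ ∧ EqOn (𝒯 μ) μ G.I ∧ G.IsKineticSolution μ₀ (Γ μ) μ := by
  refine ⟨G.value, G.control, G.response μ₀, fun μ hμ => ?_, ?_⟩
  · have hV := isHJBSolution_value hA hB hμ
    have hγ := isContFeedback_control hA hB hμ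
    have hη := isKineticSolution_response (μ₀ := μ₀) hA hB hμ
    exact ⟨fun V => ⟨fun h => h.unique hA hB hμ hV, hV.congr hA hB hμ⟩,
      fun t ht x u => isMaximizer_iff hA hB hμ hV ht, isOptimalFeedback_argmax hA hB hμ hV,
      fun η => ⟨fun h => h.unique hA hγ hη, hη.congr hA hγ⟩⟩
  · obtain ⟨μ, hμ, hfix⟩ := exists_response_eq hA hB μ₀
    exact ⟨μ, hμ, hfix, (isKineticSolution_response hA hB hμ).congr hA
      (isContFeedback_control hA hB hμ) hfix.symm⟩
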